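/- **Setting.** Let $V\colon\mathbb R\to\mathbb R\cup\{+\infty\}$ be measurable, with $e^{-V}$ bounded and continuous, $0<\int e^{-V(x)}\,dx<\infty$, $\int x^2e^{-V(x)}\,dx<\infty$ and $\int xe^{-V(x)}\,dx=0$. Let $\Delta\phi_k=\phi_{k+1}+\phi_{k-1}-2\phi_k$ and $\mathcal H_N(\phi)=\sum_{k=0}^{N}V(\Delta\phi_k)$ for $\phi\colon\{-1,0,\dots,N+1\}\to\mathbb R$. For $a,\alpha,b,\beta\in\mathbb R$ consider the boundary values $\psi_{-1}=aN^2-\alpha N$, $\psi_0=aN^2$, $\psi_N=bN^2$, $\psi_{N+1}=bN^2+\beta N$ and, with normalising constants $Z_N$, the probability measures $$\gamma_N^{(a,\alpha)}(d\phi)=\tfrac1{Z_N(a,\alpha)}e^{-\mathcal H_N(\phi)}\prod_{k=1}^{N+1}d\phi_k\prod_{k\in\{-1,0\}}\delta_{\psi_k}(d\phi_k),$$ $$\gamma_N^{(a,\alpha,b,\beta)}(d\phi)=\tfrac1{Z_N(a,\alpha,b,\beta)}e^{-\mathcal H_N(\phi)}\prod_{k=1}^{N-1}d\phi_k\prod_{k\in\{-1,0,N,N+1\}}\delta_{\psi_k}(d\phi_k).$$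 Let $h_N\in C([0,1])$ be the empirical profile, i.e. the linear interpolation of $h_N(k/N)=\phi_k/N^2$, $0\le k\le N$. A sequence of random elements of $C([0,1])$ (with the supremum norm) with laws $\mu_N$ satisfies the LDP with speed $N$ and good rate function $I\colon C([0,1])\to[0,\infty]$ if $I$ is lower semicontinuous with compact sublevel sets, $\liminf_N\frac1N\log\mu_N(O)\ge-\inf_OI$ for all open $O$, and $\limsup_N\frac1N\log\mu_N(K)\le-\inf_KI$ for all closed $K$. Write $W^{2,p}$ for the Sobolev space $W^{2,p}(0,1)\subset C^1([0,1])$, $p\ge1$, and $H^2=W^{2,2}$. **Theorem.** (a) Let $X_1$ have density proportional to $e^{-V}$, suppose that $\Lambda(\lambda)=\log\mathbb E[e^{\lambda X_1}]<\infty$ for all $\lambda\in\mathbb R$, and let $\Lambda^*(x)=\sup_{\lambda}(\lambda x-\Lambda(\lambda))$. For all $a,\alpha\in\mathbb R$, $h_N$ under $\gamma_N^{(a,\alpha)}$ satisfies the LDP on $C([0,1])$ with speed $N$ and the good rate function $$\mathscr E_f(h)=\begin{cases}\int_0^1\Lambda^*(\ddot h(t))\,dt&\text{if }h\in W^{2,1},\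 h(0)=a,\ \dot h(0)=\alpha,\\+\infty&\text{otherwise.}\end{cases}$$ If moreover there is a constant $C$ with $\Lambda(\lambda)\le C(1+\lambda^2)$ for all $\lambda\in\mathbb R$, then the same holds with $H^2$ in place of $W^{2,1}$ in the definition of $\mathscr E_f$. (b) Let $V(\eta)=\frac12\eta^2$. For all $a,\alpha,b,\beta\in\mathbb R$ the function $$\mathscr E(h)=\begin{cases}\frac12\int_0^1\ddot h(t)^2\,dt&\text{if }h\in H^2,\ h(0)=a,\ \dot h(0)=\alpha,\ h(1)=b,\ \dot h(1)=\beta,\\+\infty&\text{otherwise}\end{cases}$$ on $C([0,1])$ is lower semicontinuous with compact sublevel sets, and $h_N$ under $\gamma_N^{(a,\alpha,b,\beta)}$ satisfies the LDP on $C([0,1])$ with speed $N$ and the good rate function $\mathscr E-\inf\mathscr E$. -/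

import Mathlib

open MeasureTheory Filter Topology
open scoped ENNReal NNReal unitInterval

noncomputable section

namespace LaplacianModel

/-! ## The model -/

/-- The discrete Laplacian `Δφ_k = φ_{k+1} + φ_{k-1} - 2 φ_k`. -/
def discreteLaplacian (φ : ℤ → ℝ) (k : ℤ) : ℝ := φ (k + 1) + φ (k - 1) - 2 * φ k

/-- The Hamiltonian `H_{[ℓ,r]}(φ) = ∑_{k=ℓ+1}^{r-1} V(Δφ_k)`, for `V` with values in `ℝ ∪ {+∞}`. -/
def hamiltonian (V : ℝ → EReal) (l r : ℤ) (φ : ℤ → ℝ) : EReal :=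
  ∑ k ∈ Finset.Ioo l r, V (discreteLaplacian φ k)

/-- The standing assumptions on the potential `V : ℝ → ℝ ∪ {+∞}`. Positivity of `∫ exp(-V)` only
says that `exp(-V)` can be normalised to a probability density. -/
structure IsPotential (V : ℝ → EReal) : Prop where
  ne_bot : ∀ x, V x ≠ ⊥
  measurable : Measurable V
  continuous_exp : Continuous fun x => EReal.exp (-V x)
  bounded_exp : ∃ C : ℝ≥0, ∀ x, EReal.exp (-V x) ≤ C
  lintegral_pos : 0 < ∫⁻ x, EReal.exp (-V x)
  lintegral_lt_top : ∫⁻ x, EReal.exp (-V x) < ∞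
  sq_lintegral_lt_top : ∫⁻ x, ENNReal.ofReal (x ^ 2) * EReal.exp (-V x) < ∞
  integral_eq_zero : ∫ x, x * (EReal.exp (-V x)).toReal = 0

/-- The Gaussian potential `V(η) = η² / 2`. -/
def gaussianPotential (η : ℝ) : EReal := ((η ^ 2 / 2 : ℝ) : EReal)

/-- The configuration equal to `x` on the free sites `S` and to `ψ` elsewhere. -/
def glue (ψ : ℤ → ℝ) (S : Finset ℤ) (x : S → ℝ) : ℤ → ℝ :=
  fun k => if hk : k ∈ S then x ⟨k, hk⟩ else ψ k

/-- The product measure `∏_{k ∈ S} dφ_k ∏_{k ∉ S} δ_{ψ_k}(dφ_k)`. -/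
def referenceMeasure (ψ : ℤ → ℝ) (S : Finset ℤ) : Measure (ℤ → ℝ) :=
  (volume : Measure (S → ℝ)).map (glue ψ S)

/-- The partition function of the model on `{-1, …, N+1}` with free sites `S` and
boundary condition `ψ`. -/
def partitionFunction (V : ℝ → EReal) (N : ℕ) (ψ : ℤ → ℝ) (S : Finset ℤ) : ℝ≥0∞ :=
  ∫⁻ φ, EReal.exp (-hamiltonian V (-1) (N + 1) φ) ∂(referenceMeasure ψ S)

/-- The Gibbs measure `Z⁻¹ exp(-H_{[-1,N+1]}(φ)) ∏_{k ∈ S} dφ_k ∏_{k ∉ S} δ_{ψ_k}(dφ_k)`. -/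
def gibbsMeasure (V : ℝ → EReal) (N : ℕ) (ψ : ℤ → ℝ) (S : Finset ℤ) : Measure (ℤ → ℝ) :=
  (partitionFunction V N ψ S)⁻¹ •
    (referenceMeasure ψ S).withDensity fun φ => EReal.exp (-hamiltonian V (-1) (N + 1) φ)

/-- Microscopic Dirichlet boundary condition for `r = (a, α, b, β)`. -/
def dirichletBoundary (a α b β : ℝ) (N : ℕ) (x : ℤ) : ℝ :=
  if x = -1 then a * N ^ 2 - α * N
  else if x = 0 then a * N ^ 2
  else if x = N then b * N ^ 2
  else if x = N + 1 then b * N ^ 2 + β * N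
  else 0

/-- Microscopic boundary condition for `(a, α)`, free on the right. -/
def freeBoundary (a α : ℝ) (N : ℕ) (x : ℤ) : ℝ :=
  if x = -1 then a * N ^ 2 - α * N
  else if x = 0 then a * N ^ 2
  else 0

/-- `γ_N^r`, `r = (a, α, b, β)`: the free sites are `1, …, N-1`. -/
def dirichletGibbs (V : ℝ → EReal) (a α b β : ℝ) (N : ℕ) : Measure (ℤ → ℝ) :=
  gibbsMeasure V N (dirichletBoundary a α b β N) (Finset.Icc 1 ((N : ℤ) - 1))

/-- `γ_N^a` for the boundary data `(a, α)`: the free sites are `1, …, N+1`. -/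
def freeGibbs (V : ℝ → EReal) (a α : ℝ) (N : ℕ) : Measure (ℤ → ℝ) :=
  gibbsMeasure V N (freeBoundary a α N) (Finset.Icc 1 ((N : ℤ) + 1))

/-! ## The empirical profile -/

lemma locallyFinite_Icc_int : LocallyFinite fun n : ℤ => Set.Icc (n : ℝ) (n + 1) := by
  intro x
  refine ⟨Metric.ball x 1, Metric.ball_mem_nhds x one_pos,
    (Set.finite_Icc (⌊x⌋ - 2) (⌊x⌋ + 2)).subset ?_⟩
  rintro n ⟨y, ⟨hy1, hy2⟩, hy⟩
  rw [Metric.mem_ball, Real.dist_eq, abs_lt] at hy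
  have h1 := Int.floor_le x
  have h2 := Int.lt_floor_add_one x
  constructor
  · have h : ((⌊x⌋ - 2 : ℤ) : ℝ) < ((n : ℤ) : ℝ) + 1 := by push_cast; linarith
    have h' : ⌊x⌋ - 2 < n + 1 := by exact_mod_cast h
    omega
  · have h : (n : ℝ) < ((⌊x⌋ + 2 : ℤ) : ℝ) := by push_cast; linarith
    have h' : n < ⌊x⌋ + 2 := by exact_mod_cast h
    omega

lemma continuous_interpolation (φ : ℤ → ℝ) :
    Continuous fun x : ℝ =>
      ((⌊x⌋ : ℝ) - x + 1) * φ ⌊x⌋ + (x - (⌊x⌋ : ℝ)) * φ (⌊x⌋ + 1) := by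
  refine locallyFinite_Icc_int.continuous ?_ (fun _ => isClosed_Icc) fun n => ?_
  · refine Set.eq_univ_of_forall fun x => Set.mem_iUnion.2 ⟨⌊x⌋, Int.floor_le x, ?_⟩
    exact (Int.lt_floor_add_one x).le
  · have hc : ContinuousOn (fun x : ℝ => ((n : ℝ) - x + 1) * φ n + (x - (n : ℝ)) * φ (n + 1))
        (Set.Icc (n : ℝ) (n + 1)) := by fun_prop
    refine hc.congr fun x hx => ?_
    rcases hx.2.lt_or_eq with h | h
    · have hf : ⌊x⌋ = n := Int.floor_eq_iff.2 ⟨hx.1, h⟩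
      simp only [hf]
    · have hf : ⌊x⌋ = n + 1 := by
        rw [h]
        exact_mod_cast Int.floor_intCast (R := ℝ) (n + 1)
      simp only [hf]
      rw [h]
      push_cast
      ring

/-- The macroscopic empirical profile
`h_N(t) = (⌊Nt⌋ - Nt + 1) / N² · φ_{⌊Nt⌋} + (Nt - ⌊Nt⌋) / N² · φ_{⌊Nt⌋+1}`, `t ∈ [0,1]`. -/
def profile (N : ℕ) (φ : ℤ → ℝ) : C(I, ℝ) where
  toFun t :=
    ((⌊(N : ℝ) * t⌋ : ℝ) - N * t + 1) / (N : ℝ) ^ 2 * φ ⌊(N : ℝ) * t⌋ +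
      ((N : ℝ) * t - (⌊(N : ℝ) * t⌋ : ℝ)) / (N : ℝ) ^ 2 * φ (⌊(N : ℝ) * t⌋ + 1)
  continuous_toFun := by
    have hm : Continuous fun t : I => (N : ℝ) * (t : ℝ) := by fun_prop
    have h := ((continuous_interpolation φ).comp hm).div_const ((N : ℝ) ^ 2)
    refine h.congr fun t => ?_
    simp only [Function.comp_apply]
    ring

/-! ## Large deviation principles with speed `N` -/

/-- Good rate functions: lower semicontinuous with compact sublevel sets. -/
structure IsGoodRateFunction {E : Type*} [TopologicalSpace E] (J : E → ℝ≥0∞) : Prop where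
  lowerSemicontinuous : LowerSemicontinuous J
  isCompact_sublevel : ∀ c : ℝ≥0, IsCompact {x | J x ≤ c}

/-- The large deviation principle, with speed `N` and good rate function `J`, for the random
elements `X N` of `E` under the measures `P N`. -/
structure SatisfiesLDP {Ω E : Type*} [MeasurableSpace Ω] [TopologicalSpace E]
    (P : ℕ → Measure Ω) (X : ℕ → Ω → E) (J : E → ℝ≥0∞) : Prop where
  good : IsGoodRateFunction J
  lower_bound : ∀ O : Set E, IsOpen O →
    -(⨅ h ∈ O, (J h : EReal)) ≤
      liminf (fun N : ℕ => ENNReal.log (P N (X N ⁻¹' O)) / (N : EReal)) atTop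
  upper_bound : ∀ K : Set E, IsClosed K →
    limsup (fun N : ℕ => ENNReal.log (P N (X N ⁻¹' K)) / (N : EReal)) atTop ≤
      -(⨅ h ∈ K, (J h : EReal))

/-- The rate function `J - inf J` attached to an unnormalised rate function `J`. -/
def normalised {E : Type*} (J : E → ℝ≥0∞) (h : E) : ℝ≥0∞ := J h - ⨅ g, J g

/-! ## Sobolev spaces on the unit interval -/

/-- `v` is a weak derivative of `u` on `(0,1)`. -/
def HasWeakDeriv (u v : ℝ → ℝ) : Prop :=
  ∀ η : ℝ → ℝ, ContDiff ℝ ((⊤ : ℕ∞) : WithTop ℕ∞) η → HasCompactSupport η → tsupport η ⊆ Set.Ioo 0 1 →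
    ∫ t in Set.Ioo (0 : ℝ) 1, u t * deriv η t = -∫ t in Set.Ioo (0 : ℝ) 1, v t * η t

/-- The function on `ℝ` extending `h : [0,1] → ℝ` (constant on each side of the interval). -/
def extend (h : C(I, ℝ)) : ℝ → ℝ := Set.IccExtend zero_le_one h

/-- `h` belongs to the Sobolev space `W^{2,p}` of the unit interval and `g` is a representative of
its second weak derivative. -/
def HasSecondWeakDeriv (p : ℝ≥0∞) (h : C(I, ℝ)) (g : ℝ → ℝ) : Prop :=
  ∃ v : ℝ → ℝ,
    MemLp (extend h) p (volume.restrict (Set.Ioo 0 1)) ∧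
    MemLp v p (volume.restrict (Set.Ioo 0 1)) ∧
    MemLp g p (volume.restrict (Set.Ioo 0 1)) ∧
    HasWeakDeriv (extend h) v ∧ HasWeakDeriv v g

/-- `h(0) = a` and `ḣ(0) = α`. Elements of `W^{2,p}` are continuously differentiable up to the
boundary, so the boundary value of `ḣ` is the one-sided derivative of `h`. -/
def LeftBoundary (a α : ℝ) (h : C(I, ℝ)) : Prop :=
  h 0 = a ∧ HasDerivWithinAt (extend h) α (Set.Icc 0 1) 0

/-- `h(1) = b` and `ḣ(1) = β`. -/
def RightBoundary (b β : ℝ) (h : C(I, ℝ)) : Prop :=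
  h 1 = b ∧ HasDerivWithinAt (extend h) β (Set.Icc 0 1) 1

/-! ## Rate functions -/

/-- The law of an increment `X₁`, with density proportional to `exp(-V)`. -/
def incrementLaw (V : ℝ → EReal) : Measure ℝ :=
  (∫⁻ x, EReal.exp (-V x))⁻¹ • volume.withDensity fun x => EReal.exp (-V x)

/-- The logarithmic moment generating function `Λ(s) = log E[exp(s X₁)]`. -/
def logMGF (V : ℝ → EReal) (s : ℝ) : ℝ := ProbabilityTheory.cgf id (incrementLaw V) s

/-- The Fenchel-Legendre transform of `L`. -/
def legendre (L : ℝ → ℝ) (x : ℝ) : EReal := ⨆ s : ℝ, ((s * x - L s : ℝ) : EReal)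

/-- `∫₀¹ Λ*(ḧ(t)) dt` if `h ∈ W^{2,p}`, `h(0) = a`, `ḣ(0) = α`, and `+∞` otherwise. The second
weak derivative `g` of `h` is unique up to null sets, so the infimum is over at most one value,
and it is `+∞` if there is none. As `Λ(0) = 0`, `Λ*` is nonnegative, so that `toENNReal` does not
change its values. -/
def freeRate (V : ℝ → EReal) (p : ℝ≥0∞) (a α : ℝ) (h : C(I, ℝ)) : ℝ≥0∞ :=
  ⨅ (g : ℝ → ℝ) (_ : HasSecondWeakDeriv p h g ∧ LeftBoundary a α h),
    ∫⁻ t in Set.Ioo (0 : ℝ) 1, (legendre (logMGF V) (g t)).toENNReal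

/-- `½ ∫₀¹ ḧ(t)² dt` if `h ∈ H²`, `h(0) = a`, `ḣ(0) = α`, `h(1) = b`, `ḣ(1) = β`, and `+∞`
otherwise. -/
def dirichletRate (a α b β : ℝ) (h : C(I, ℝ)) : ℝ≥0∞ :=
  ⨅ (g : ℝ → ℝ) (_ : HasSecondWeakDeriv 2 h g ∧ LeftBoundary a α h ∧ RightBoundary b β h),
    (1 / 2) * ∫⁻ t in Set.Ioo (0 : ℝ) 1, ENNReal.ofReal (g t ^ 2)

end LaplacianModel

end

open LaplacianModel

open LaplacianModel
open MeasureTheory Filter Topology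
open scoped ENNReal NNReal unitInterval

namespace LaplacianModel

/-! ## A local criterion for large deviation principles -/

/-! Both parts are reduced by `SatisfiesLDP.of_local` to three statements: a neighbourhood of each
`h` with `J h > M` has probability at most `exp (-M N)`; compact sets carry all but `exp (-M N)` of
the mass; every neighbourhood of an `h` with `J h < M` has probability at least `exp (-M N)`. Lower
semicontinuity and compactness of sublevel sets then come for free, by playing upper and lower
bounds against each other.

By the discrete Taylor formula (`profile_eq`) the profile is a linear image of the discrete
Laplacians with kernel `(Nt - i)⁺`, the same kernel that recovers a function from its second
derivative (`IsSecondPrimitive.extend_eq`). With free right end, passing from heights to Laplacians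
is a unimodular affine map, so the Laplacians are i.i.d. (`map_freeGibbs`), and the claim is a
Mogulskii theorem for the twice integrated noise.

The upper bounds and tightness use only exponential moments (`ExpBound`), so they serve both parts.
The set where the energy is at most `M` is described in duality (`VariationBound`): for every `δ >
0` the backward difference quotients of step `δ` satisfy a family of inequalities `∑ s (v(b) - v(a))
≤ M + ∑ L(s) (b - a)`. A violated inequality involves finitely many values of `h`, hence persists on
an open set, where Chernoff's inequality and Jensen's inequality give the exponential bound
(`exists_open_of_not_isSecondPrimitive`). Conversely, if all inequalities hold, the limit `δ → 0`
gives an absolutely continuous derivative, and Fatou's lemma bounds the integral of the Legendre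
transform of its derivative (`exists_second_derivative_of_variationBound`).

The lower bound in (a) is exponential tilting around a sampled profile (`eventually_le_freeGibbs`).
The Laplacians of the sample are averages of `g` against tent functions, so Jensen bounds their
total cost by `N ∫ Λ*(g)`. Truncating `g` where `Λ*(g)` is large and multiplying it by `1 - κ` keeps
the tilting parameters in a bounded set, uniformly in `N`; Chebyshev's inequality then suffices.
Under quadratic growth of `Λ`, `Λ*` dominates a multiple of `x²` up to a constant, so finite rate
forces a square integrable second derivative (`freeRate_two_eq`).

In (b) the Gibbs measure is a centred Gaussian translated by the equilibrium configuration
(`IsEquilibrium.gibbsMeasure_eq`). Conditioning costs at most the exponential of the equilibrium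
energy (`IsEquilibrium.lintegral_exp_le`), which is `N inf 𝓔` up to a bounded error; this produces
the subtraction of `inf 𝓔`. For the lower bound, a symmetric ball of probability at least `1/2` is
translated at the price given by a Cameron–Martin inequality (`mul_gaussLaw_le`), and Pythagoras
identifies that price with the excess energy. The value of the slope at `1` is not a continuous
functional of the profile, so a wrong slope there needs its own Chernoff bound
(`exists_open_of_slope_ne`). -/

lemma ofReal_exp_eq (x : ℝ) : ENNReal.ofReal (Real.exp x) = EReal.exp (x : EReal) := by
  rw [EReal.exp_coe]

lemma log_ofReal_exp (x : ℝ) : ENNReal.log (ENNReal.ofReal (Real.exp x)) = (x : EReal) := by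
  rw [ofReal_exp_eq, EReal.log_exp]

lemma neg_le_log_div {p : ℝ≥0∞} {M : ℝ} {N : ℕ} (hN : 0 < N)
    (h : ENNReal.ofReal (Real.exp (-(M * N))) ≤ p) :
    ((-M : ℝ) : EReal) ≤ ENNReal.log p / (N : EReal) := by
  rw [EReal.le_div_iff_mul_le (by exact_mod_cast hN) (EReal.natCast_ne_top N)]
  have := ENNReal.log_monotone h
  rw [log_ofReal_exp] at this
  refine le_trans (le_of_eq ?_) this
  norm_cast
  simp

lemma log_div_le_neg {p : ℝ≥0∞} {M : ℝ} {N : ℕ} (hN : 0 < N)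
    (h : p ≤ ENNReal.ofReal (Real.exp (-(M * N)))) :
    ENNReal.log p / (N : EReal) ≤ ((-M : ℝ) : EReal) := by
  rw [EReal.div_le_iff_le_mul (by exact_mod_cast hN) (EReal.natCast_ne_top N)]
  have := ENNReal.log_monotone h
  rw [log_ofReal_exp] at this
  refine this.trans (le_of_eq ?_)
  norm_cast
  ring

/-- Constants are absorbed by an exponential with a better rate. -/
lemma eventually_const_mul_exp_le {M M' : ℝ} (h : M' < M) (C D : ℝ) :
    ∀ᶠ N : ℕ in atTop, C * Real.exp (D - M * N) ≤ Real.exp (-(M' * N)) := by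
  have h1 : Tendsto (fun N : ℕ => (M - M') * (N : ℝ)) atTop atTop :=
    tendsto_natCast_atTop_atTop.const_mul_atTop (sub_pos.2 h)
  have h2 := (Real.tendsto_exp_atTop.comp h1).eventually_ge_atTop (C * Real.exp D)
  filter_upwards [h2] with N hN
  simp only [Function.comp_apply] at hN
  calc C * Real.exp (D - M * N) = C * Real.exp D * Real.exp (-(M * N)) := by
        rw [mul_assoc, ← Real.exp_add]; ring_nf
    _ ≤ Real.exp ((M - M') * N) * Real.exp (-(M * N)) := by gcongr
    _ = Real.exp (-(M' * N)) := by rw [← Real.exp_add]; ring_nf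

lemma eventually_const_mul_ofReal_exp_le {M M' : ℝ} (h : M' < M) (C D : ℝ) :
    ∀ᶠ N : ℕ in atTop, ENNReal.ofReal (C * Real.exp (D - M * N)) ≤
      ENNReal.ofReal (Real.exp (-(M' * N))) :=
  (eventually_const_mul_exp_le h C D).mono fun _ hN => ENNReal.ofReal_le_ofReal hN

/-- Both bounds hold at some common `N > 0`, where the exponents can be compared. This confrontation
of a lower with an upper bound is what makes the rate function good. -/
lemma le_of_eventually_exp_le {p : ℕ → ℝ≥0∞} {M M' : ℝ}
    (h1 : ∀ᶠ N : ℕ in atTop, ENNReal.ofReal (Real.exp (-(M' * N))) ≤ p N)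
    (h2 : ∀ᶠ N : ℕ in atTop, p N ≤ ENNReal.ofReal (Real.exp (-(M * N)))) : M ≤ M' := by
  obtain ⟨N, ha, hb, hN⟩ := (h1.and (h2.and (eventually_gt_atTop 0))).exists
  have := ha.trans hb
  rw [ENNReal.ofReal_le_ofReal_iff (Real.exp_pos _).le, Real.exp_le_exp] at this
  have hN' : (0 : ℝ) < N := by exact_mod_cast hN
  nlinarith

/-- Local upper bounds, exponential tightness and local lower bounds imply the large deviation
principle, including the goodness of the rate function. -/
theorem SatisfiesLDP.of_local {Ω E : Type*} [MeasurableSpace Ω] [TopologicalSpace E] [T2Space E]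
    {P : ℕ → Measure Ω} {X : ℕ → Ω → E} {J : E → ℝ≥0∞}
    (hU : ∀ h, ∀ M : ℝ, (M : EReal) < J h → ∃ U, IsOpen U ∧ h ∈ U ∧
      ∀ᶠ N : ℕ in atTop, P N (X N ⁻¹' U) ≤ ENNReal.ofReal (Real.exp (-(M * N))))
    (hT : ∀ M : ℝ, ∃ K, IsCompact K ∧
      ∀ᶠ N : ℕ in atTop, P N (X N ⁻¹' Kᶜ) ≤ ENNReal.ofReal (Real.exp (-(M * N))))
    (hL : ∀ h, ∀ M : ℝ, (J h : EReal) < M → ∀ U, IsOpen U → h ∈ U →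
      ∀ᶠ N : ℕ in atTop, ENNReal.ofReal (Real.exp (-(M * N))) ≤ P N (X N ⁻¹' U)) :
    SatisfiesLDP P X J := by
  -- A point `h'` of `U` with a smaller rate would, by its own local lower bound, give `U` more mass
  -- than the upper bound at `h` permits.
  have hlsc : LowerSemicontinuous J := by
    intro h y hy
    have hy' : (y : EReal) < (J h : EReal) := by exact_mod_cast hy
    obtain ⟨M, hM1, hM2⟩ := EReal.lt_iff_exists_real_btwn.1 hy'
    obtain ⟨U, hUo, hhU, hUP⟩ := hU h M hM2
    filter_upwards [hUo.mem_nhds hhU] with h' hh'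
    by_contra hcon
    have h3 : (J h' : EReal) < M := lt_of_le_of_lt (by exact_mod_cast not_lt.1 hcon) hM1
    obtain ⟨M', hM'1, hM'2⟩ := EReal.lt_iff_exists_real_btwn.1 h3
    have := le_of_eventually_exp_le (hL h' M' hM'1 U hUo hh') hUP
    exact absurd hM'2 (not_lt.2 (by exact_mod_cast this))
  refine ⟨⟨hlsc, fun c => ?_⟩, fun O hO => ?_, fun K hK => ?_⟩
  -- The complement of `K` is open: a point of the sublevel set lying there would give it mass at
  -- least `exp (-(c+1) N)`, against the bound `exp (-(c+2) N)`.
  · obtain ⟨K, hKc, hKP⟩ := hT (c + 2)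
    refine hKc.of_isClosed_subset (hlsc.isClosed_preimage c) fun h hh => ?_
    by_contra hcon
    have hh1 : (J h : EReal) < ((c + 1 : ℝ) : EReal) := by
      have h1 : (J h : EReal) ≤ ((c : ℝ≥0∞) : EReal) := by exact_mod_cast hh
      refine lt_of_le_of_lt h1 ?_
      have : (((c : ℝ≥0∞) : EReal)) = ((c : ℝ) : EReal) := rfl
      rw [this]
      exact_mod_cast lt_add_one (c : ℝ)
    have := le_of_eventually_exp_le (hL h _ hh1 Kᶜ hKc.isClosed.isOpen_compl hcon) hKP
    linarith
  · rw [EReal.neg_le]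
    refine le_iInf₂ fun h hh => ?_
    rw [EReal.neg_le]
    by_contra hcon
    obtain ⟨r, hr1, hr2⟩ := EReal.lt_iff_exists_real_btwn.1 (not_le.1 hcon)
    have hJ : (J h : EReal) < ((-r : ℝ) : EReal) := by
      rw [EReal.coe_neg]
      exact EReal.lt_neg_comm.1 hr2
    refine absurd hr1 (not_lt.2 ?_)
    refine le_liminf_of_le (by isBoundedDefault) ?_
    filter_upwards [hL h (-r) hJ O hO hh, eventually_gt_atTop 0] with N hN hN0
    simpa using neg_le_log_div hN0 hN
  · by_contra hcon
    obtain ⟨r, hr1, hr2⟩ := EReal.lt_iff_exists_real_btwn.1 (not_le.1 hcon)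
    refine absurd hr2 (not_lt.2 ?_)
    -- The gap between `r'` and `r` absorbs the number of sets in the finite cover.
    obtain ⟨r', hr'1, hr'2⟩ := EReal.lt_iff_exists_real_btwn.1 hr1
    have hlt : r' < r := by exact_mod_cast hr'2
    have hJ : ∀ h ∈ K, ((-r' : ℝ) : EReal) < J h := fun h hh => by
      have h1 : -(⨅ h ∈ K, (J h : EReal)) < r' := hr'1
      have h2 : ((-r' : ℝ) : EReal) < ⨅ h ∈ K, (J h : EReal) := by
        rw [EReal.coe_neg]; exact EReal.neg_lt_comm.1 h1
      exact h2.trans_le (iInf₂_le h hh)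
    obtain ⟨K', hK'c, hK'P⟩ := hT (-r')
    have hcomp : IsCompact (K' ∩ K) := hK'c.inter_right hK
    choose! U hUo hhU hUP using fun h (hh : h ∈ K) => hU h (-r') (hJ h hh)
    obtain ⟨t, hcov⟩ := hcomp.elim_nhds_subcover' (fun h _ => U h)
      fun h hh => (hUo h hh.2).mem_nhds (hhU h hh.2)
    have hev : ∀ᶠ N : ℕ in atTop, ∀ x ∈ t, P N (X N ⁻¹' U x) ≤
        ENNReal.ofReal (Real.exp (-(-r' * N))) := by
      rw [eventually_all_finset]
      exact fun x _ => hUP x x.2.2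
    refine limsup_le_of_le (by isBoundedDefault) ?_
    filter_upwards [hev, hK'P, eventually_gt_atTop 0,
      eventually_const_mul_ofReal_exp_le (show -r < -r' by linarith) (t.card + 1) 0]
      with N hN1 hN2 hN0 hN3
    have hb : P N (X N ⁻¹' K) ≤ ENNReal.ofReal (Real.exp (-(-r * N))) := by
      refine le_trans ?_ hN3
      have hsub : X N ⁻¹' K ⊆ (⋃ x ∈ t, X N ⁻¹' U x) ∪ X N ⁻¹' K'ᶜ := by
        intro ω hω
        by_cases hω' : X N ω ∈ K'
        · left
          have := hcov ⟨hω', hω⟩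
          simpa using this
        · right; exact hω'
      calc P N (X N ⁻¹' K) ≤ P N (⋃ x ∈ t, X N ⁻¹' U x) + P N (X N ⁻¹' K'ᶜ) :=
            (measure_mono hsub).trans (measure_union_le _ _)
        _ ≤ ∑ x ∈ t, P N (X N ⁻¹' U x) + P N (X N ⁻¹' K'ᶜ) := by
            gcongr; exact measure_biUnion_finset_le _ _
        _ ≤ ∑ x ∈ t, ENNReal.ofReal (Real.exp (-(-r' * N))) +
              ENNReal.ofReal (Real.exp (-(-r' * N))) := by
            gcongr with x hx; exact hN1 x hx
        _ = ENNReal.ofReal ((t.card + 1) * Real.exp (0 - -r' * N)) := by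
            rw [ENNReal.ofReal_mul (by positivity), Finset.sum_const, nsmul_eq_mul,
              ENNReal.ofReal_add (by positivity) zero_le_one, zero_sub]
            simp [add_mul]
    simpa using log_div_le_neg hN0 hb

/-! ## The Legendre transform with values in `[0, ∞]` -/

/-- The positive part of the Fenchel-Legendre transform. -/
noncomputable def legE (L : ℝ → ℝ) (x : ℝ) : ℝ≥0∞ := ⨆ s : ℝ, ENNReal.ofReal (s * x - L s)

lemma ofReal_le_legE (L : ℝ → ℝ) (s x : ℝ) : ENNReal.ofReal (s * x - L s) ≤ legE L x :=
  le_iSup (fun s : ℝ => ENNReal.ofReal (s * x - L s)) s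

lemma toENNReal_legendre (L : ℝ → ℝ) (x : ℝ) : (legendre L x).toENNReal = legE L x := by
  refine le_antisymm ?_ (iSup_le fun s => ?_)
  · have h : legendre L x ≤ (legE L x : EReal) := by
      refine iSup_le fun s => ?_
      refine le_trans ?_ (EReal.coe_ennreal_le_coe_ennreal_iff.2 (ofReal_le_legE L s x))
      rw [EReal.coe_ennreal_ofReal]
      exact_mod_cast le_max_left _ _
    simpa using EReal.toENNReal_le_toENNReal h
  · have h : ((s * x - L s : ℝ) : EReal) ≤ legendre L x :=
      le_iSup (fun s : ℝ => ((s * x - L s : ℝ) : EReal)) s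
    have h' := EReal.toENNReal_le_toENNReal h
    rwa [EReal.toENNReal_of_ne_top (EReal.coe_ne_top _), EReal.toReal_coe] at h'

lemma continuous_ofReal_affine (L : ℝ → ℝ) (s : ℝ) :
    Continuous fun x : ℝ => ENNReal.ofReal (s * x - L s) :=
  ENNReal.continuous_ofReal.comp (by fun_prop)

lemma measurable_legE (L : ℝ → ℝ) : Measurable (legE L) :=
  (lowerSemicontinuous_iSup fun s => (continuous_ofReal_affine L s).lowerSemicontinuous).measurable

/-- A supremum of continuous functions is lower semicontinuous; this is the sequential form needed
for Fatou's lemma. -/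
lemma legE_le_liminf (L : ℝ → ℝ) {x : ℕ → ℝ} {y : ℝ} (h : Tendsto x atTop (𝓝 y)) :
    legE L y ≤ liminf (fun n => legE L (x n)) atTop := by
  refine iSup_le fun s => ?_
  rw [← (((continuous_ofReal_affine L s).tendsto y).comp h).liminf_eq]
  exact liminf_le_liminf (Eventually.of_forall fun n => ofReal_le_legE L s (x n))

lemma le_of_legE_le {L : ℝ → ℝ} {x : ℝ} {c : ℝ} (hc : 0 ≤ c) (h : legE L x ≤ ENNReal.ofReal c)
    (s : ℝ) : s * x - L s ≤ c := by
  have := (ofReal_le_legE L s x).trans h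
  rwa [ENNReal.ofReal_le_ofReal_iff hc] at this

/-- The suprema are pulled out one index at a time. The constant `c` collects the terms already
treated, so the induction has to be uniform in it. -/
lemma add_sum_iSup_le {ι κ : Type*} [Nonempty κ] (S : Finset ι) (f : ι → κ → ℝ≥0∞) {B c : ℝ≥0∞}
    (h : ∀ q : ι → κ, c + ∑ i ∈ S, f i (q i) ≤ B) : c + ∑ i ∈ S, ⨆ s, f i s ≤ B := by
  classical
  induction S using Finset.induction_on generalizing c with
  | empty => simpa using h fun _ => Classical.arbitrary κ
  | insert i S hi ih =>
    rw [Finset.sum_insert hi, ← add_assoc, ENNReal.add_iSup, ENNReal.iSup_add]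
    refine iSup_le fun s => ih fun q => ?_
    have := h (Function.update q i s)
    rw [Finset.sum_insert hi, ← add_assoc, Function.update_self] at this
    refine le_trans (le_of_eq ?_) this
    congr 1
    refine Finset.sum_congr rfl fun j hj => ?_
    rw [Function.update_of_ne (ne_of_mem_of_not_mem hj hi)]

lemma sum_iSup_le {ι κ : Type*} [Nonempty κ] (S : Finset ι) (f : ι → κ → ℝ≥0∞) {B : ℝ≥0∞}
    (h : ∀ q : ι → κ, ∑ i ∈ S, f i (q i) ≤ B) : ∑ i ∈ S, ⨆ s, f i s ≤ B := by
  simpa using add_sum_iSup_le (c := 0) S f (by simpa using h)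

/-- The hypothesis controls sums of terms of either sign, whereas `legE` sees only positive parts.
Replacing `q i` by `0` wherever the term is negative makes it vanish, because `L 0 = 0`, so both
agree for the modified choice. -/
lemma sum_mul_legE_le {ι : Type*} (S : Finset ι) {L : ℝ → ℝ} (hL0 : L 0 = 0) (x : ι → ℝ)
    {c M : ℝ} (hc : 0 ≤ c) (h : ∀ q : ι → ℝ, ∑ i ∈ S, c * (q i * x i - L (q i)) ≤ M) :
    ∑ i ∈ S, ENNReal.ofReal c * legE L (x i) ≤ ENNReal.ofReal M := by
  simp only [legE, ENNReal.mul_iSup]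
  refine sum_iSup_le S _ fun q => ?_
  let τ : ι → ℝ := fun i => if 0 ≤ q i * x i - L (q i) then q i else 0
  have hτ1 : ∀ i, 0 ≤ q i * x i - L (q i) → τ i = q i := fun i hi => if_pos hi
  have hτ0 : ∀ i, ¬ 0 ≤ q i * x i - L (q i) → τ i = 0 := fun i hi => if_neg hi
  have hτ : ∀ i, ENNReal.ofReal c * ENNReal.ofReal (q i * x i - L (q i)) =
      ENNReal.ofReal (c * (τ i * x i - L (τ i))) := fun i => by
    rw [← ENNReal.ofReal_mul hc]
    by_cases hi : 0 ≤ q i * x i - L (q i)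
    · rw [hτ1 i hi]
    · rw [hτ0 i hi, zero_mul, hL0, sub_zero, mul_zero, ENNReal.ofReal_zero]
      exact ENNReal.ofReal_of_nonpos (mul_nonpos_of_nonneg_of_nonpos hc (not_le.1 hi).le)
  have hpos : ∀ i ∈ S, 0 ≤ c * (τ i * x i - L (τ i)) := fun i _ => by
    refine mul_nonneg hc ?_
    by_cases hi : 0 ≤ q i * x i - L (q i)
    · rwa [hτ1 i hi]
    · rw [hτ0 i hi, zero_mul, hL0, sub_zero]
  rw [Finset.sum_congr rfl fun i _ => hτ i, ← ENNReal.ofReal_sum_of_nonneg hpos]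
  exact ENNReal.ofReal_le_ofReal (h τ)

/-! ## Functions of bounded `L`-variation -/

/-- The increments of `v` over disjoint intervals to the left of `1` are bounded, in duality with
the cost function `L`, by `M`. -/
def VariationBound (L : ℝ → ℝ) (M : ℝ) (v : ℝ → ℝ) : Prop :=
  ∀ (n : ℕ) (a b s : ℕ → ℝ), (∀ i < n, a i ≤ b i ∧ b i ≤ 1) →
    Set.PairwiseDisjoint (Finset.range n : Set ℕ) (fun i => Set.Ioc (a i) (b i)) →
    ∑ i ∈ Finset.range n, s i * (v (b i) - v (a i)) ≤
      M + ∑ i ∈ Finset.range n, L (s i) * (b i - a i)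

namespace VariationBound

variable {L : ℝ → ℝ} {M : ℝ} {v : ℝ → ℝ}

lemma nonneg (hv : VariationBound L M v) : 0 ≤ M := by
  simpa using hv 0 0 0 0 (by simp) (by simp)

/-- Take `s i = ± R` with the sign of the increment. As `R` is arbitrary, the contribution `M / R`
to the total variation can be made small. -/
lemma sum_abs_le (hv : VariationBound L M v) {n : ℕ} {a b : ℕ → ℝ} {R : ℝ}
    (hab : ∀ i < n, a i ≤ b i ∧ b i ≤ 1)
    (hd : Set.PairwiseDisjoint (Finset.range n : Set ℕ) (fun i => Set.Ioc (a i) (b i))) :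
    R * ∑ i ∈ Finset.range n, |v (b i) - v (a i)| ≤
      M + max (L R) (L (-R)) * ∑ i ∈ Finset.range n, (b i - a i) := by
  have h := hv n a b (fun i => if 0 ≤ v (b i) - v (a i) then R else -R) hab hd
  rw [Finset.mul_sum, Finset.mul_sum]
  refine le_trans (le_of_eq ?_) (h.trans (add_le_add le_rfl ?_))
  · refine Finset.sum_congr rfl fun i _ => ?_
    by_cases hi : 0 ≤ v (b i) - v (a i)
    · simp [hi, abs_of_nonneg hi]
    · rw [if_neg hi, abs_of_neg (not_le.1 hi)]; ring
  · refine Finset.sum_le_sum fun i hi => ?_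
    refine mul_le_mul_of_nonneg_right ?_ (sub_nonneg.2 (hab i (Finset.mem_range.1 hi)).1)
    split_ifs
    · exact le_max_left _ _
    · exact le_max_right _ _

lemma abs_sub_le (hv : VariationBound L M v) {R s t : ℝ} (hst : s ≤ t) (ht : t ≤ 1) :
    R * |v t - v s| ≤ M + max (L R) (L (-R)) * (t - s) := by
  simpa using hv.sum_abs_le (n := 1) (a := fun _ => s) (b := fun _ => t) (R := R)
    (fun _ _ => ⟨hst, ht⟩) (by simp [Set.PairwiseDisjoint, Set.Pairwise])

lemma absolutelyContinuousOnInterval (hv : VariationBound L M v) (hL : ∀ s, 0 ≤ L s) :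
    AbsolutelyContinuousOnInterval v 0 1 := by
  rw [absolutelyContinuousOnInterval_iff]
  intro ε hε
  -- Total length at most `1 / (C + 1)` makes the `L`-term at most `1`, so `R` times the variation
  -- is at most `M + 1 < M + 2 = R ε`.
  set R : ℝ := (M + 2) / ε with hR
  have hM := hv.nonneg
  have hRpos : 0 < R := by positivity
  set C : ℝ := max (L R) (L (-R)) with hC
  have hCn : 0 ≤ C := le_max_of_le_left (hL R)
  refine ⟨1 / (C + 1), by positivity, fun E hE hlen => ?_⟩
  have hE1 : ∀ i ∈ Finset.range E.1, (E.2 i).1 ≤ 1 ∧ (E.2 i).2 ≤ 1 := fun i hi => by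
    have := hE.1 i hi
    rw [Set.uIcc_of_le zero_le_one] at this
    exact ⟨this.1.2, this.2.2⟩
  have h := hv.sum_abs_le (n := E.1) (a := fun i => min (E.2 i).1 (E.2 i).2)
    (b := fun i => max (E.2 i).1 (E.2 i).2) (R := R)
    (fun i hi => ⟨min_le_max, max_le (hE1 i (Finset.mem_range.2 hi)).1
      (hE1 i (Finset.mem_range.2 hi)).2⟩) hE.2
  have h1 : ∀ i, |v (max (E.2 i).1 (E.2 i).2) - v (min (E.2 i).1 (E.2 i).2)| =
      dist (v (E.2 i).1) (v (E.2 i).2) := fun i => by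
    rw [Real.dist_eq]
    rcases le_total (E.2 i).1 (E.2 i).2 with hi | hi
    · rw [max_eq_right hi, min_eq_left hi, abs_sub_comm]
    · rw [max_eq_left hi, min_eq_right hi]
  have h2 : ∀ i, max (E.2 i).1 (E.2 i).2 - min (E.2 i).1 (E.2 i).2 =
      dist (E.2 i).1 (E.2 i).2 := fun i => by
    rw [Real.dist_eq, max_sub_min_eq_abs']
  simp only [h1, h2] at h
  have h3 : C * ∑ i ∈ Finset.range E.1, dist (E.2 i).1 (E.2 i).2 ≤ 1 := by
    calc C * _ ≤ C * (1 / (C + 1)) := by gcongr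
      _ ≤ 1 := by rw [mul_one_div, div_le_one (by positivity)]; linarith
  have h4 : R * ∑ i ∈ Finset.range E.1, dist (v (E.2 i).1) (v (E.2 i).2) < R * ε := by
    rw [hR, div_mul_cancel₀ _ hε.ne', ← hR]
    linarith
  exact lt_of_mul_lt_mul_left h4 hRpos.le

end VariationBound

/-! ### Energy bound for the derivative by grid approximation -/

/-- Difference quotients over intervals shrinking to `t` and containing `t` converge to the
derivative. -/
lemma tendsto_straddle {v : ℝ → ℝ} {d t : ℝ} (hv : HasDerivAt v d t) {x y : ℕ → ℝ}
    (hxy : ∀ᶠ n in atTop, x n < y n) (hx : ∀ᶠ n in atTop, x n ≤ t) (hy : ∀ᶠ n in atTop, t ≤ y n)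
    (hx' : Tendsto x atTop (𝓝 t)) (hy' : Tendsto y atTop (𝓝 t)) :
    Tendsto (fun n => (v (y n) - v (x n)) / (y n - x n)) atTop (𝓝 d) := by
  rw [Metric.tendsto_nhds]
  intro ε hε
  have h := (hasDerivAt_iff_isLittleO.1 hv).def (half_pos hε)
  filter_upwards [hxy, hx, hy, hx'.eventually h, hy'.eventually h] with n h1 h2 h3 h4 h5
  have hpos : 0 < y n - x n := sub_pos.2 h1
  simp only [Real.norm_eq_abs, smul_eq_mul] at h4 h5
  rw [abs_of_nonpos (sub_nonpos.2 h2)] at h4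
  rw [abs_of_nonneg (sub_nonneg.2 h3)] at h5
  rw [Real.dist_eq]
  have : (v (y n) - v (x n)) / (y n - x n) - d =
      ((v (y n) - v t - (y n - t) * d) - (v (x n) - v t - (x n - t) * d)) / (y n - x n) := by
    field_simp
    ring
  rw [this, abs_div, abs_of_pos hpos, div_lt_iff₀ hpos]
  refine (abs_sub _ _).trans_lt ?_
  nlinarith

/-- The difference quotient of `v` over the cell of the grid of mesh `1/m` that contains `t`. -/
noncomputable def gridSlope (v : ℝ → ℝ) (m : ℕ) (t : ℝ) : ℝ :=
  (v ((⌊(m : ℝ) * t⌋ + 1 : ℝ) / m) - v ((⌊(m : ℝ) * t⌋ : ℝ) / m)) * m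

lemma measurable_gridSlope (v : ℝ → ℝ) (m : ℕ) : Measurable (gridSlope v m) := by
  have : gridSlope v m = (fun k : ℤ => (v ((k + 1 : ℝ) / m) - v ((k : ℝ) / m)) * m) ∘
      fun t : ℝ => ⌊(m : ℝ) * t⌋ := rfl
  rw [this]
  exact measurable_from_top.comp (Int.measurable_floor.comp (by fun_prop))

lemma tendsto_gridSlope {v : ℝ → ℝ} {d t : ℝ} (hv : HasDerivAt v d t) :
    Tendsto (fun m : ℕ => gridSlope v m t) atTop (𝓝 d) := by
  have hcast : Tendsto (fun m : ℕ => (m : ℝ)) atTop atTop := tendsto_natCast_atTop_atTop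
  have hinv : Tendsto (fun m : ℕ => (1 : ℝ) / m) atTop (𝓝 0) :=
    tendsto_one_div_atTop_nhds_zero_nat
  have hpos : ∀ᶠ m : ℕ in atTop, (0 : ℝ) < m := hcast.eventually_gt_atTop 0
  have hx : ∀ᶠ m : ℕ in atTop, ((⌊(m : ℝ) * t⌋ : ℝ) / m) ≤ t := by
    filter_upwards [hpos] with m hm
    rw [div_le_iff₀ hm, mul_comm]
    exact Int.floor_le _
  have hy : ∀ᶠ m : ℕ in atTop, t ≤ ((⌊(m : ℝ) * t⌋ + 1 : ℝ) / m) := by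
    filter_upwards [hpos] with m hm
    rw [le_div_iff₀ hm, mul_comm]
    exact (Int.lt_floor_add_one _).le
  have hd : ∀ m : ℕ, ((⌊(m : ℝ) * t⌋ + 1 : ℝ) / m) - ((⌊(m : ℝ) * t⌋ : ℝ) / m) = 1 / m :=
    fun m => by ring
  have hx' : Tendsto (fun m : ℕ => ((⌊(m : ℝ) * t⌋ : ℝ) / m)) atTop (𝓝 t) := by
    refine tendsto_of_tendsto_of_tendsto_of_le_of_le' (g := fun m : ℕ => t - 1 / m) (h := fun _ => t)
      (by simpa using tendsto_const_nhds.sub hinv) tendsto_const_nhds ?_ hx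
    filter_upwards [hy] with m hm
    linarith [hd m]
  have hy' : Tendsto (fun m : ℕ => ((⌊(m : ℝ) * t⌋ + 1 : ℝ) / m)) atTop (𝓝 t) := by
    have := hx'.add hinv
    rw [add_zero] at this
    refine this.congr fun m => ?_
    linarith [hd m]
  refine (tendsto_straddle hv ?_ hx hy hx' hy').congr' ?_
  · filter_upwards [hpos] with m hm
    have := one_div_pos.2 hm
    linarith [hd m]
  · filter_upwards [hpos] with m hm
    rw [hd, gridSlope]
    field_simp

/-- The grid slope is constant on each of the `m` cells, so the integral is a finite sum, and the
variation bound for the cells is the dual form of the claim. The floor function produces cells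
closed on the left, the variation bound uses intervals closed on the right; this is why disjointness
is checked twice. -/
lemma VariationBound.lintegral_gridSlope_le {L : ℝ → ℝ} {M : ℝ} {v : ℝ → ℝ}
    (hv : VariationBound L M v) (hL0 : L 0 = 0) {m : ℕ} (hm : 0 < m) :
    ∫⁻ t in Set.Ioo (0 : ℝ) 1, legE L (gridSlope v m t) ≤ ENNReal.ofReal M := by
  have hm' : (0 : ℝ) < m := by exact_mod_cast hm
  set x : ℕ → ℝ := fun k => (v ((k + 1 : ℝ) / m) - v ((k : ℝ) / m)) * m with hx
  have hcell : ∀ k : ℕ, ∀ t ∈ Set.Ico ((k : ℝ) / m) ((k + 1 : ℝ) / m), gridSlope v m t = x k := by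
    rintro k t ⟨h1, h2⟩
    have : ⌊(m : ℝ) * t⌋ = (k : ℤ) := by
      rw [Int.floor_eq_iff]
      rw [div_le_iff₀ hm', mul_comm] at h1
      rw [lt_div_iff₀ hm', mul_comm] at h2
      exact ⟨by exact_mod_cast h1, by exact_mod_cast h2⟩
    simp [gridSlope, this, hx]
  have hcover : Set.Ioo (0 : ℝ) 1 ⊆ ⋃ k ∈ Finset.range m, Set.Ico ((k : ℝ) / m) ((k + 1 : ℝ) / m) := by
    rintro t ⟨h0, h1⟩
    have hmt : 0 ≤ (m : ℝ) * t := by positivity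
    refine Set.mem_biUnion (x := ⌊(m : ℝ) * t⌋₊) ?_ ⟨?_, ?_⟩
    · simp only [Finset.coe_range, Set.mem_Iio]
      rw [Nat.floor_lt hmt]
      nlinarith
    · rw [div_le_iff₀ hm', mul_comm t]; exact Nat.floor_le hmt
    · rw [lt_div_iff₀ hm', mul_comm t]; exact Nat.lt_floor_add_one _
  have hdisj : Set.PairwiseDisjoint (Finset.range m : Set ℕ)
      (fun k : ℕ => Set.Ico ((k : ℝ) / m) ((k + 1 : ℝ) / m)) := by
    intro i _ j _ hij
    refine Set.disjoint_left.2 fun t hi hj => hij ?_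
    have h1 := lt_of_le_of_lt hi.1 hj.2
    have h2 := lt_of_le_of_lt hj.1 hi.2
    rw [div_lt_div_iff_of_pos_right hm'] at h1 h2
    have h1' : i < j + 1 := by exact_mod_cast h1
    have h2' : j < i + 1 := by exact_mod_cast h2
    omega
  have hdisj' : Set.PairwiseDisjoint (Finset.range m : Set ℕ)
      (fun k : ℕ => Set.Ioc ((k : ℝ) / m) ((k + 1 : ℝ) / m)) := by
    intro i _ j _ hij
    refine Set.disjoint_left.2 fun t hi hj => hij ?_
    have h1 := lt_of_lt_of_le hi.1 hj.2
    have h2 := lt_of_lt_of_le hj.1 hi.2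
    rw [div_lt_div_iff_of_pos_right hm'] at h1 h2
    have h1' : i < j + 1 := by exact_mod_cast h1
    have h2' : j < i + 1 := by exact_mod_cast h2
    omega
  calc ∫⁻ t in Set.Ioo (0 : ℝ) 1, legE L (gridSlope v m t)
      ≤ ∫⁻ t in ⋃ k ∈ Finset.range m, Set.Ico ((k : ℝ) / m) ((k + 1 : ℝ) / m),
          legE L (gridSlope v m t) := lintegral_mono_set hcover
    _ = ∑ k ∈ Finset.range m, ∫⁻ t in Set.Ico ((k : ℝ) / m) ((k + 1 : ℝ) / m),
          legE L (gridSlope v m t) := by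
        rw [lintegral_biUnion_finset hdisj (fun _ _ => measurableSet_Ico)]
    _ = ∑ k ∈ Finset.range m, ENNReal.ofReal (1 / m) * legE L (x k) := by
        refine Finset.sum_congr rfl fun k _ => ?_
        rw [setLIntegral_congr_fun measurableSet_Ico
          (fun t ht => by rw [hcell k t ht] : Set.EqOn _ (fun _ => legE L (x k)) _),
          setLIntegral_const, Real.volume_Ico, mul_comm]
        congr 2
        ring
    _ ≤ ENNReal.ofReal M := by
        refine sum_mul_legE_le _ hL0 x (by positivity) fun q => ?_
        have h := hv m (fun k => (k : ℝ) / m) (fun k => (k + 1 : ℝ) / m) q ?_ hdisj'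
        · rw [← sub_le_iff_le_add, ← Finset.sum_sub_distrib] at h
          refine le_trans (le_of_eq (Finset.sum_congr rfl fun k _ => ?_)) h
          simp only [hx]
          field_simp
          ring
        · intro k hk
          constructor
          · rw [div_le_div_iff_of_pos_right hm']; linarith
          · rw [div_le_one hm']; exact_mod_cast hk

/-- Grid slopes converge to the derivative almost everywhere, since `v` is absolutely continuous;
lower semicontinuity of `legE L` and Fatou's lemma carry the uniform bound to the limit. -/
lemma VariationBound.lintegral_deriv_le {L : ℝ → ℝ} {M : ℝ} {v : ℝ → ℝ}
    (hv : VariationBound L M v) (hL0 : L 0 = 0) (hL : ∀ s, 0 ≤ L s) :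
    ∫⁻ t in Set.Ioo (0 : ℝ) 1, legE L (deriv v t) ≤ ENNReal.ofReal M := by
  have hac := hv.absolutelyContinuousOnInterval hL
  have hae : ∀ᵐ t ∂(volume.restrict (Set.Ioo (0 : ℝ) 1)),
      legE L (deriv v t) ≤ liminf (fun m : ℕ => legE L (gridSlope v m t)) atTop := by
    rw [ae_restrict_iff' measurableSet_Ioo]
    filter_upwards [hac.ae_differentiableAt] with t ht hmem
    refine legE_le_liminf L (tendsto_gridSlope (ht ?_).hasDerivAt)
    rw [Set.uIcc_of_le zero_le_one]
    exact Set.Ioo_subset_Icc_self hmem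
  calc ∫⁻ t in Set.Ioo (0 : ℝ) 1, legE L (deriv v t)
      ≤ ∫⁻ t in Set.Ioo (0 : ℝ) 1, liminf (fun m : ℕ => legE L (gridSlope v m t)) atTop :=
        lintegral_mono_ae hae
    _ ≤ liminf (fun m : ℕ => ∫⁻ t in Set.Ioo (0 : ℝ) 1, legE L (gridSlope v m t)) atTop :=
        lintegral_liminf_le fun m => (measurable_legE L).comp (measurable_gridSlope v m)
    _ ≤ ENNReal.ofReal M := by
        refine (liminf_le_liminf (v := fun _ => ENNReal.ofReal M) ?_).trans (by simp)
        filter_upwards [eventually_gt_atTop 0] with m hm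
        exact hv.lintegral_gridSlope_le hL0 hm

/-! ### Recovering a derivative from backward difference quotients -/

/-- The backward difference quotient of `H` with step `δ`. -/
noncomputable def backSlope (H : ℝ → ℝ) (δ t : ℝ) : ℝ := (H t - H (t - δ)) / δ

lemma integral_backSlope {H : ℝ → ℝ} (hH : Continuous H) (δ δ' t : ℝ) :
    ∫ x in (t - δ')..t, backSlope H δ x =
      ((∫ x in (0 : ℝ)..t, H x) - (∫ x in (0 : ℝ)..(t - δ'), H x) -
        (∫ x in (0 : ℝ)..(t - δ), H x) + ∫ x in (0 : ℝ)..(t - δ - δ'), H x) / δ := by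
  have hi : ∀ a b : ℝ, IntervalIntegrable H volume a b := fun a b => hH.intervalIntegrable a b
  have hi' : IntervalIntegrable (fun x => H (x - δ)) volume (t - δ') t :=
    (hH.comp (continuous_sub_right δ)).intervalIntegrable _ _
  simp only [backSlope]
  rw [intervalIntegral.integral_div, intervalIntegral.integral_sub (hi _ _) hi',
    intervalIntegral.integral_comp_sub_right (fun x => H x),
    ← intervalIntegral.integral_interval_sub_left (hi 0 t) (hi 0 (t - δ')),
    ← intervalIntegral.integral_interval_sub_left (hi 0 (t - δ)) (hi 0 (t - δ' - δ)),
    show t - δ' - δ = t - δ - δ' by ring]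
  ring

/-- Both sides are the mixed second difference, with steps `δ` and `δ'`, of a primitive of `H`,
divided by `δ δ'`. The symmetry makes difference quotients of unrelated steps comparable. -/
lemma integral_backSlope_comm {H : ℝ → ℝ} (hH : Continuous H) {δ δ' : ℝ} (hδ : 0 < δ) (hδ' : 0 < δ')
    (t : ℝ) : (∫ x in (t - δ')..t, backSlope H δ x) / δ' =
      (∫ x in (t - δ)..t, backSlope H δ' x) / δ := by
  rw [integral_backSlope hH, integral_backSlope hH, show t - δ' - δ = t - δ - δ' by ring]
  field_simp
  ring

lemma continuous_backSlope {H : ℝ → ℝ} (hH : Continuous H) (δ : ℝ) : Continuous (backSlope H δ) := by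
  unfold backSlope
  fun_prop

lemma abs_sub_average_le {f : ℝ → ℝ} (hf : Continuous f) {ε δ t : ℝ} (hδ : 0 < δ)
    (h : ∀ x, t - δ ≤ x → x ≤ t → |f t - f x| ≤ ε) :
    |f t - (∫ x in (t - δ)..t, f x) / δ| ≤ ε := by
  have h1 : f t - (∫ x in (t - δ)..t, f x) / δ = (∫ x in (t - δ)..t, (f t - f x)) / δ := by
    rw [intervalIntegral.integral_sub (by simp) (hf.intervalIntegrable _ _),
      intervalIntegral.integral_const, smul_eq_mul]
    field_simp
    ring
  rw [h1, abs_div, abs_of_pos hδ, div_le_iff₀ hδ]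
  have := intervalIntegral.norm_integral_le_of_norm_le_const (a := t - δ) (b := t)
    (f := fun x => f t - f x) (C := ε) (fun x hx => by
      rw [Set.uIoc_of_le (by linarith)] at hx
      exact h x hx.1.le hx.2)
  rwa [Real.norm_eq_abs, sub_sub_cancel, abs_of_pos hδ] at this

/-- If the backward difference quotients of `H` have uniformly bounded `L`-variation, then `H` is
the primitive of a function of bounded `L`-variation. -/
theorem exists_primitive_of_variationBound {L : ℝ → ℝ} {M : ℝ} (hL : ∀ s, 0 ≤ L s) {H : ℝ → ℝ}
    {a α : ℝ} (hH : Continuous H) (hH0 : ∀ t ≤ 0, H t = a + α * t)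
    (hv : ∀ δ > 0, VariationBound L M (backSlope H δ)) :
    ∃ v : ℝ → ℝ, VariationBound L M v ∧ v 0 = α ∧ ∀ t ∈ Set.Icc (0 : ℝ) 1,
      H t = a + ∫ x in (0 : ℝ)..t, v x := by
  have hM : 0 ≤ M := (hv 1 one_pos).nonneg
  -- a common modulus of continuity
  have hmod : ∀ ε > 0, ∃ ρ > 0, ∀ w : ℝ → ℝ, VariationBound L M w → ∀ s t, s ≤ t → t ≤ 1 →
      t - s ≤ ρ → |w t - w s| ≤ ε := by
    intro ε hε
    set R : ℝ := (M + 1) / ε with hR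
    have hRpos : 0 < R := by positivity
    set C : ℝ := max (L R) (L (-R)) with hC
    have hCn : 0 ≤ C := le_max_of_le_left (hL R)
    refine ⟨1 / (C + 1), by positivity, fun w hw s t hst ht hρ => ?_⟩
    have h := hw.abs_sub_le (R := R) hst ht
    have h3 : C * (t - s) ≤ 1 := by
      calc C * (t - s) ≤ C * (1 / (C + 1)) := by gcongr
        _ ≤ 1 := by rw [mul_one_div, div_le_one (by positivity)]; linarith
    have h4 : R * |w t - w s| ≤ R * ε := by
      rw [hR, div_mul_cancel₀ _ hε.ne', ← hR]
      linarith
    exact le_of_mul_le_mul_left h4 hRpos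
  -- Each quotient is within `ε / 2` of its own average over the step of the other one, and the two
  -- averages coincide.
  have hcauchy : ∀ ε > 0, ∃ ρ > 0, ∀ δ δ', 0 < δ → 0 < δ' → δ ≤ ρ → δ' ≤ ρ → ∀ t ≤ 1,
      |backSlope H δ t - backSlope H δ' t| ≤ ε := by
    intro ε hε
    obtain ⟨ρ, hρ, hmod'⟩ := hmod (ε / 2) (half_pos hε)
    refine ⟨ρ, hρ, fun δ δ' hδ hδ' hδρ hδ'ρ t ht => ?_⟩
    have h1 := abs_sub_average_le (continuous_backSlope hH δ) (t := t) (ε := ε / 2) hδ'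
      fun x hx1 hx2 => hmod' _ (hv δ hδ) x t hx2 ht (by linarith)
    have h2 := abs_sub_average_le (continuous_backSlope hH δ') (t := t) (ε := ε / 2) hδ
      fun x hx1 hx2 => hmod' _ (hv δ' hδ') x t hx2 ht (by linarith)
    rw [integral_backSlope_comm hH hδ hδ'] at h1
    have := abs_sub_le_iff.1 h1
    have := abs_sub_le_iff.1 h2
    rw [abs_sub_le_iff]
    constructor <;> linarith
  set δs : ℕ → ℝ := fun n => 1 / ((n : ℝ) + 1) with hδs
  have hδpos : ∀ n, 0 < δs n := fun n => by positivity
  have hδlim : Tendsto δs atTop (𝓝 0) := tendsto_one_div_add_atTop_nhds_zero_nat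
  have hlim : ∀ t ≤ 1, ∃ y, Tendsto (fun n => backSlope H (δs n) t) atTop (𝓝 y) := by
    intro t ht
    refine cauchySeq_tendsto_of_complete (Metric.cauchySeq_iff.2 fun ε hε => ?_)
    obtain ⟨ρ, hρ, h⟩ := hcauchy (ε / 2) (half_pos hε)
    obtain ⟨n0, hn0⟩ := eventually_atTop.1 (hδlim.eventually (Iic_mem_nhds hρ))
    refine ⟨n0, fun m hm n hn => ?_⟩
    rw [Real.dist_eq]
    exact (h _ _ (hδpos m) (hδpos n) (hn0 m hm) (hn0 n hn) t ht).trans_lt (by linarith)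
  choose! v hvlim using hlim
  have hclose : ∀ ε > 0, ∃ ρ > 0, ∀ δ, 0 < δ → δ ≤ ρ → ∀ t ≤ 1, |backSlope H δ t - v t| ≤ ε := by
    intro ε hε
    obtain ⟨ρ, hρ, h⟩ := hcauchy ε hε
    refine ⟨ρ, hρ, fun δ hδ hδρ t ht => ?_⟩
    refine le_of_tendsto ((tendsto_const_nhds.sub (hvlim t ht)).abs) ?_
    filter_upwards [hδlim.eventually (Iic_mem_nhds hρ)] with n hn
    exact h δ _ hδ (hδpos n) hδρ hn t ht
  -- For fixed intervals and multipliers the inequality involves finitely many values, so it passes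
  -- to the pointwise limit.
  have hvb : VariationBound L M v := by
    intro n x y s hxy hd
    refine le_of_tendsto (f := fun k : ℕ => ∑ i ∈ Finset.range n,
      s i * (backSlope H (δs k) (y i) - backSlope H (δs k) (x i))) (x := atTop) ?_
      (Eventually.of_forall fun k => hv _ (hδpos k) n x y s hxy hd)
    refine tendsto_finsetSum _ fun i hi => ?_
    have := hxy i (Finset.mem_range.1 hi)
    exact ((hvlim _ this.2).sub (hvlim _ (this.1.trans this.2))).const_mul _
  have hac := hvb.absolutelyContinuousOnInterval hL
  have hvc : ContinuousOn v (Set.Icc 0 1) := by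
    have := hac.continuousOn
    rwa [Set.uIcc_of_le zero_le_one] at this
  refine ⟨v, hvb, ?_, fun t ht => ?_⟩
  · refine tendsto_nhds_unique (hvlim 0 zero_le_one) (tendsto_const_nhds.congr fun n => ?_)
    rw [backSlope, hH0 0 le_rfl, hH0 (0 - δs n) (by linarith [hδpos n])]
    have := (hδpos n).ne'
    field_simp
    ring
  · have hder : ∀ x ∈ Set.Ioo (0 : ℝ) t, HasDerivAt H (v x) x := by
      intro x hx
      have hx1 : x < 1 := hx.2.trans_le ht.2
      rw [hasDerivAt_iff_isLittleO, Asymptotics.isLittleO_iff]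
      intro ε hε
      obtain ⟨ρ, hρ, h1⟩ := hclose (ε / 2) (half_pos hε)
      obtain ⟨ρ', hρ', h2⟩ := hmod (ε / 2) (half_pos hε)
      filter_upwards [Ioo_mem_nhds (show x - min ρ ρ' < x by have := lt_min hρ hρ'; linarith)
        (show x < min 1 (x + min ρ ρ') by
          have := lt_min hρ hρ'
          exact lt_min hx1 (by linarith))] with y hy
      have hy1 : y < 1 := hy.2.trans_le (min_le_left _ _)
      have hy2 : y < x + min ρ ρ' := hy.2.trans_le (min_le_right _ _)
      have hmin1 := min_le_left ρ ρ'
      have hmin2 := min_le_right ρ ρ'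
      simp only [Real.norm_eq_abs, smul_eq_mul]
      rcases lt_trichotomy y x with hlt | rfl | hlt
      · have := h1 (x - y) (by linarith) (by linarith [hy.1]) x hx1.le
        rw [backSlope, sub_sub_cancel] at this
        have hpos : 0 < x - y := by linarith
        have e : H y - H x - (y - x) * v x = -(((H x - H y) / (x - y) - v x) * (x - y)) := by
          field_simp; ring
        rw [e, abs_neg, abs_mul, abs_sub_comm y x]
        gcongr
        linarith
      · simp
      -- For `y > x` the quotient is a backward one based at `y`, hence close to `v y`; the modulus
      -- of continuity of `v` leads back to `v x`.
      · have h3 := h1 (y - x) (by linarith) (by linarith [hy.1]) y hy1.le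
        have h4 := h2 v hvb x y hlt.le hy1.le (by linarith)
        rw [backSlope, sub_sub_cancel] at h3
        have hpos : 0 < y - x := by linarith
        have e : H y - H x - (y - x) * v x = (((H y - H x) / (y - x) - v y) + (v y - v x)) * (y - x) := by
          field_simp; ring
        rw [e, abs_mul]
        gcongr
        exact (abs_add_le _ _).trans (by linarith)
    have hsub : Set.Icc 0 t ⊆ Set.Icc (0 : ℝ) 1 := Set.Icc_subset_Icc_right ht.2
    have := intervalIntegral.integral_eq_sub_of_hasDerivAt_of_le ht.1 hH.continuousOn hder
      ((hvc.mono hsub).intervalIntegrable_of_Icc ht.1)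
    rw [this, hH0 0 le_rfl]
    ring

/-- A function satisfying the variation bound is a second primitive `a + α t + ∫₀ᵗ ∫₀ˢ g`. -/
theorem exists_second_derivative_of_variationBound {L : ℝ → ℝ} {M : ℝ} (hL0 : L 0 = 0)
    (hL : ∀ s, 0 ≤ L s) {H : ℝ → ℝ} {a α : ℝ} (hH : Continuous H) (hH0 : ∀ t ≤ 0, H t = a + α * t)
    (hv : ∀ δ > 0, VariationBound L M (backSlope H δ)) :
    ∃ g : ℝ → ℝ, IntegrableOn g (Set.Ioo 0 1) ∧
      (∀ t ∈ Set.Icc (0 : ℝ) 1, H t = a + ∫ x in (0 : ℝ)..t, (α + ∫ s in (0 : ℝ)..x, g s)) ∧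
      ∫⁻ t in Set.Ioo (0 : ℝ) 1, legE L (g t) ≤ ENNReal.ofReal M := by
  obtain ⟨v, hvb, hv0, hHv⟩ := exists_primitive_of_variationBound hL hH hH0 hv
  have hac := hvb.absolutelyContinuousOnInterval hL
  refine ⟨deriv v, ?_, fun t ht => ?_, hvb.lintegral_deriv_le hL0 hL⟩
  · have := hac.intervalIntegrable_deriv
    rw [intervalIntegrable_iff_integrableOn_Ioo_of_le zero_le_one] at this
    exact this
  · rw [hHv t ht]
    congr 1
    refine intervalIntegral.integral_congr fun x hx => ?_
    rw [Set.uIcc_of_le ht.1] at hx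
    have hacx := hac.mono (c := 0) (d := x) (by
      rw [Set.uIcc_of_le zero_le_one, Set.uIcc_of_le hx.1]
      exact Set.Icc_subset_Icc_right (hx.2.trans ht.2))
    change v x = α + ∫ s in (0 : ℝ)..x, deriv v s
    rw [hacx.integral_deriv_eq_sub, hv0]
    ring

/-! ## Weak derivatives on the unit interval -/

lemma setIntegral_Ioo_eq (f : ℝ → ℝ) :
    ∫ t in Set.Ioo (0 : ℝ) 1, f t = ∫ t in (0 : ℝ)..1, f t := by
  rw [intervalIntegral.integral_of_le zero_le_one, integral_Ioc_eq_integral_Ioo]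

lemma intervalIntegrable_of_Ioo {f : ℝ → ℝ} (hf : IntegrableOn f (Set.Ioo 0 1)) {a b : ℝ}
    (ha : a ∈ Set.Icc (0 : ℝ) 1) (hb : b ∈ Set.Icc (0 : ℝ) 1) : IntervalIntegrable f volume a b := by
  have h : IntervalIntegrable f volume 0 1 := by
    rwa [intervalIntegrable_iff_integrableOn_Ioo_of_le zero_le_one]
  refine h.mono_set ?_
  rw [Set.uIcc_of_le zero_le_one]
  exact Set.uIcc_subset_Icc ha hb

lemma deriv_primitive_ae {f : ℝ → ℝ} (hf : IntegrableOn f (Set.Ioo 0 1)) :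
    ∀ᵐ t, t ∈ Set.Icc (0 : ℝ) 1 → deriv (fun x => ∫ s in (0 : ℝ)..x, f s) t = f t := by
  have h := (intervalIntegrable_of_Ioo hf (a := 0) (b := 1) (by simp) (by simp)).ae_hasDerivAt_integral
  rw [Set.uIcc_of_le zero_le_one] at h
  filter_upwards [h] with t ht hmem
  exact (ht hmem 0 (by simp)).deriv

lemma absolutelyContinuous_primitive {f : ℝ → ℝ} (hf : IntegrableOn f (Set.Ioo 0 1)) :
    AbsolutelyContinuousOnInterval (fun x => ∫ s in (0 : ℝ)..x, f s) 0 1 :=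
  (intervalIntegrable_of_Ioo hf (a := 0) (b := 1) (by simp)
    (by simp)).absolutelyContinuousOnInterval_intervalIntegral (by simp)

lemma eq_zero_of_tsupport_subset_Ioo {η : ℝ → ℝ} (h : tsupport η ⊆ Set.Ioo 0 1) :
    η 0 = 0 ∧ η 1 = 0 :=
  ⟨image_eq_zero_of_notMem_tsupport fun h' => (h h').1.false,
    image_eq_zero_of_notMem_tsupport fun h' => (h h').2.false⟩

/-- Integration by parts for absolutely continuous functions; the test function vanishes at both
ends, which also removes the constant `c`. -/
lemma hasWeakDeriv_primitive {f u : ℝ → ℝ} (hf : IntegrableOn f (Set.Ioo 0 1)) (c : ℝ)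
    (hu : ∀ t ∈ Set.Ioo (0 : ℝ) 1, u t = c + ∫ s in (0 : ℝ)..t, f s) : HasWeakDeriv u f := by
  intro η hη _ hsupp
  obtain ⟨h0, h1⟩ := eq_zero_of_tsupport_subset_Ioo hsupp
  have hηac : AbsolutelyContinuousOnInterval η 0 1 :=
    (hη.contDiffOn.of_le (by exact_mod_cast le_top)).absolutelyContinuousOnInterval
  have hac := absolutelyContinuous_primitive hf
  have hpart := hac.integral_mul_deriv_eq_deriv_mul hηac
  have hη' : Continuous (deriv η) := hη.continuous_deriv (by exact_mod_cast le_top)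
  have hconst : ∫ x in (0 : ℝ)..1, deriv η x = 0 := by
    rw [hηac.integral_deriv_eq_sub, h0, h1, sub_zero]
  rw [setIntegral_congr_fun (g := fun t => (c + ∫ s in (0 : ℝ)..t, f s) * deriv η t)
    measurableSet_Ioo (fun t ht => by simp only [hu t ht]), setIntegral_Ioo_eq, setIntegral_Ioo_eq]
  simp only [add_mul]
  rw [intervalIntegral.integral_add, intervalIntegral.integral_const_mul, hconst, hpart, h0, h1]
  · simp only [mul_zero, sub_zero, zero_add, zero_sub, neg_inj]
    refine intervalIntegral.integral_congr_ae ?_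
    filter_upwards [deriv_primitive_ae hf] with t ht hmem
    rw [Set.uIoc_of_le zero_le_one] at hmem
    rw [ht ⟨hmem.1.le, hmem.2⟩]
  · exact (hη'.intervalIntegrable _ _).const_mul _
  · exact (hη'.intervalIntegrable _ _).continuousOn_mul hac.continuousOn

/-- The primitive vanishes to the left of the support, and to the right of it equals the total
integral, which is `0`. Thus mean-zero test functions are derivatives of test functions. -/
lemma exists_smooth_primitive {θ : ℝ → ℝ} (hθ : ContDiff ℝ ((⊤ : ℕ∞) : WithTop ℕ∞) θ)
    (hc : HasCompactSupport θ) (hsupp : tsupport θ ⊆ Set.Ioo 0 1) (hint : ∫ x, θ x = 0) :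
    ∃ η : ℝ → ℝ, ContDiff ℝ ((⊤ : ℕ∞) : WithTop ℕ∞) η ∧ HasCompactSupport η ∧
      tsupport η ⊆ Set.Ioo 0 1 ∧ deriv η = θ := by
  obtain ⟨a, b, ha, hb, hK⟩ : ∃ a b : ℝ, 0 < a ∧ b < 1 ∧ tsupport θ ⊆ Set.Icc a b := by
    rcases (tsupport θ).eq_empty_or_nonempty with he | hne
    · exact ⟨1 / 2, 1 / 2, by norm_num, by norm_num, by simp [he]⟩
    · have hcomp : IsCompact (tsupport θ) := hc
      obtain ⟨a, ha, hamin⟩ := hcomp.exists_isLeast hne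
      obtain ⟨b, hb, hbmax⟩ := hcomp.exists_isGreatest hne
      exact ⟨a, b, (hsupp ha).1, (hsupp hb).2, fun x hx => ⟨hamin hx, hbmax hx⟩⟩
  have hcont := hθ.continuous
  have hzero : ∀ x, x ∉ Set.Icc a b → θ x = 0 := fun x hx =>
    image_eq_zero_of_notMem_tsupport fun h => hx (hK h)
  set η : ℝ → ℝ := fun x => ∫ s in (0 : ℝ)..x, θ s with hη
  have hder : ∀ x, HasDerivAt η (θ x) x := fun x =>
    intervalIntegral.integral_hasDerivAt_right (hcont.intervalIntegrable _ _)
      (hcont.stronglyMeasurableAtFilter _ _) hcont.continuousAt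
  have hderiv : deriv η = θ := funext fun x => (hder x).deriv
  have h01 : ∫ s in (0 : ℝ)..1, θ s = 0 := by
    rw [← setIntegral_Ioo_eq, setIntegral_eq_integral_of_forall_compl_eq_zero, hint]
    intro x hx
    exact image_eq_zero_of_notMem_tsupport fun h => hx (hsupp h)
  have hηsupp : ∀ x, x ∉ Set.Icc a b → η x = 0 := by
    intro x hx
    rw [Set.mem_Icc, not_and_or, not_le, not_le] at hx
    rcases hx with hx | hx
    · refine (intervalIntegral.integral_congr (g := fun _ => (0 : ℝ)) fun s hs => ?_).trans (by simp)
      refine hzero s fun hs' => ?_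
      have : s ≤ max 0 x := hs.2
      rcases max_cases 0 x with h | h <;> linarith [hs'.1]
    · have h1 : ∫ s in x..1, θ s = 0 := by
        refine (intervalIntegral.integral_congr (g := fun _ => (0 : ℝ)) fun s hs => ?_).trans (by simp)
        refine hzero s fun hs' => ?_
        have : min x 1 ≤ s := hs.1
        rcases min_cases x 1 with h | h <;> linarith [hs'.2]
      have := intervalIntegral.integral_add_adjacent_intervals (hcont.intervalIntegrable 0 x)
        (hcont.intervalIntegrable (μ := volume) x 1)
      rw [h1, h01, add_zero] at this
      exact this
  have hts : tsupport η ⊆ Set.Icc a b := by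
    refine closure_minimal (fun x hx => ?_) isClosed_Icc
    by_contra h
    exact hx (hηsupp x h)
  refine ⟨η, ?_, isCompact_Icc.of_isClosed_subset (isClosed_tsupport _) hts,
    hts.trans fun x hx => ⟨ha.trans_le hx.1, hx.2.trans_lt hb⟩, hderiv⟩
  rw [contDiff_infty_iff_deriv, hderiv]
  exact ⟨fun x => (hder x).differentiableAt, hθ⟩

/-- The lemma of du Bois-Reymond. -/
lemma ae_const_of_weakDeriv_zero {w : ℝ → ℝ} (hw : IntegrableOn w (Set.Ioo 0 1))
    (h : HasWeakDeriv w fun _ => 0) : ∃ c : ℝ, ∀ᵐ t ∂(volume.restrict (Set.Ioo (0 : ℝ) 1)), w t = c := by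
  let B : ContDiffBump (1 / 2 : ℝ) := ⟨1 / 8, 1 / 4, by norm_num, by norm_num⟩
  set ρ : ℝ → ℝ := B.normed volume with hρ
  have hρs : ContDiff ℝ ((⊤ : ℕ∞) : WithTop ℕ∞) ρ := B.contDiff_normed
  have hρc : HasCompactSupport ρ := B.hasCompactSupport_normed
  have hρt : tsupport ρ ⊆ Set.Ioo 0 1 := by
    rw [hρ, B.tsupport_normed_eq, Real.closedBall_eq_Icc]
    intro x hx
    change x ∈ Set.Icc (1 / 2 - 1 / 4 : ℝ) (1 / 2 + 1 / 4) at hx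
    exact ⟨by linarith [hx.1], by linarith [hx.2]⟩
  have hρ1 : ∫ x, ρ x = 1 := B.integral_normed
  set c : ℝ := ∫ t in Set.Ioo (0 : ℝ) 1, w t * ρ t with hc
  have hmulint : ∀ ζ : ℝ → ℝ, Continuous ζ → HasCompactSupport ζ →
      IntegrableOn (fun t => w t * ζ t) (Set.Ioo 0 1) := fun ζ hζ hζc => by
    obtain ⟨C, hC⟩ := hζ.bounded_above_of_compact_support hζc
    exact hw.mul_bdd hζ.aestronglyMeasurable (Eventually.of_forall hC)
  refine ⟨c, ?_⟩
  have hmain : ∀ᵐ t, t ∈ Set.Ioo (0 : ℝ) 1 → w t - c = 0 := by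
    refine isOpen_Ioo.ae_eq_zero_of_integral_contDiff_smul_eq_zero
      (hw.sub (integrableOn_const (by simp))).locallyIntegrableOn fun ζ hζ hζc hζt => ?_
    have hζint : Integrable ζ := hζ.continuous.integrable_of_hasCompactSupport hζc
    have hρint : Integrable ρ := hρs.continuous.integrable_of_hasCompactSupport hρc
    set m : ℝ := ∫ x, ζ x with hm
    -- Subtracting `m ρ` makes the mean zero, so that the hypothesis on `w` applies to the
    -- primitive; what remains is `∫ w ζ = m c`, which says that `w` acts on `ζ` as the constant
    -- `c`.
    obtain ⟨η, hη1, hη2, hη3, hη4⟩ := exists_smooth_primitive (θ := fun x => ζ x - m * ρ x)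
      (hζ.sub (contDiff_const.mul hρs)) (hζc.sub (hρc.mul_left)) (by
        refine closure_minimal (fun x hx => ?_) (isClosed_tsupport ζ |>.union (isClosed_tsupport ρ))
          |>.trans (Set.union_subset hζt hρt)
        by_contra hcon
        rw [Set.mem_union, not_or] at hcon
        refine hx ?_
        simp [image_eq_zero_of_notMem_tsupport hcon.1, image_eq_zero_of_notMem_tsupport hcon.2])
      (by rw [integral_sub hζint (hρint.const_mul _), integral_const_mul, hρ1]; simp [hm])
    have h1 := h η hη1 hη2 hη3
    rw [hη4] at h1
    simp only [zero_mul, integral_zero, neg_zero] at h1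
    have hζ' := hmulint ζ hζ.continuous hζc
    have hρ' := hmulint ρ hρs.continuous hρc
    have h2 : ∫ t in Set.Ioo (0 : ℝ) 1, w t * ζ t = m * c := by
      have : ∀ t, w t * (ζ t - m * ρ t) = w t * ζ t - m * (w t * ρ t) := fun t => by ring
      simp only [this] at h1
      rw [integral_sub hζ' (hρ'.const_mul _), integral_const_mul] at h1
      linarith
    have h3 : ∫ x, ζ x • (w x - c) = ∫ t in Set.Ioo (0 : ℝ) 1, (w t * ζ t - c * ζ t) := by
      rw [← setIntegral_eq_integral_of_forall_compl_eq_zero (s := Set.Ioo (0 : ℝ) 1)]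
      · refine integral_congr_ae (Eventually.of_forall fun t => ?_)
        simp only [smul_eq_mul]; ring
      · intro x hx
        rw [image_eq_zero_of_notMem_tsupport fun h' => hx (hζt h'), zero_smul]
    rw [h3, integral_sub hζ' (hζint.integrableOn.const_mul _), integral_const_mul, h2,
      setIntegral_eq_integral_of_forall_compl_eq_zero]
    · rw [← hm]; ring
    · intro x hx
      exact image_eq_zero_of_notMem_tsupport fun h' => hx (hζt h')
  rw [ae_restrict_iff' measurableSet_Ioo]
  filter_upwards [hmain] with t ht hmem
  linarith [ht hmem]

/-- The difference of `u` and the primitive of `f` has weak derivative zero, hence is constant. -/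
lemma HasWeakDeriv.ae_eq_primitive {u f : ℝ → ℝ} (h : HasWeakDeriv u f)
    (hu : IntegrableOn u (Set.Ioo 0 1)) (hf : IntegrableOn f (Set.Ioo 0 1)) :
    ∃ c : ℝ, ∀ᵐ t ∂(volume.restrict (Set.Ioo (0 : ℝ) 1)), u t = c + ∫ s in (0 : ℝ)..t, f s := by
  have hcont := (absolutelyContinuous_primitive hf).continuousOn
  rw [Set.uIcc_of_le zero_le_one] at hcont
  have hFint : IntegrableOn (fun t => ∫ s in (0 : ℝ)..t, f s) (Set.Ioo 0 1) :=
    hcont.integrableOn_Icc.mono_set Set.Ioo_subset_Icc_self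
  have hF : HasWeakDeriv (fun t => ∫ s in (0 : ℝ)..t, f s) f :=
    hasWeakDeriv_primitive hf 0 fun t _ => by simp
  obtain ⟨c, hc⟩ := ae_const_of_weakDeriv_zero (w := fun t => u t - ∫ s in (0 : ℝ)..t, f s)
    (hu.sub hFint) (by
      intro η h1 h2 h3
      have hη' : Continuous (deriv η) := h1.continuous_deriv (by exact_mod_cast le_top)
      obtain ⟨C, hC⟩ := hη'.bounded_above_of_compact_support h2.deriv
      have e1 := h η h1 h2 h3
      have e2 := hF η h1 h2 h3
      simp only [sub_mul, zero_mul, integral_zero, neg_zero]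
      rw [integral_sub (hu.mul_bdd hη'.aestronglyMeasurable (Eventually.of_forall hC))
        (hFint.mul_bdd hη'.aestronglyMeasurable (Eventually.of_forall hC)), e1, e2, sub_self])
  refine ⟨c, ?_⟩
  filter_upwards [hc] with t ht
  linarith

/-! ## Second primitives -/

/-- `h(t) = a + ∫₀ᵗ (α + ∫₀ˣ g(s) ds) dx` with `g` integrable. -/
def IsSecondPrimitive (a α : ℝ) (g : ℝ → ℝ) (h : C(I, ℝ)) : Prop :=
  IntegrableOn g (Set.Ioo 0 1) ∧
    ∀ t ∈ Set.Icc (0 : ℝ) 1, extend h t = a + ∫ x in (0 : ℝ)..t, (α + ∫ s in (0 : ℝ)..x, g s)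

lemma continuous_extend (h : C(I, ℝ)) : Continuous (extend h) :=
  h.continuous.Icc_extend'

lemma extend_coe (h : C(I, ℝ)) (t : I) : extend h t = h t := by
  simp [extend, Set.IccExtend_of_mem zero_le_one _ t.2]

/-- A primitive that is continuous on the whole line. -/
lemma exists_continuous_primitive {g : ℝ → ℝ} (hg : IntegrableOn g (Set.Ioo 0 1)) :
    ∃ G : ℝ → ℝ, Continuous G ∧ ∀ t ∈ Set.Icc (0 : ℝ) 1, G t = ∫ s in (0 : ℝ)..t, g s := by
  refine ⟨fun t => ∫ s in (0 : ℝ)..t, (Set.Ioo (0 : ℝ) 1).indicator g s,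
    (hg.integrable_indicator measurableSet_Ioo).continuous_primitive 0, fun t ht => ?_⟩
  beta_reduce
  rw [intervalIntegral.integral_of_le ht.1, intervalIntegral.integral_of_le ht.1,
    integral_Ioc_eq_integral_Ioo, integral_Ioc_eq_integral_Ioo]
  refine setIntegral_congr_fun measurableSet_Ioo fun s hs => ?_
  have hs' : s ∈ Set.Ioo (0 : ℝ) 1 := ⟨hs.1, hs.2.trans_le ht.2⟩
  exact Set.indicator_of_mem hs' g

namespace IsSecondPrimitive

variable {a α : ℝ} {g : ℝ → ℝ} {h : C(I, ℝ)}

lemma hasDerivWithinAt (hh : IsSecondPrimitive a α g h) {t : ℝ} (ht : t ∈ Set.Icc (0 : ℝ) 1) :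
    HasDerivWithinAt (extend h) (α + ∫ s in (0 : ℝ)..t, g s) (Set.Icc 0 1) t := by
  obtain ⟨G, hG, hGeq⟩ := exists_continuous_primitive hh.1
  have hc : Continuous fun x => α + G x := by fun_prop
  have hd : HasDerivAt (fun t => a + ∫ x in (0 : ℝ)..t, (α + G x)) (α + G t) t :=
    (intervalIntegral.integral_hasDerivAt_right (hc.intervalIntegrable _ _)
      (hc.stronglyMeasurableAtFilter _ _) hc.continuousAt).const_add a
  rw [← hGeq t ht]
  have key : ∀ t ∈ Set.Icc (0 : ℝ) 1, extend h t = a + ∫ x in (0 : ℝ)..t, (α + G x) := by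
    intro t ht
    rw [hh.2 t ht]
    congr 1
    refine intervalIntegral.integral_congr fun x hx => ?_
    rw [Set.uIcc_of_le ht.1] at hx
    simp only [hGeq x ⟨hx.1, hx.2.trans ht.2⟩]
  exact hd.hasDerivWithinAt.congr key (key t ht)

lemma leftBoundary (hh : IsSecondPrimitive a α g h) : LeftBoundary a α h := by
  have h0 := hh.2 0 (by simp)
  have h1 := hh.hasDerivWithinAt (t := 0) (by simp)
  refine ⟨?_, by simpa using h1⟩
  rw [← extend_coe h 0]
  simpa using h0

lemma hasSecondWeakDeriv (hh : IsSecondPrimitive a α g h) {p : ℝ≥0∞}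
    (hp : MemLp g p (volume.restrict (Set.Ioo 0 1))) : HasSecondWeakDeriv p h g := by
  obtain ⟨G, hG, hGeq⟩ := exists_continuous_primitive hh.1
  have hmem : ∀ f : ℝ → ℝ, Continuous f → MemLp f p (volume.restrict (Set.Ioo 0 1)) := by
    intro f hf
    obtain ⟨C, hC⟩ := isCompact_Icc.exists_bound_of_continuousOn (s := Set.Icc (0 : ℝ) 1)
      hf.continuousOn
    refine MemLp.of_bound hf.aestronglyMeasurable C ?_
    rw [ae_restrict_iff' measurableSet_Ioo]
    exact Eventually.of_forall fun t ht => hC t (Set.Ioo_subset_Icc_self ht)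
  have hc : Continuous fun x => α + G x := by fun_prop
  refine ⟨fun x => α + G x, hmem _ (continuous_extend h), hmem _ hc, hp, ?_, ?_⟩
  · refine hasWeakDeriv_primitive (hc.integrableOn_Icc.mono_set Set.Ioo_subset_Icc_self) a
      fun t ht => ?_
    rw [hh.2 t (Set.Ioo_subset_Icc_self ht)]
    congr 1
    refine intervalIntegral.integral_congr fun x hx => ?_
    rw [Set.uIcc_of_le ht.1.le] at hx
    simp only [hGeq x ⟨hx.1, hx.2.trans ht.2.le⟩]
  · exact hasWeakDeriv_primitive hh.1 α fun t ht => by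
      rw [hGeq t (Set.Ioo_subset_Icc_self ht)]

/-- Taylor's formula with integral remainder, by integrating the inner primitive by parts against `x
- t`. Its kernel is the continuous counterpart of the one in `profile_eq`. -/
lemma extend_eq (hh : IsSecondPrimitive a α g h) {t : ℝ} (ht : t ∈ Set.Icc (0 : ℝ) 1) :
    extend h t = a + α * t + ∫ s in Set.Ioo (0 : ℝ) 1, max (t - s) 0 * g s := by
  have hac := (absolutelyContinuous_primitive hh.1).mono (c := 0) (d := t) (by
    rw [Set.uIcc_of_le zero_le_one, Set.uIcc_of_le ht.1]
    exact Set.Icc_subset_Icc_right ht.2)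
  have hlin : AbsolutelyContinuousOnInterval (fun x : ℝ => x - t) 0 t :=
    ((contDiff_id.sub contDiff_const : ContDiff ℝ 1 fun x : ℝ => x - t).contDiffOn
      ).absolutelyContinuousOnInterval
  have hpart := hac.integral_mul_deriv_eq_deriv_mul hlin
  have hd : ∀ x : ℝ, deriv (fun x : ℝ => x - t) x = 1 := fun x => by simp
  simp only [hd, mul_one, sub_self, mul_zero, intervalIntegral.integral_same, zero_mul,
    zero_sub] at hpart
  have hg := intervalIntegrable_of_Ioo hh.1 (a := 0) (b := t) (by simp) ht
  rw [hh.2 t ht, intervalIntegral.integral_add (by simp) hac.continuousOn.intervalIntegrable, hpart,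
    intervalIntegral.integral_const]
  have h1 : ∫ x in (0 : ℝ)..t, deriv (fun x => ∫ s in (0 : ℝ)..x, g s) x * (x - t) =
      ∫ x in (0 : ℝ)..t, g x * (x - t) := by
    refine intervalIntegral.integral_congr_ae ?_
    filter_upwards [deriv_primitive_ae hh.1] with x hx hmem
    rw [Set.uIoc_of_le ht.1] at hmem
    rw [hx ⟨hmem.1.le, hmem.2.trans ht.2⟩]
  have h2 : ∫ s in Set.Ioo (0 : ℝ) 1, max (t - s) 0 * g s = ∫ s in (0 : ℝ)..t, (t - s) * g s := by
    rw [intervalIntegral.integral_of_le ht.1, ← integral_Ioc_eq_integral_Ioo,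
      setIntegral_eq_of_subset_of_forall_sdiff_eq_zero (s := Set.Ioc 0 t) measurableSet_Ioc
        (Set.Ioc_subset_Ioc_right ht.2)]
    · refine setIntegral_congr_fun measurableSet_Ioc fun s hs => ?_
      simp only [max_eq_left (sub_nonneg.2 hs.2)]
    · intro s hs
      have : t - s ≤ 0 := by
        by_contra hcon
        exact hs.2 ⟨hs.1.1, by linarith⟩
      rw [max_eq_right this, zero_mul]
  rw [h1, h2, ← intervalIntegral.integral_neg]
  simp only [smul_eq_mul, sub_zero]
  rw [add_assoc, mul_comm t α]
  congr 2
  refine intervalIntegral.integral_congr fun x _ => ?_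
  ring

end IsSecondPrimitive

/-- Applying `HasWeakDeriv.ae_eq_primitive` twice gives a representation up to two constants. It
holds everywhere because both sides are continuous, and the boundary data at `0` identify the
constants. -/
lemma isSecondPrimitive_of_hasSecondWeakDeriv {a α : ℝ} {g : ℝ → ℝ} {h : C(I, ℝ)} {p : ℝ≥0∞}
    (hp : 1 ≤ p) (hg : HasSecondWeakDeriv p h g) (hb : LeftBoundary a α h) :
    IsSecondPrimitive a α g h := by
  obtain ⟨v, hh, hv, hg', hhv, hvg⟩ := hg
  have hgi : IntegrableOn g (Set.Ioo 0 1) := hg'.integrable hp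
  have hvi : IntegrableOn v (Set.Ioo 0 1) := hv.integrable hp
  obtain ⟨c, hc⟩ := hvg.ae_eq_primitive hvi hgi
  obtain ⟨c', hc'⟩ := hhv.ae_eq_primitive (hh.integrable hp) hvi
  have hvi' := intervalIntegrable_of_Ioo hvi (a := 0) (b := 1) (by simp) (by simp)
  have hc2 : ∀ t ∈ Set.Icc (0 : ℝ) 1, ∫ x in (0 : ℝ)..t, v x =
      ∫ x in (0 : ℝ)..t, (c + ∫ s in (0 : ℝ)..x, g s) := by
    intro t ht
    rw [intervalIntegral.integral_of_le ht.1, intervalIntegral.integral_of_le ht.1,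
      integral_Ioc_eq_integral_Ioo, integral_Ioc_eq_integral_Ioo]
    exact integral_congr_ae (ae_restrict_of_ae_restrict_of_subset
      (Set.Ioo_subset_Ioo_right ht.2) hc)
  have heq : Set.EqOn (extend h) (fun t => c' + ∫ x in (0 : ℝ)..t, v x) (Set.Icc 0 1) := by
    have hcont := (absolutelyContinuous_primitive hvi).continuousOn
    rw [Set.uIcc_of_le zero_le_one] at hcont
    refine Measure.eqOn_Icc_of_ae_eq volume zero_ne_one ?_ (continuous_extend h).continuousOn
      (continuousOn_const.add hcont)
    rw [← restrict_Ioo_eq_restrict_Icc]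
    exact hc'
  have hsp : IsSecondPrimitive c' c g h := ⟨hgi, fun t ht => by rw [← hc2 t ht]; exact heq ht⟩
  have hl := hsp.leftBoundary
  have e1 : a = c' := hb.1.symm.trans hl.1
  have e2 : α = c :=
    (uniqueDiffOn_Icc_zero_one 0 (by simp)).eq_deriv _ hb.2 hl.2
  rw [e1, e2]
  exact hsp

/-! ## Profiles in terms of discrete Laplacians -/

lemma sum_Ioo_int_eq_sum_range {β : Type*} [AddCommMonoid β] (N : ℕ) (f : ℤ → β) :
    ∑ k ∈ Finset.Ioo (-1 : ℤ) (N + 1), f k = ∑ i ∈ Finset.range (N + 1), f i := by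
  have : Finset.Ioo (-1 : ℤ) (N + 1) = (Finset.range (N + 1)).map Nat.castEmbedding := by
    ext k
    simp only [Finset.mem_Ioo, Finset.mem_map, Finset.mem_range, Nat.castEmbedding_apply]
    constructor
    · rintro ⟨h1, h2⟩
      exact ⟨k.toNat, by omega, by omega⟩
    · rintro ⟨i, hi, rfl⟩
      omega
  rw [this, Finset.sum_map]
  rfl

lemma slope_eq_sum (φ : ℤ → ℝ) (n : ℕ) : φ (n + 1) - φ n =
    φ 0 - φ (-1) + ∑ i ∈ Finset.range (n + 1), discreteLaplacian φ i := by
  induction n with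
  | zero => simp [discreteLaplacian]; ring
  | succ n ih =>
    rw [Finset.sum_range_succ, ← add_assoc, ← ih, discreteLaplacian]
    push_cast
    rw [show (n : ℤ) + 1 - 1 = n by ring]
    ring

/-- Discrete Taylor formula. The positive part annihilates the terms with `i ≥ n`, so the index set
need not depend on `n`; the restriction `n ≤ N + 1` ensures that no nonzero term is missing. -/
lemma eq_add_sum_discreteLaplacian (φ : ℤ → ℝ) {N n : ℕ} (hn : n ≤ N + 1) : φ n =
    φ 0 + n * (φ 0 - φ (-1)) +
      ∑ i ∈ Finset.range (N + 1), max ((n : ℝ) - i) 0 * discreteLaplacian φ i := by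
  induction n with
  | zero =>
    have : ∑ i ∈ Finset.range (N + 1), max (((0 : ℕ) : ℝ) - i) 0 * discreteLaplacian φ i = 0 :=
      Finset.sum_eq_zero fun i _ => by
        rw [max_eq_right (by simp), zero_mul]
    rw [this]
    simp
  | succ n ih =>
    have h1 := slope_eq_sum φ n
    have h2 := ih (by omega)
    have h3 : ∑ i ∈ Finset.range (N + 1), max (((n + 1 : ℕ) : ℝ) - i) 0 * discreteLaplacian φ i =
        ∑ i ∈ Finset.range (N + 1), max ((n : ℝ) - i) 0 * discreteLaplacian φ i +
          ∑ i ∈ Finset.range (n + 1), discreteLaplacian φ i := by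
      have hs : ∑ i ∈ Finset.range (n + 1), discreteLaplacian φ i =
          ∑ i ∈ Finset.range (N + 1), if i ≤ n then discreteLaplacian φ i else 0 := by
        rw [← Finset.sum_filter]
        congr 1
        ext i
        simp only [Finset.mem_range, Finset.mem_filter]
        omega
      rw [hs, ← Finset.sum_add_distrib]
      refine Finset.sum_congr rfl fun i _ => ?_
      push_cast
      by_cases hi : i ≤ n
      · have : (i : ℝ) ≤ n := by exact_mod_cast hi
        rw [if_pos hi, max_eq_left (by linarith), max_eq_left (by linarith)]
        ring
      · have : (n : ℝ) + 1 ≤ i := by exact_mod_cast not_le.1 hi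
        rw [if_neg hi, max_eq_right (by linarith), max_eq_right (by linarith)]
        ring
    rw [h3]
    push_cast at h1 h2 ⊢
    linarith

/-- The kink of `(· - i)⁺` is at an integer, so linear interpolation between consecutive integers
reproduces the function. -/
lemma interpolate_pos_part (k i : ℕ) {l : ℝ} (h0 : 0 ≤ l) (h1 : l ≤ 1) :
    (1 - l) * max ((k : ℝ) - i) 0 + l * max (((k + 1 : ℕ) : ℝ) - i) 0 = max (k + l - i) 0 := by
  push_cast
  by_cases hi : i ≤ k
  · have : (i : ℝ) ≤ k := by exact_mod_cast hi
    rw [max_eq_left (by linarith), max_eq_left (by linarith), max_eq_left (by linarith)]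
    ring
  · have : (k : ℝ) + 1 ≤ i := by exact_mod_cast not_le.1 hi
    rw [max_eq_right (by linarith), max_eq_right (by linarith), max_eq_right (by linarith)]
    ring

lemma profile_apply_floor (N : ℕ) (φ : ℤ → ℝ) (t : I) : profile N φ t =
    ((1 - ((N : ℝ) * t - ⌊(N : ℝ) * t⌋₊)) * φ ⌊(N : ℝ) * t⌋₊ +
      ((N : ℝ) * t - ⌊(N : ℝ) * t⌋₊) * φ (⌊(N : ℝ) * t⌋₊ + 1)) / (N : ℝ) ^ 2 := by
  have h0 : 0 ≤ (N : ℝ) * t := mul_nonneg (Nat.cast_nonneg N) t.2.1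
  have hf : ⌊(N : ℝ) * t⌋ = (⌊(N : ℝ) * t⌋₊ : ℤ) := (Int.natCast_floor_eq_floor h0).symm
  simp only [profile, ContinuousMap.coe_mk, hf, Int.cast_natCast]
  ring

lemma floor_le_of_mem (N : ℕ) (t : I) : ⌊(N : ℝ) * t⌋₊ ≤ N := by
  have h0 : 0 ≤ (N : ℝ) * t := mul_nonneg (Nat.cast_nonneg N) t.2.1
  have : ((⌊(N : ℝ) * t⌋₊ : ℕ) : ℝ) ≤ N :=
    (Nat.floor_le h0).trans (mul_le_of_le_one_right (Nat.cast_nonneg N) t.2.2)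
  exact_mod_cast this

/-- The profile as a superposition of the functions `t ↦ (Nt - i)⁺`. -/
lemma profile_eq (N : ℕ) (φ : ℤ → ℝ) (t : I) : profile N φ t =
    (φ 0 + N * t * (φ 0 - φ (-1)) +
      ∑ i ∈ Finset.range (N + 1), max ((N : ℝ) * t - i) 0 * discreteLaplacian φ i) / (N : ℝ) ^ 2 := by
  have h0 : 0 ≤ (N : ℝ) * t := mul_nonneg (Nat.cast_nonneg N) t.2.1
  rw [profile_apply_floor]
  have hk := floor_le_of_mem N t
  set k : ℕ := ⌊(N : ℝ) * t⌋₊ with hkdef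
  set l : ℝ := (N : ℝ) * t - k with hl
  have hl0 : 0 ≤ l := sub_nonneg.2 (Nat.floor_le h0)
  have hl1 : l ≤ 1 := by
    have := Nat.lt_floor_add_one ((N : ℝ) * t)
    rw [← hkdef] at this
    linarith
  have e1 := eq_add_sum_discreteLaplacian φ (N := N) (n := k) (by omega)
  have e2 := eq_add_sum_discreteLaplacian φ (N := N) (n := k + 1) (by omega)
  have e3 : ∑ i ∈ Finset.range (N + 1), max ((N : ℝ) * t - i) 0 * discreteLaplacian φ i =
      (1 - l) * ∑ i ∈ Finset.range (N + 1), max ((k : ℝ) - i) 0 * discreteLaplacian φ i +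
      l * ∑ i ∈ Finset.range (N + 1), max (((k + 1 : ℕ) : ℝ) - i) 0 * discreteLaplacian φ i := by
    rw [Finset.mul_sum, Finset.mul_sum, ← Finset.sum_add_distrib]
    refine Finset.sum_congr rfl fun i _ => ?_
    rw [← mul_assoc, ← mul_assoc, ← add_mul, interpolate_pos_part k i hl0 hl1]
    congr 3
    rw [hl]; ring
  rw [e3, show (N : ℝ) * t = k + l by rw [hl]; ring]
  push_cast at e1 e2 ⊢
  rw [e1, e2]
  ring

lemma continuous_discreteLaplacian (k : ℤ) :
    Continuous fun φ : ℤ → ℝ => discreteLaplacian φ k := by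
  unfold discreteLaplacian
  fun_prop

lemma continuous_profile (N : ℕ) : Continuous (profile N) := by
  refine ContinuousMap.continuous_of_continuous_uncurry _ ?_
  have h : (Function.uncurry fun (φ : ℤ → ℝ) (t : I) => profile N φ t) = fun p : (ℤ → ℝ) × I =>
      (p.1 0 + N * p.2 * (p.1 0 - p.1 (-1)) + ∑ i ∈ Finset.range (N + 1),
        max ((N : ℝ) * p.2 - i) 0 * discreteLaplacian p.1 i) / (N : ℝ) ^ 2 := by
    funext p
    exact profile_eq N p.1 p.2
  rw [h]
  have h1 : ∀ i : ℕ, Continuous fun p : (ℤ → ℝ) × I => discreteLaplacian p.1 i := fun i =>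
    (continuous_discreteLaplacian i).comp continuous_fst
  fun_prop

lemma measurable_profile_preimage (N : ℕ) {O : Set C(I, ℝ)} (hO : IsOpen O) :
    MeasurableSet (profile N ⁻¹' O) :=
  (hO.preimage (continuous_profile N)).measurableSet

/-! ## Exponential moment bounds -/

/-- Under `P` the field has the left boundary values `(a, α)`, and the exponential moments of its
discrete Laplacians are bounded in terms of `L`, up to a factor `exp (c N)`. -/
structure ExpBound (a α : ℝ) (L : ℝ → ℝ) (c : ℝ) (N : ℕ) (P : Measure (ℤ → ℝ)) : Prop where
  zero : ∀ᵐ φ ∂P, φ 0 = a * N ^ 2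
  neg_one : ∀ᵐ φ ∂P, φ (-1) = a * N ^ 2 - α * N
  exp_le : ∀ u : ℕ → ℝ,
    ∫⁻ φ, ENNReal.ofReal (Real.exp (∑ i ∈ Finset.range (N + 1), u i * discreteLaplacian φ i)) ∂P ≤
      ENNReal.ofReal (Real.exp (∑ i ∈ Finset.range (N + 1), L (u i) + c * N))

lemma measurable_discreteLaplacian (k : ℤ) :
    Measurable fun φ : ℤ → ℝ => discreteLaplacian φ k :=
  (continuous_discreteLaplacian k).measurable

/-- Chernoff's inequality. The inclusion of events is only required almost surely, since the
boundary values of the field are known only in that sense. -/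
lemma measure_le_of_lintegral_exp_le {Ω : Type*} [MeasurableSpace Ω] {P : Measure Ω} {f : Ω → ℝ}
    (hf : Measurable f) {B : ℝ}
    (h : ∫⁻ ω, ENNReal.ofReal (Real.exp (f ω)) ∂P ≤ ENNReal.ofReal (Real.exp B))
    {A : Set Ω} {m : ℝ} (hA : ∀ᵐ ω ∂P, ω ∈ A → m ≤ f ω) :
    P A ≤ ENNReal.ofReal (Real.exp (B - m)) := by
  have h1 : P A ≤ P {ω | ENNReal.ofReal (Real.exp m) ≤ ENNReal.ofReal (Real.exp (f ω))} := by
    refine measure_mono_ae ?_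
    filter_upwards [hA] with ω hω hmem
    exact ENNReal.ofReal_le_ofReal (Real.exp_le_exp.2 (hω hmem))
  have h2 := mul_meas_ge_le_lintegral₀ (μ := P) (f := fun ω => ENNReal.ofReal (Real.exp (f ω)))
    (by fun_prop) (ENNReal.ofReal (Real.exp m))
  have h3 := (mul_le_mul_right h1 (ENNReal.ofReal (Real.exp m))).trans (h2.trans h)
  have hpos : ENNReal.ofReal (Real.exp m) ≠ 0 := by
    simp [Real.exp_pos]
  rw [Real.exp_sub, ENNReal.ofReal_div_of_pos (Real.exp_pos _), ENNReal.le_div_iff_mul_le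
    (Or.inl hpos) (Or.inl ENNReal.ofReal_ne_top), mul_comm]
  exact h3

lemma ExpBound.measure_le {a α c : ℝ} {L : ℝ → ℝ} {N : ℕ} {P : Measure (ℤ → ℝ)}
    (hP : ExpBound a α L c N P) (u : ℕ → ℝ) {A : Set (ℤ → ℝ)} {m : ℝ}
    (hA : ∀ φ ∈ A, φ 0 = a * N ^ 2 → φ (-1) = a * N ^ 2 - α * N →
      m ≤ ∑ i ∈ Finset.range (N + 1), u i * discreteLaplacian φ i) :
    P A ≤ ENNReal.ofReal (Real.exp (∑ i ∈ Finset.range (N + 1), L (u i) + c * N - m)) := by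
  refine measure_le_of_lintegral_exp_le ?_ (hP.exp_le u) ?_
  · exact Finset.measurable_fun_sum _ fun i _ => (measurable_discreteLaplacian i).const_mul _
  · filter_upwards [hP.zero, hP.neg_one] with φ h0 h1 hmem
    exact hA φ hmem h0 h1

/-- Expand the product of the bounds `exp |x| ≤ exp x + exp (-x)` over all sign patterns. -/
lemma exp_sum_abs_le (S : Finset ℕ) (x : ℕ → ℝ) : Real.exp (∑ i ∈ S, |x i|) ≤
    ∑ t ∈ S.powerset, Real.exp (∑ i ∈ S, (if i ∈ t then 1 else -1) * x i) := by
  calc Real.exp (∑ i ∈ S, |x i|) = ∏ i ∈ S, Real.exp |x i| := Real.exp_sum _ _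
    _ ≤ ∏ i ∈ S, (Real.exp (x i) + Real.exp (-x i)) := by
        refine Finset.prod_le_prod (fun i _ => (Real.exp_pos _).le) fun i _ => ?_
        rcases abs_cases (x i) with h | h <;> rw [h.1] <;>
          linarith [Real.exp_pos (x i), Real.exp_pos (-x i)]
    _ = _ := by
        rw [Finset.prod_add]
        refine Finset.sum_congr rfl fun t ht => ?_
        rw [Finset.mem_powerset] at ht
        rw [← Real.exp_sum, ← Real.exp_sum, ← Real.exp_add]
        congr 1
        rw [← Finset.sum_sdiff ht, add_comm]
        congr 1
        · refine Finset.sum_congr rfl fun i hi => ?_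
          rw [if_neg (Finset.mem_sdiff.1 hi).2]; ring
        · refine Finset.sum_congr rfl fun i hi => ?_
          rw [if_pos hi]; ring

/-- Every sign pattern is controlled by the exponential bound with `u = ± 1`; the `2 ^ (N + 1)`
patterns cost a factor of at most `exp (N + 1)`. -/
lemma ExpBound.lintegral_exp_sum_abs_le {a α c : ℝ} {L : ℝ → ℝ} {N : ℕ} {P : Measure (ℤ → ℝ)}
    (hP : ExpBound a α L c N P) :
    ∫⁻ φ, ENNReal.ofReal (Real.exp (∑ i ∈ Finset.range (N + 1), |discreteLaplacian φ i|)) ∂P ≤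
      ENNReal.ofReal (Real.exp ((N + 1) * (1 + max (L 1) (L (-1))) + c * N)) := by
  set S := Finset.range (N + 1) with hS
  set C := max (L 1) (L (-1)) with hC
  have hmeas : ∀ t : Finset ℕ, Measurable fun φ : ℤ → ℝ => ENNReal.ofReal (Real.exp
      (∑ i ∈ S, (if i ∈ t then (1 : ℝ) else -1) * discreteLaplacian φ i)) := fun t => by
    have := measurable_discreteLaplacian
    fun_prop
  calc ∫⁻ φ, ENNReal.ofReal (Real.exp (∑ i ∈ S, |discreteLaplacian φ i|)) ∂P
      ≤ ∫⁻ φ, ∑ t ∈ S.powerset, ENNReal.ofReal (Real.exp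
          (∑ i ∈ S, (if i ∈ t then 1 else -1) * discreteLaplacian φ i)) ∂P := by
        refine lintegral_mono fun φ => ?_
        rw [← ENNReal.ofReal_sum_of_nonneg fun _ _ => (Real.exp_pos _).le]
        exact ENNReal.ofReal_le_ofReal (exp_sum_abs_le S _)
    _ = ∑ t ∈ S.powerset, ∫⁻ φ, ENNReal.ofReal (Real.exp
          (∑ i ∈ S, (if i ∈ t then 1 else -1) * discreteLaplacian φ i)) ∂P :=
        lintegral_finsetSum _ fun t _ => hmeas t
    _ ≤ ∑ t ∈ S.powerset, ENNReal.ofReal (Real.exp ((N + 1) * C + c * N)) := by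
        refine Finset.sum_le_sum fun t _ => (hP.exp_le _).trans ?_
        refine ENNReal.ofReal_le_ofReal (Real.exp_le_exp.2 (add_le_add ?_ le_rfl))
        have : ∀ i ∈ S, L (if i ∈ t then 1 else -1) ≤ C := fun i _ => by
          split_ifs
          · exact le_max_left _ _
          · exact le_max_right _ _
        refine (Finset.sum_le_sum this).trans (le_of_eq ?_)
        simp [hS]
    _ = ENNReal.ofReal (2 ^ (N + 1) * Real.exp ((N + 1) * C + c * N)) := by
        rw [Finset.sum_const, Finset.card_powerset, hS, Finset.card_range, nsmul_eq_mul,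
          ENNReal.ofReal_mul (by positivity)]
        congr 1
        rw [ENNReal.ofReal_pow (by norm_num)]
        simp
    _ ≤ _ := by
        refine ENNReal.ofReal_le_ofReal ?_
        have h2 : (2 : ℝ) ≤ Real.exp 1 := by linarith [Real.add_one_le_exp (1 : ℝ)]
        calc (2 : ℝ) ^ (N + 1) * Real.exp ((N + 1) * C + c * N)
            ≤ Real.exp 1 ^ (N + 1) * Real.exp ((N + 1) * C + c * N) := by gcongr
          _ = _ := by
            rw [← Real.exp_nat_mul, ← Real.exp_add]
            congr 1
            push_cast
            ring

/-! ## Exponential tightness -/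

/-- Arzelà–Ascoli: a common Lipschitz constant gives equicontinuity, and the conditions define a
closed subset of a product of compact intervals around `a`. -/
lemma isCompact_lipschitz (a R : ℝ) :
    IsCompact {h : C(I, ℝ) | h 0 = a ∧ ∀ s t : I, |h s - h t| ≤ R * |(s : ℝ) - t|} := by
  set S := {h : C(I, ℝ) | h 0 = a ∧ ∀ s t : I, |h s - h t| ≤ R * |(s : ℝ) - t|} with hS
  have hlip : ∀ f : I → ℝ, (∀ s t : I, |f s - f t| ≤ R * |(s : ℝ) - t|) →
      LipschitzWith R.toNNReal f := fun f hf => by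
    refine LipschitzWith.of_dist_le_mul fun s t => ?_
    rw [Real.dist_eq, Subtype.dist_eq, Real.dist_eq]
    exact (hf s t).trans (mul_le_mul_of_nonneg_right (Real.le_coe_toNNReal R) (abs_nonneg _))
  refine ArzelaAscoli.isCompact_of_equicontinuous S ?_ ?_
  · have himage : ContinuousMap.toFun '' S =
        {f : I → ℝ | f 0 = a ∧ ∀ s t : I, |f s - f t| ≤ R * |(s : ℝ) - t|} := by
      ext f
      constructor
      · rintro ⟨h, hh, rfl⟩
        exact hh
      · intro hf
        exact ⟨⟨f, (hlip f hf.2).continuous⟩, hf, rfl⟩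
    rw [himage]
    refine (isCompact_univ_pi fun _ : I => isCompact_Icc (a := a - |R|) (b := a + |R|)).of_isClosed_subset
      ?_ fun f hf t _ => ?_
    · simp only [Set.ofPred_and, Set.ofPred_forall]
      refine (isClosed_eq (continuous_apply _) continuous_const).inter
        (isClosed_iInter fun s => isClosed_iInter fun t => isClosed_le ?_ continuous_const)
      exact ((continuous_apply s).sub (continuous_apply t)).abs
    · have h := hf.2 t 0
      rw [hf.1] at h
      have ht : |(t : ℝ) - (0 : I)| ≤ 1 := by
        rw [abs_le]
        constructor <;> simp <;> linarith [t.2.1, t.2.2]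
      have h' : |f t - a| ≤ |R| := by
        refine h.trans ((mul_le_mul_of_nonneg_right (le_abs_self R) (abs_nonneg _)).trans ?_)
        exact mul_le_of_le_one_right (abs_nonneg R) ht
      rw [abs_le] at h'
      constructor <;> linarith
  · exact (LipschitzWith.uniformEquicontinuous _ R.toNNReal fun h => hlip _ h.2.2).equicontinuous

lemma abs_profile_sub_le {N : ℕ} (hN : 0 < N) (φ : ℤ → ℝ) (s t : I) :
    |profile N φ s - profile N φ t| ≤ (|φ 0 - φ (-1)| / N +
      (∑ i ∈ Finset.range (N + 1), |discreteLaplacian φ i|) / N) * |(s : ℝ) - t| := by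
  have hN' : (0 : ℝ) < N := by exact_mod_cast hN
  have e : profile N φ s - profile N φ t = (N * (s - t) * (φ 0 - φ (-1)) +
      ∑ i ∈ Finset.range (N + 1), (max ((N : ℝ) * s - i) 0 - max ((N : ℝ) * t - i) 0) *
        discreteLaplacian φ i) / (N : ℝ) ^ 2 := by
    rw [profile_eq, profile_eq]
    simp only [sub_mul, Finset.sum_sub_distrib]
    ring
  have h1 : |∑ i ∈ Finset.range (N + 1), (max ((N : ℝ) * s - i) 0 - max ((N : ℝ) * t - i) 0) *
      discreteLaplacian φ i| ≤
      N * |(s : ℝ) - t| * ∑ i ∈ Finset.range (N + 1), |discreteLaplacian φ i| := by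
    refine (Finset.abs_sum_le_sum_abs _ _).trans ?_
    rw [Finset.mul_sum]
    refine Finset.sum_le_sum fun i _ => ?_
    rw [abs_mul]
    gcongr
    refine (abs_max_sub_max_le_abs _ _ _).trans (le_of_eq ?_)
    rw [sub_sub_sub_cancel_right, ← mul_sub, abs_mul, abs_of_pos hN']
  rw [e, abs_div, abs_of_pos (by positivity : (0 : ℝ) < (N : ℝ) ^ 2), div_le_iff₀ (by positivity)]
  refine (abs_add_le _ _).trans ((add_le_add le_rfl h1).trans (le_of_eq ?_))
  rw [abs_mul, abs_mul, abs_of_pos hN']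
  field_simp

/-- The profile is Lipschitz with constant `|α| + N⁻¹ ∑ |Δφ_i|`, and this sum has exponential
moments of order `exp (O(N))`. -/
theorem exponentially_tight {a α c : ℝ} {L : ℝ → ℝ} {P : ℕ → Measure (ℤ → ℝ)}
    (hP : ∀ᶠ N : ℕ in atTop, ExpBound a α L c N (P N)) (M : ℝ) :
    ∃ K : Set C(I, ℝ), IsCompact K ∧
      ∀ᶠ N : ℕ in atTop, P N (profile N ⁻¹' Kᶜ) ≤ ENNReal.ofReal (Real.exp (-(M * N))) := by
  set C := max (L 1) (L (-1)) with hC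
  -- With this `R` the Chernoff exponent `(N + 1) (1 + C) + c N - R N` equals `(1 + C) - (M + 1) N`.
  set R : ℝ := 1 + C + c + M + 1 with hR
  refine ⟨_, isCompact_lipschitz a (|α| + R), ?_⟩
  filter_upwards [hP, eventually_gt_atTop 0,
    eventually_const_mul_ofReal_exp_le (show M < M + 1 by linarith) 1 (1 + C)] with N hN hN0 hexp
  have hN' : (0 : ℝ) < N := by exact_mod_cast hN0
  refine le_trans ?_ hexp
  have := measure_le_of_lintegral_exp_le (A := profile N ⁻¹' {h : C(I, ℝ) | h 0 = a ∧ ∀ s t : I,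
    |h s - h t| ≤ (|α| + R) * |(s : ℝ) - t|}ᶜ) (m := R * N) ?_ hN.lintegral_exp_sum_abs_le ?_
  · refine this.trans (ENNReal.ofReal_le_ofReal ?_)
    rw [one_mul]
    refine Real.exp_le_exp.2 (le_of_eq ?_)
    rw [hR]; ring
  · exact Finset.measurable_fun_sum _ fun i _ => (measurable_discreteLaplacian i).norm
  · filter_upwards [hN.zero, hN.neg_one] with φ h0 h1 hmem
    by_contra hcon
    refine hmem ⟨?_, fun s t => ?_⟩
    · rw [profile_eq, h0]
      have : ∑ i ∈ Finset.range (N + 1), max ((N : ℝ) * ((0 : I) : ℝ) - i) 0 *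
          discreteLaplacian φ i = 0 :=
        Finset.sum_eq_zero fun i _ => by rw [max_eq_right (by simp), zero_mul]
      rw [this]
      simp only [Set.Icc.coe_zero, mul_zero, zero_mul, add_zero]
      field_simp
    · refine (abs_profile_sub_le hN0 φ s t).trans ?_
      gcongr
      · rw [h0, h1, sub_sub_cancel, abs_mul, abs_of_pos hN', mul_div_cancel_right₀ _ hN'.ne']
      · rw [div_le_iff₀ hN']
        exact (not_le.1 hcon).le

/-! ## Local upper bounds -/

/-- Jensen's inequality, with the missing mass placed at `0`, where `L` vanishes. -/
lemma map_sum_le_of_sum_le_one {ι : Type*} (S : Finset ι) {L : ℝ → ℝ}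
    (hL : ConvexOn ℝ Set.univ L) (hL0 : L 0 = 0) {w s : ι → ℝ} (hw : ∀ i ∈ S, 0 ≤ w i)
    (hw1 : ∑ i ∈ S, w i ≤ 1) : L (∑ i ∈ S, s i * w i) ≤ ∑ i ∈ S, L (s i) * w i := by
  have h := hL.map_add_sum_le (t := S) (w := w) (p := s) (v := 1 - ∑ i ∈ S, w i) (q := 0) hw
    (by ring) (fun _ _ => trivial) (sub_nonneg.2 hw1) trivial
  simp only [smul_eq_mul, mul_zero, zero_add, hL0] at h
  simpa only [mul_comm] using h

/-- The proportion of `(x, x + δ]` that is covered by `(a, b]`. -/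
noncomputable def overlap (δ a b x : ℝ) : ℝ :=
  volume.real (Set.Ioc a b ∩ Set.Ioc x (x + δ)) / δ

lemma overlap_nonneg {δ : ℝ} (hδ : 0 < δ) (a b x : ℝ) : 0 ≤ overlap δ a b x :=
  div_nonneg measureReal_nonneg hδ.le

/-- Written with the kernel `(· - x)⁺`, the overlap becomes the combination of kernels that appears
in an increment of backward difference quotients; see `backSlope_profile_sub`. -/
lemma overlap_eq {δ : ℝ} (hδ : 0 < δ) {a b : ℝ} (hab : a ≤ b) (x : ℝ) :
    overlap δ a b x * δ = max (b - x) 0 - max (b - δ - x) 0 - (max (a - x) 0 - max (a - δ - x) 0) := by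
  rw [overlap, div_mul_cancel₀ _ hδ.ne', Set.Ioc_inter_Ioc, Measure.real, Real.volume_Ioc,
    ENNReal.toReal_ofReal']
  simp only [max_def, min_def]
  split_ifs <;> linarith

lemma sum_overlap_le_one {δ : ℝ} (hδ : 0 < δ) {ι : Type*} (S : Finset ι) {a b : ι → ℝ}
    (hd : Set.PairwiseDisjoint (S : Set ι) (fun i => Set.Ioc (a i) (b i))) (x : ℝ) :
    ∑ i ∈ S, overlap δ (a i) (b i) x ≤ 1 := by
  simp only [overlap]
  rw [← Finset.sum_div, div_le_one hδ, ← measureReal_biUnion_finset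
    (fun i hi j hj hij => ((hd hi hj hij).mono Set.inter_subset_left Set.inter_subset_left))
    (fun i _ => measurableSet_Ioc.inter measurableSet_Ioc)
    (fun i _ => (measure_lt_top_of_subset Set.inter_subset_right (by simp)).ne)]
  calc volume.real (⋃ i ∈ S, Set.Ioc (a i) (b i) ∩ Set.Ioc x (x + δ))
      ≤ volume.real (Set.Ioc x (x + δ)) :=
        measureReal_mono (Set.iUnion₂_subset fun i _ => Set.inter_subset_right) (by simp)
    _ = δ := by simp [Measure.real, hδ.le]

/-- The indices are integers in a half-open interval of length `N δ`; passing to integer endpoints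
by ceilings costs at most one. -/
lemma card_filter_grid_le {N n : ℕ} (hN : 0 < N) {δ : ℝ} (hδ : 0 < δ) (r : ℝ) :
    (((Finset.range n).filter fun i : ℕ => r ∈ Set.Ioc ((i : ℝ) / N) ((i : ℝ) / N + δ)).card : ℝ) ≤
      N * δ + 1 := by
  have hN' : (0 : ℝ) < N := by exact_mod_cast hN
  have hsub : ((Finset.range n).filter fun i : ℕ => r ∈ Set.Ioc ((i : ℝ) / N) ((i : ℝ) / N + δ)).map
      Nat.castEmbedding ⊆ Finset.Ico ⌈N * r - N * δ⌉ ⌈N * r⌉ := by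
    intro k hk
    simp only [Finset.mem_map, Finset.mem_filter, Nat.castEmbedding_apply] at hk
    obtain ⟨i, ⟨_, h1, h2⟩, rfl⟩ := hk
    rw [div_lt_iff₀ hN'] at h1
    rw [← sub_le_iff_le_add, le_div_iff₀ hN'] at h2
    rw [Finset.mem_Ico, Int.ceil_le, Int.lt_ceil]
    push_cast
    constructor <;> nlinarith
  have hcard := Finset.card_le_card hsub
  rw [Finset.card_map, Int.card_Ico] at hcard
  have h3 : ((⌈N * r⌉ - ⌈N * r - N * δ⌉).toNat : ℝ) ≤ N * δ + 1 := by
    have h4 : (((⌈N * r⌉ - ⌈N * r - N * δ⌉).toNat : ℤ) : ℝ) ≤ max (N * δ + 1) 0 := by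
      rw [Int.toNat_eq_max]
      push_cast
      refine max_le_max ?_ le_rfl
      have := Int.ceil_lt_add_one (N * r)
      have := Int.le_ceil (N * r - N * δ)
      linarith
    rw [max_eq_left (by positivity)] at h4
    exact_mod_cast h4
  exact (by exact_mod_cast hcard : _ ≤ ((⌈N * r⌉ - ⌈N * r - N * δ⌉).toNat : ℝ)).trans h3

/-- By exchanging sum and integral, the left side is `1 / δ` times the integral over `(a, b]` of the
number of grid windows that cover a point. The excess `1 / δ` over the leading factor `N` stays
bounded as `N` grows. -/
lemma sum_overlap_grid_le {N n : ℕ} (hN : 0 < N) {δ : ℝ} (hδ : 0 < δ) {a b : ℝ} (hab : a ≤ b) :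
    ∑ i ∈ Finset.range n, overlap δ a b ((i : ℝ) / N) ≤ (N + 1 / δ) * (b - a) := by
  have hN' : (0 : ℝ) < N := by exact_mod_cast hN
  have h1 : ∑ i ∈ Finset.range n, volume (Set.Ioc a b ∩ Set.Ioc ((i : ℝ) / N) ((i : ℝ) / N + δ)) ≤
      ENNReal.ofReal ((N * δ + 1) * (b - a)) := by
    calc ∑ i ∈ Finset.range n, volume (Set.Ioc a b ∩ Set.Ioc ((i : ℝ) / N) ((i : ℝ) / N + δ))
        = ∑ i ∈ Finset.range n, ∫⁻ r in Set.Ioc a b,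
            (Set.Ioc ((i : ℝ) / N) ((i : ℝ) / N + δ)).indicator 1 r := by
          refine Finset.sum_congr rfl fun i _ => ?_
          rw [lintegral_indicator_one measurableSet_Ioc,
            Measure.restrict_apply measurableSet_Ioc, Set.inter_comm]
      _ = ∫⁻ r in Set.Ioc a b, ∑ i ∈ Finset.range n,
            (Set.Ioc ((i : ℝ) / N) ((i : ℝ) / N + δ)).indicator 1 r :=
          (lintegral_finsetSum _ fun i _ => measurable_one.indicator measurableSet_Ioc).symm
      _ ≤ ∫⁻ _ in Set.Ioc a b, ENNReal.ofReal (N * δ + 1) := by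
          refine lintegral_mono fun r => ?_
          refine le_trans (le_of_eq ?_) (ENNReal.ofReal_le_ofReal (card_filter_grid_le (n := n) hN hδ r))
          rw [ENNReal.ofReal_natCast, Finset.card_filter]
          push_cast
          exact Finset.sum_congr rfl fun i _ => by simp [Set.indicator_apply]
      _ = _ := by
          rw [setLIntegral_const, Real.volume_Ioc, ← ENNReal.ofReal_mul (by positivity)]
  have h2 : ∑ i ∈ Finset.range n, volume.real (Set.Ioc a b ∩ Set.Ioc ((i : ℝ) / N) ((i : ℝ) / N + δ)) ≤
      (N * δ + 1) * (b - a) := by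
    have hne : ∀ i ∈ Finset.range n,
        volume (Set.Ioc a b ∩ Set.Ioc ((i : ℝ) / N) ((i : ℝ) / N + δ)) ≠ ∞ := fun i _ =>
      (measure_lt_top_of_subset Set.inter_subset_left (by simp)).ne
    simp only [Measure.real]
    rw [← ENNReal.toReal_sum hne]
    exact ENNReal.toReal_le_of_le_ofReal
      (mul_nonneg (by positivity) (sub_nonneg.2 hab)) h1
  simp only [overlap]
  rw [← Finset.sum_div, div_le_iff₀ hδ]
  refine h2.trans (le_of_eq ?_)
  field_simp

/-- The extension of `h` to the left of `0` with slope `α`. -/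
noncomputable def leftExtend (α : ℝ) (h : C(I, ℝ)) (t : ℝ) : ℝ := extend h t + α * min t 0

lemma continuous_leftExtend (α : ℝ) (h : C(I, ℝ)) : Continuous (leftExtend α h) := by
  have := continuous_extend h
  unfold leftExtend
  fun_prop

lemma leftExtend_of_nonpos {a α : ℝ} {h : C(I, ℝ)} (h0 : h 0 = a) {t : ℝ} (ht : t ≤ 0) :
    leftExtend α h t = a + α * t := by
  rw [leftExtend, min_eq_left ht, extend, Set.IccExtend_of_le_left zero_le_one _ ht, ← h0]
  rfl

lemma leftExtend_of_mem (α : ℝ) (h : C(I, ℝ)) {t : ℝ} (ht : t ∈ Set.Icc (0 : ℝ) 1) :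
    leftExtend α h t = extend h t := by
  rw [leftExtend, min_eq_right ht.1, mul_zero, add_zero]

lemma continuous_backSlope_leftExtend (α δ t : ℝ) :
    Continuous fun h : C(I, ℝ) => backSlope (leftExtend α h) δ t := by
  have h1 : ∀ t : ℝ, Continuous fun h : C(I, ℝ) => leftExtend α h t := fun t =>
    (continuous_eval_const (F := C(I, ℝ)) (Set.projIcc 0 1 zero_le_one t)).add continuous_const
  exact ((h1 t).sub (h1 (t - δ))).div_const δ

lemma leftExtend_profile {N : ℕ} (hN : 0 < N) {a α : ℝ} {φ : ℤ → ℝ} (h0 : φ 0 = a * N ^ 2)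
    (h1 : φ (-1) = a * N ^ 2 - α * N) {t : ℝ} (ht : t ≤ 1) :
    leftExtend α (profile N φ) t = a + α * t +
      (∑ i ∈ Finset.range (N + 1), max (t - i / N) 0 * discreteLaplacian φ i) / N := by
  have hN' : (0 : ℝ) < N := by exact_mod_cast hN
  have hmax : ∀ (t : ℝ) (i : ℕ), max ((N : ℝ) * t - i) 0 = N * max (t - i / N) 0 := fun t i => by
    rw [mul_max_of_nonneg _ _ hN'.le, mul_zero]
    congr 1
    field_simp
  have key : ∀ t : I, profile N φ t = a + α * t +
      (∑ i ∈ Finset.range (N + 1), max ((t : ℝ) - i / N) 0 * discreteLaplacian φ i) / N := by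
    intro t
    rw [profile_eq, h0, h1]
    simp only [hmax, mul_assoc]
    rw [← Finset.mul_sum]
    field_simp
    ring
  rcases le_total t 0 with ht0 | ht0
  · have hz : ∑ i ∈ Finset.range (N + 1), max (t - i / N) 0 * discreteLaplacian φ i = 0 :=
      Finset.sum_eq_zero fun i _ => by
        have : (0 : ℝ) ≤ i / N := by positivity
        rw [max_eq_right (by linarith), zero_mul]
    rw [leftExtend_of_nonpos (a := a) ?_ ht0, hz, zero_div, add_zero]
    rw [key 0]
    have hz : ∑ i ∈ Finset.range (N + 1), max (((0 : I) : ℝ) - i / N) 0 * discreteLaplacian φ i = 0 :=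
      Finset.sum_eq_zero fun i _ => by
        have : (0 : ℝ) ≤ i / N := by positivity
        rw [max_eq_right (by simpa using this), zero_mul]
    rw [hz]
    simp
  · rw [leftExtend_of_mem α _ ⟨ht0, ht⟩]
    have := key ⟨t, ht0, ht⟩
    rw [← extend_coe] at this
    exact this

/-- Constants and linear parts cancel in the second difference, leaving an average of the discrete
Laplacians weighted by overlaps. -/
lemma backSlope_profile_sub {N : ℕ} (hN : 0 < N) {a α : ℝ} {φ : ℤ → ℝ} (h0 : φ 0 = a * N ^ 2)
    (h1 : φ (-1) = a * N ^ 2 - α * N) {δ : ℝ} (hδ : 0 < δ) {x y : ℝ} (hxy : x ≤ y) (hy : y ≤ 1) :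
    backSlope (leftExtend α (profile N φ)) δ y - backSlope (leftExtend α (profile N φ)) δ x =
      (∑ i ∈ Finset.range (N + 1), overlap δ x y (i / N) * discreteLaplacian φ i) / N := by
  have hN' : (0 : ℝ) < N := by exact_mod_cast hN
  rw [backSlope, backSlope, leftExtend_profile hN h0 h1 hy, leftExtend_profile hN h0 h1 (hxy.trans hy),
    leftExtend_profile hN h0 h1 (by linarith : y - δ ≤ 1),
    leftExtend_profile hN h0 h1 (by linarith : x - δ ≤ 1)]
  have hs : ∑ i ∈ Finset.range (N + 1), overlap δ x y (i / N) * discreteLaplacian φ i =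
      ((∑ i ∈ Finset.range (N + 1), max (y - i / N) 0 * discreteLaplacian φ i) -
      (∑ i ∈ Finset.range (N + 1), max (y - δ - i / N) 0 * discreteLaplacian φ i) -
      ((∑ i ∈ Finset.range (N + 1), max (x - i / N) 0 * discreteLaplacian φ i) -
      (∑ i ∈ Finset.range (N + 1), max (x - δ - i / N) 0 * discreteLaplacian φ i))) / δ := by
    rw [eq_div_iff hδ.ne', Finset.sum_mul]
    simp only [← Finset.sum_sub_distrib]
    refine Finset.sum_congr rfl fun i _ => ?_
    rw [mul_right_comm, overlap_eq hδ hxy]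
    ring
  rw [hs]
  field_simp
  ring

/-- A function outside the energy ball violates one of the dual inequalities at some positive step
`δ`. Difference quotients at a fixed step are continuous in the supremum norm, unlike derivatives,
so the violation defines an open set on which Chernoff's inequality applies. -/
theorem exists_open_of_not_isSecondPrimitive {a α c M : ℝ} {L : ℝ → ℝ} {P : ℕ → Measure (ℤ → ℝ)}
    (hL : ConvexOn ℝ Set.univ L) (hL0 : L 0 = 0) (hLn : ∀ s, 0 ≤ L s)
    (hP : ∀ᶠ N : ℕ in atTop, ExpBound a α L c N (P N)) (h : C(I, ℝ))
    (hn : ¬ ∃ g, IsSecondPrimitive a α g h ∧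
      ∫⁻ t in Set.Ioo (0 : ℝ) 1, legE L (g t) ≤ ENNReal.ofReal M) :
    ∃ U : Set C(I, ℝ), IsOpen U ∧ h ∈ U ∧ ∃ D : ℝ, ∀ᶠ N : ℕ in atTop,
      P N (profile N ⁻¹' U) ≤ ENNReal.ofReal (Real.exp (D - (M - c) * N)) := by
  by_cases ha : h 0 = a
  · have hv : ¬ ∀ δ > 0, VariationBound L M (backSlope (leftExtend α h) δ) := fun hv => by
      obtain ⟨g, hg1, hg2, hg3⟩ := exists_second_derivative_of_variationBound hL0 hLn
        (continuous_leftExtend α h) (fun t ht => leftExtend_of_nonpos ha ht) hv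
      exact hn ⟨g, ⟨hg1, fun t ht => by rw [← leftExtend_of_mem α h ht, hg2 t ht]⟩, hg3⟩
    simp only [VariationBound] at hv
    push Not at hv
    obtain ⟨δ, hδ, n, x, y, s, hxy, hd, hlt⟩ := hv
    set B : ℝ := ∑ k ∈ Finset.range n, L (s k) * (y k - x k) with hB
    refine ⟨{h' | M + B < ∑ k ∈ Finset.range n, s k *
      (backSlope (leftExtend α h') δ (y k) - backSlope (leftExtend α h') δ (x k))}, ?_, hlt,
      1 / δ * B, ?_⟩
    · refine isOpen_lt continuous_const (continuous_finsetSum _ fun k _ => ?_)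
      exact ((continuous_backSlope_leftExtend α δ (y k)).sub
        (continuous_backSlope_leftExtend α δ (x k))).const_mul (s k)
    · filter_upwards [hP, eventually_gt_atTop 0] with N hN hN0
      have hN' : (0 : ℝ) < N := by exact_mod_cast hN0
      -- The weights write the violated functional as a linear combination of the Laplacians; at
      -- each site they form a subconvex combination of the multipliers `s k`.
      refine (hN.measure_le (fun i => ∑ k ∈ Finset.range n, s k * overlap δ (x k) (y k) (i / N))
        (m := N * (M + B)) ?_).trans (ENNReal.ofReal_le_ofReal (Real.exp_le_exp.2 ?_))
      · intro φ hφ h0 h1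
        have hφ' : M + B < ∑ k ∈ Finset.range n, s k *
          (backSlope (leftExtend α (profile N φ)) δ (y k) -
            backSlope (leftExtend α (profile N φ)) δ (x k)) := hφ
        rw [Finset.sum_congr rfl fun k hk => by
          rw [backSlope_profile_sub hN0 h0 h1 hδ (hxy k (Finset.mem_range.1 hk)).1
            (hxy k (Finset.mem_range.1 hk)).2]] at hφ'
        have e : ∑ i ∈ Finset.range (N + 1), (∑ k ∈ Finset.range n,
            s k * overlap δ (x k) (y k) (i / N)) * discreteLaplacian φ i =
            N * ∑ k ∈ Finset.range n, s k * ((∑ i ∈ Finset.range (N + 1),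
              overlap δ (x k) (y k) (i / N) * discreteLaplacian φ i) / N) := by
          simp only [Finset.sum_mul, Finset.mul_sum, Finset.sum_div]
          rw [Finset.sum_comm]
          refine Finset.sum_congr rfl fun k _ => Finset.sum_congr rfl fun i _ => ?_
          field_simp
        rw [e]
        exact mul_le_mul_of_nonneg_left hφ'.le hN'.le
      -- Jensen at every site, then counting grid windows. The term `N B` cancels against the
      -- threshold `N (M + B)`, and `B / δ` is the constant `D`.
      · have hsum : ∑ i ∈ Finset.range (N + 1),
            L (∑ k ∈ Finset.range n, s k * overlap δ (x k) (y k) (i / N)) ≤ (N + 1 / δ) * B := by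
          calc _ ≤ ∑ i ∈ Finset.range (N + 1), ∑ k ∈ Finset.range n,
                L (s k) * overlap δ (x k) (y k) (i / N) :=
                Finset.sum_le_sum fun i _ => map_sum_le_of_sum_le_one _ hL hL0
                  (fun k _ => overlap_nonneg hδ _ _ _) (sum_overlap_le_one hδ _ hd _)
            _ = ∑ k ∈ Finset.range n, L (s k) * ∑ i ∈ Finset.range (N + 1),
                overlap δ (x k) (y k) (i / N) := by
                rw [Finset.sum_comm]
                simp only [Finset.mul_sum]
            _ ≤ ∑ k ∈ Finset.range n, L (s k) * ((N + 1 / δ) * (y k - x k)) := by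
                refine Finset.sum_le_sum fun k hk => mul_le_mul_of_nonneg_left ?_ (hLn _)
                exact sum_overlap_grid_le hN0 hδ (hxy k (Finset.mem_range.1 hk)).1
            _ = (N + 1 / δ) * B := by
                rw [hB, Finset.mul_sum]
                exact Finset.sum_congr rfl fun k _ => by ring
        linarith
  · refine ⟨{h' | h' 0 ≠ a}, ?_, ha, 0, ?_⟩
    · exact (isClosed_eq (continuous_eval_const (F := C(I, ℝ)) 0) continuous_const).isOpen_compl
    · filter_upwards [hP, eventually_gt_atTop 0] with N hN hN0
      have hz : P N (profile N ⁻¹' {h' | h' 0 ≠ a}) = 0 := by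
        rw [← nonpos_iff_eq_zero, ← measure_empty (μ := P N)]
        refine measure_mono_ae ?_
        filter_upwards [hN.zero, hN.neg_one] with φ h0 h1 hmem
        refine hmem ?_
        have := leftExtend_profile hN0 h0 h1 (t := 0) zero_le_one
        rw [leftExtend_of_nonpos rfl le_rfl] at this
        have hz : ∑ i ∈ Finset.range (N + 1), max ((0 : ℝ) - i / N) 0 * discreteLaplacian φ i = 0 :=
          Finset.sum_eq_zero fun i _ => by
            have : (0 : ℝ) ≤ i / N := by positivity
            rw [max_eq_right (by simpa using this), zero_mul]
        rw [hz] at this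
        simpa using this
      rw [hz]
      exact zero_le

/-! ## Products of densities -/

/-- Tonelli, by induction on the set of coordinates already integrated out. Marginals need a base
point, hence the separate treatment of an empty product space. -/
lemma lintegral_pi_prod {ι : Type*} [Fintype ι] {X : ι → Type*} [∀ i, MeasurableSpace (X i)]
    (μ : ∀ i, Measure (X i)) [∀ i, SigmaFinite (μ i)] {f : ∀ i, X i → ℝ≥0∞}
    (hf : ∀ i, Measurable (f i)) :
    ∫⁻ y, ∏ i, f i (y i) ∂Measure.pi μ = ∏ i, ∫⁻ x, f i x ∂μ i := by
  classical
  have key : ∀ s : Finset ι, (∫⋯∫⁻_s, (fun y => ∏ i ∈ s, f i (y i)) ∂μ) =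
      fun _ => ∏ i ∈ s, ∫⁻ x, f i x ∂μ i := by
    intro s
    induction s using Finset.induction_on with
    | empty => simp
    | insert i s hi ih =>
      have hm : ∀ t : Finset ι, Measurable fun y : ∀ i, X i => ∏ i ∈ t, f i (y i) := fun t =>
        Finset.measurable_fun_prod t fun j _ => (hf j).comp (measurable_pi_apply j)
      rw [lmarginal_insert' _ (hm _) hi]
      have h1 : (fun x : ∀ i, X i => ∫⁻ xi, ∏ j ∈ insert i s, f j (Function.update x i xi j) ∂μ i) =
          fun x => (∫⁻ xi, f i xi ∂μ i) * ∏ j ∈ s, f j (x j) := by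
        funext x
        rw [← lintegral_mul_const _ (hf i)]
        refine lintegral_congr fun xi => ?_
        rw [Finset.prod_insert hi, Function.update_self]
        congr 1
        refine Finset.prod_congr rfl fun j hj => ?_
        rw [Function.update_of_ne (ne_of_mem_of_not_mem hj hi)]
      rw [h1]
      funext x
      have h2 := congrFun ih x
      rw [lmarginal] at h2 ⊢
      rw [lintegral_const_mul _ (by exact (hm s).comp measurable_updateFinset), h2,
        Finset.prod_insert hi]
  rcases isEmpty_or_nonempty (∀ i, X i) with he | ⟨⟨x⟩⟩
  · obtain ⟨i, hi⟩ : ∃ i, IsEmpty (X i) := by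
      by_contra! hcon
      exact he.false fun i => (hcon i).some
    rw [Finset.prod_eq_zero (Finset.mem_univ i) (by simp [lintegral_of_isEmpty])]
    simp [lintegral_of_isEmpty]
  · rw [lintegral_eq_lmarginal_univ x, key Finset.univ]

lemma pi_withDensity {ι : Type*} [Fintype ι] {X : ι → Type*} [∀ i, MeasurableSpace (X i)]
    (μ : ∀ i, Measure (X i)) [∀ i, SigmaFinite (μ i)] {f : ∀ i, X i → ℝ≥0∞}
    (hf : ∀ i, Measurable (f i)) [∀ i, SigmaFinite ((μ i).withDensity (f i))] :
    Measure.pi (fun i => (μ i).withDensity (f i)) =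
      (Measure.pi μ).withDensity fun y => ∏ i, f i (y i) := by
  refine Measure.pi_eq fun s hs => ?_
  rw [withDensity_apply _ (MeasurableSet.univ_pi hs), Measure.restrict_pi_pi, lintegral_pi_prod _ hf]
  exact Finset.prod_congr rfl fun i _ => (withDensity_apply _ (hs i)).symm

lemma withDensity_map_eq {X Y : Type*} [MeasurableSpace X] [MeasurableSpace Y] {μ : Measure X}
    {g : X → Y} (hg : Measurable g) {F : Y → ℝ≥0∞} (hF : Measurable F) :
    (μ.map g).withDensity F = (μ.withDensity (F ∘ g)).map g := by
  ext s hs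
  rw [withDensity_apply _ hs, Measure.map_apply hg hs, withDensity_apply _ (hg hs),
    Measure.restrict_map hg hs, lintegral_map hF hg]
  rfl

/-! ## Change of variables -/

lemma measurable_glue (ψ : ℤ → ℝ) (S : Finset ℤ) : Measurable (glue ψ S) := by
  refine measurable_pi_lambda _ fun k => ?_
  by_cases hk : k ∈ S
  · simp only [glue, hk, dif_pos]
    exact measurable_pi_apply _
  · simp only [glue, hk, dif_neg, not_false_eq_true]
    exact measurable_const

lemma glue_of_notMem (ψ : ℤ → ℝ) {S : Finset ℤ} (x : S → ℝ) {k : ℤ} (hk : k ∉ S) :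
    glue ψ S x k = ψ k := dif_neg hk

lemma glue_eq_add (ψ : ℤ → ℝ) (S : Finset ℤ) (x : S → ℝ) (k : ℤ) :
    glue ψ S x k = glue 0 S x k + glue ψ S 0 k := by
  by_cases hk : k ∈ S <;> simp [glue, hk]

lemma discreteLaplacian_add (φ χ : ℤ → ℝ) (k : ℤ) :
    discreteLaplacian (fun j => φ j + χ j) k = discreteLaplacian φ k + discreteLaplacian χ k := by
  simp only [discreteLaplacian]; ring

lemma discreteLaplacian_glue (ψ : ℤ → ℝ) (S : Finset ℤ) (x : S → ℝ) (k : ℤ) :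
    discreteLaplacian (glue ψ S x) k =
      discreteLaplacian (glue 0 S x) k + discreteLaplacian (glue ψ S 0) k := by
  rw [← discreteLaplacian_add]
  congr 1
  funext j
  exact glue_eq_add ψ S x j

/-- The discrete Laplacian of a field with zero boundary values. -/
noncomputable def glueLaplacian (S : Finset ℤ) : (S → ℝ) →ₗ[ℝ] ℤ → ℝ where
  toFun x k := discreteLaplacian (glue 0 S x) k
  map_add' x y := by
    funext k
    rw [Pi.add_apply, ← discreteLaplacian_add]
    congr 1
    funext j
    by_cases hj : j ∈ S <;> simp [glue, hj]
  map_smul' c x := by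
    funext k
    have : ∀ j, glue 0 S (c • x) j = c * glue 0 S x j := fun j => by
      by_cases hj : j ∈ S <;> simp [glue, hj]
    simp only [discreteLaplacian, this, RingHom.id_apply, Pi.smul_apply, smul_eq_mul]
    ring

/-- The map from the free sites `1, …, m` to the discrete Laplacians at `0, …, m - 1`. -/
noncomputable def laplacianMap (ψ : ℤ → ℝ) (S : Finset ℤ) (x : S → ℝ) (k : S) : ℝ :=
  discreteLaplacian (glue ψ S x) (k - 1)

/-- The Laplacian at `k - 1` contains `φ_k` with coefficient one and otherwise only earlier sites,
so the linear part is lower triangular with unit diagonal. The boundary values contribute a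
translation. -/
lemma measurePreserving_laplacianMap (ψ : ℤ → ℝ) (m : ℤ) :
    MeasurePreserving (laplacianMap ψ (Finset.Icc 1 m)) := by
  classical
  set S := Finset.Icc 1 m with hS
  let A : (S → ℝ) →ₗ[ℝ] (S → ℝ) :=
    (LinearMap.funLeft ℝ ℝ fun k : S => (k : ℤ) - 1).comp (glueLaplacian S)
  have hA : ∀ x k, A x k = discreteLaplacian (glue 0 S x) (k - 1) := fun x k => rfl
  have hsingle : ∀ (l : S) (j : ℤ), glue 0 S (Pi.single l 1) j = if j = l then 1 else 0 := by
    intro l j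
    by_cases hj : j ∈ S
    · simp only [glue, hj, dif_pos, Pi.single_apply, Subtype.ext_iff]
    · have : j ≠ l := fun e => hj (e ▸ l.2)
      simp [glue, hj, this]
  have hentry : ∀ k l : S, LinearMap.toMatrix' A k l =
      (if (k : ℤ) = l then (1 : ℝ) else 0) + (if (k : ℤ) - 2 = l then 1 else 0) -
        2 * (if (k : ℤ) - 1 = l then 1 else 0) := by
    intro k l
    rw [LinearMap.toMatrix'_apply, hA, discreteLaplacian]
    simp only [hsingle]
    rw [show (k : ℤ) - 1 + 1 = k by ring, show (k : ℤ) - 1 - 1 = k - 2 by ring]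
  have hdet : LinearMap.det A = 1 := by
    rw [← LinearMap.det_toMatrix', Matrix.det_of_isLowerTriangular]
    · refine Finset.prod_eq_one fun k _ => ?_
      rw [hentry]
      simp
    · intro k l hkl
      have hkl' : (k : ℤ) < l := hkl
      rw [hentry, if_neg (by omega), if_neg (by omega), if_neg (by omega)]
      ring
  have hmap : MeasurePreserving (fun x => A x) volume volume := by
    refine ⟨?_, ?_⟩
    · exact (LinearMap.continuous_of_finiteDimensional A).measurable
    · rw [Real.map_linearMap_volume_pi_eq_smul_volume_pi (by rw [hdet]; exact one_ne_zero), hdet]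
      simp
  have htrans := (measurePreserving_add_right (volume : Measure (S → ℝ))
    (fun k : S => discreteLaplacian (glue ψ S 0) (k - 1))).comp hmap
  have heq : laplacianMap ψ S = (fun x => x + fun k : S => discreteLaplacian (glue ψ S 0) (k - 1)) ∘
      fun x => A x := by
    funext x k
    exact discreteLaplacian_glue ψ S x (k - 1)
  rw [heq]
  exact htrans

/-! ## Densities of the Gibbs measures -/

/-- The value `⊤` is allowed; excluding `⊥` is what makes negation additive on `EReal`. -/
lemma exp_neg_sum {ι : Type*} (s : Finset ι) {f : ι → EReal} (hf : ∀ i, f i ≠ ⊥) :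
    EReal.exp (-∑ i ∈ s, f i) = ∏ i ∈ s, EReal.exp (-f i) := by
  classical
  have hb : ∀ s : Finset ι, ∑ i ∈ s, f i ≠ ⊥ := fun s => by
    induction s using Finset.induction_on with
    | empty => simp
    | insert i s hi ih =>
      rw [Finset.sum_insert hi]
      exact EReal.add_ne_bot_iff.2 ⟨hf i, ih⟩
  induction s using Finset.induction_on with
  | empty => simp
  | insert i s hi ih =>
    rw [Finset.sum_insert hi, Finset.prod_insert hi, EReal.neg_add (Or.inl (hf i)) (Or.inr (hb s)),
      sub_eq_add_neg, EReal.exp_add, ih]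

lemma exp_neg_hamiltonian {V : ℝ → EReal} (hV : ∀ x, V x ≠ ⊥) (N : ℕ) (φ : ℤ → ℝ) :
    EReal.exp (-hamiltonian V (-1) (N + 1) φ) =
      ∏ i ∈ Finset.range (N + 1), EReal.exp (-V (discreteLaplacian φ i)) := by
  rw [hamiltonian, sum_Ioo_int_eq_sum_range N fun k => V (discreteLaplacian φ k),
    exp_neg_sum _ fun i => hV _]

lemma measurable_exp_neg_hamiltonian {V : ℝ → EReal} (hV : ∀ x, V x ≠ ⊥)
    (hm : Measurable fun x => EReal.exp (-V x)) (N : ℕ) :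
    Measurable fun φ : ℤ → ℝ => EReal.exp (-hamiltonian V (-1) (N + 1) φ) := by
  simp only [exp_neg_hamiltonian hV]
  exact Finset.measurable_fun_prod _ fun i _ => hm.comp (measurable_discreteLaplacian i)

lemma ae_gibbsMeasure_eq (V : ℝ → EReal) (N : ℕ) (ψ : ℤ → ℝ) (S : Finset ℤ) {k : ℤ} (hk : k ∉ S) :
    ∀ᵐ φ ∂gibbsMeasure V N ψ S, φ k = ψ k := by
  refine Measure.ae_smul_measure ((withDensity_absolutelyContinuous _ _).ae_le ?_) _
  exact (ae_map_iff (measurable_glue ψ S).aemeasurable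
    (measurableSet_eq_fun (measurable_pi_apply k) measurable_const)).2
    (Eventually.of_forall fun x => glue_of_notMem ψ x hk)

lemma prod_Icc_int_eq_prod_range {β : Type*} [CommMonoid β] (N : ℕ) (f : ℤ → β) :
    ∏ k : Finset.Icc (1 : ℤ) (N + 1), f (k - 1) = ∏ i ∈ Finset.range (N + 1), f i := by
  rw [Finset.prod_coe_sort (Finset.Icc (1 : ℤ) (N + 1)) fun k => f (k - 1)]
  refine Finset.prod_bij' (fun k _ => (k - 1).toNat) (fun i _ => (i : ℤ) + 1) ?_ ?_ ?_ ?_ ?_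
  · intro k hk
    rw [Finset.mem_Icc] at hk
    rw [Finset.mem_range]
    omega
  · intro i hi
    rw [Finset.mem_range] at hi
    rw [Finset.mem_Icc]
    omega
  · intro k hk
    rw [Finset.mem_Icc] at hk
    omega
  · intro i hi
    omega
  · intro k hk
    rw [Finset.mem_Icc] at hk
    congr 1
    omega

lemma sum_Icc_int_eq_sum_range {β : Type*} [AddCommMonoid β] (N : ℕ) (f : ℤ → β) :
    ∑ k : Finset.Icc (1 : ℤ) (N + 1), f (k - 1) = ∑ i ∈ Finset.range (N + 1), f i :=
  prod_Icc_int_eq_prod_range (β := Multiplicative β) N f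

lemma isProbabilityMeasure_incrementLaw {V : ℝ → EReal} (hV : IsPotential V) :
    IsProbabilityMeasure (incrementLaw V) := by
  refine ⟨?_⟩
  rw [incrementLaw, Measure.smul_apply, withDensity_apply _ MeasurableSet.univ,
    Measure.restrict_univ, smul_eq_mul]
  exact ENNReal.inv_mul_cancel hV.lintegral_pos.ne' hV.lintegral_lt_top.ne

/-- Under the measure with free right boundary the discrete Laplacians are independent and
identically distributed. -/
theorem map_freeGibbs {V : ℝ → EReal} (hV : IsPotential V) (a α : ℝ) (N : ℕ) :
    (freeGibbs V a α N).map (fun φ (k : Finset.Icc (1 : ℤ) (N + 1)) => discreteLaplacian φ (k - 1)) =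
      Measure.pi fun _ => incrementLaw V := by
  set S := Finset.Icc (1 : ℤ) (N + 1) with hS
  set ψ := freeBoundary a α N with hψ
  set ρ : ℝ → ℝ≥0∞ := fun x => EReal.exp (-V x) with hρ
  have hρm : Measurable ρ := hV.continuous_exp.measurable
  set D : (S → ℝ) → ℝ≥0∞ := fun y => ∏ k, ρ (y k) with hD
  have hDm : Measurable D := Finset.measurable_fun_prod _ fun k _ => hρm.comp (measurable_pi_apply k)
  have hFm := measurable_exp_neg_hamiltonian hV.ne_bot hρm N
  have hlap : Measurable fun (φ : ℤ → ℝ) (k : S) => discreteLaplacian φ (k - 1) :=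
    measurable_pi_lambda _ fun k => measurable_discreteLaplacian _
  have hT := measurePreserving_laplacianMap ψ (N + 1 : ℤ)
  have hFD : (fun φ : ℤ → ℝ => EReal.exp (-hamiltonian V (-1) (N + 1) φ)) ∘ glue ψ S =
      D ∘ laplacianMap ψ S := by
    funext x
    simp only [Function.comp_apply, exp_neg_hamiltonian hV.ne_bot]
    exact (prod_Icc_int_eq_prod_range N
      fun k => ρ (discreteLaplacian (glue ψ S x) k)).symm
  set z : ℝ≥0∞ := ∫⁻ x, ρ x with hz
  have hDint : ∫⁻ y, D y = z ^ Fintype.card S := by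
    rw [volume_pi, hD, lintegral_pi_prod _ fun _ => hρm]
    simp [hz]
  have hZ : partitionFunction V N ψ S = z ^ Fintype.card S := by
    rw [partitionFunction, referenceMeasure, lintegral_map hFm (measurable_glue ψ S), ← hDint,
      ← hT.lintegral_comp hDm]
    exact lintegral_congr fun x => congrFun hFD x
  have h1 : ((referenceMeasure ψ S).withDensity fun φ =>
      EReal.exp (-hamiltonian V (-1) (N + 1) φ)).map
        (fun (φ : ℤ → ℝ) (k : S) => discreteLaplacian φ (k - 1)) = volume.withDensity D := by
    rw [referenceMeasure, withDensity_map_eq (measurable_glue ψ S) hFm,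
      Measure.map_map hlap (measurable_glue ψ S), hFD]
    change Measure.map (laplacianMap ψ S) _ = _
    rw [← withDensity_map_eq hT.measurable hDm, hT.map_eq]
  have hz0 : z ≠ 0 := hV.lintegral_pos.ne'
  have hzt : z ≠ ∞ := hV.lintegral_lt_top.ne
  have hprob := isProbabilityMeasure_incrementLaw hV
  have hlaw : incrementLaw V = volume.withDensity fun x => z⁻¹ * ρ x := by
    rw [incrementLaw]
    exact (withDensity_smul _ hρm).symm
  have : SigmaFinite (volume.withDensity fun x => z⁻¹ * ρ x) := by rw [← hlaw]; infer_instance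
  rw [freeGibbs, gibbsMeasure, Measure.map_smul, h1, hZ, hlaw,
    pi_withDensity (fun _ : S => (volume : Measure ℝ)) fun _ => hρm.const_mul _, ← volume_pi]
  simp only [Finset.prod_mul_distrib, Finset.prod_const, Finset.card_univ]
  rw [← ENNReal.inv_pow]
  exact (withDensity_smul _ hDm).symm

/-! ## Discretisation of smooth profiles -/

/-- The function `t ↦ a + α t + ∫₀¹ (t - s)⁺ g(s) ds`. -/
noncomputable def secondPrimitive (a α : ℝ) (g : ℝ → ℝ) (t : ℝ) : ℝ :=
  a + α * t + ∫ s in Set.Ioo (0 : ℝ) 1, max (t - s) 0 * g s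

/-- The microscopic configuration obtained by sampling a macroscopic function. -/
noncomputable def gridField (H : ℝ → ℝ) (N : ℕ) (k : ℤ) : ℝ := (N : ℝ) ^ 2 * H (k / N)

/-- The tent function of width `2 / N`, height `N` and centre `i / N`. -/
noncomputable def tent (N i : ℕ) (s : ℝ) : ℝ :=
  (N : ℝ) ^ 2 * (max (((i : ℝ) + 1) / N - s) 0 - max ((i : ℝ) / N - s) 0 -
    (max ((i : ℝ) / N - s) 0 - max (((i : ℝ) - 1) / N - s) 0))

lemma continuous_tent (N i : ℕ) : Continuous (tent N i) := by
  unfold tent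
  fun_prop

lemma tent_eq_overlap {N : ℕ} (hN : 0 < N) (i : ℕ) (s : ℝ) :
    tent N i s = N * overlap (1 / N) (i / N) ((i + 1) / N) s := by
  have hN' : (0 : ℝ) < N := by exact_mod_cast hN
  have h := overlap_eq (δ := 1 / (N : ℝ)) (by positivity) (a := (i : ℝ) / N) (b := ((i : ℝ) + 1) / N)
    (by gcongr; linarith) s
  rw [show ((i : ℝ) + 1) / N - 1 / N - s = i / N - s by ring,
    show (i : ℝ) / N - 1 / N - s = (i - 1) / N - s by ring] at h
  rw [tent, ← h]
  field_simp

lemma tent_nonneg {N : ℕ} (hN : 0 < N) (i : ℕ) (s : ℝ) : 0 ≤ tent N i s := by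
  have hN' : (0 : ℝ) < N := by exact_mod_cast hN
  rw [tent_eq_overlap hN]
  exact mul_nonneg hN'.le (overlap_nonneg (by positivity) _ _ _)

lemma integral_pos_part {A B c : ℝ} (hA : A ≤ c) (hB : c ≤ B) :
    ∫ s in A..B, max (c - s) 0 = (c - A) ^ 2 / 2 := by
  have hcont : Continuous fun s : ℝ => max (c - s) 0 := by fun_prop
  rw [← intervalIntegral.integral_add_adjacent_intervals (hcont.intervalIntegrable A c)
    (hcont.intervalIntegrable c B)]
  have h1 : ∫ s in A..c, max (c - s) 0 = ∫ s in A..c, (c - s) :=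
    intervalIntegral.integral_congr fun s hs => by
      rw [Set.uIcc_of_le hA] at hs
      exact max_eq_left (sub_nonneg.2 hs.2)
  have h2 : ∫ s in c..B, max (c - s) 0 = ∫ s in c..B, (0 : ℝ) :=
    intervalIntegral.integral_congr fun s hs => by
      rw [Set.uIcc_of_le hB] at hs
      exact max_eq_right (sub_nonpos.2 hs.1)
  rw [h1, h2, intervalIntegral.integral_comp_sub_left (fun x => x)]
  simp

lemma tent_eq_zero {N : ℕ} (hN : 0 < N) {i : ℕ} {s : ℝ}
    (hs : s ∉ Set.Icc (((i : ℝ) - 1) / N) (((i : ℝ) + 1) / N)) : tent N i s = 0 := by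
  have hN' : (0 : ℝ) < N := by exact_mod_cast hN
  have h1 : ((i : ℝ) - 1) / N ≤ i / N := by gcongr; linarith
  have h2 : (i : ℝ) / N ≤ (i + 1) / N := by gcongr; linarith
  have h3 : ((i : ℝ) + 1) / N - i / N = i / N - (i - 1) / N := by ring
  rw [tent]
  rw [Set.mem_Icc, not_and_or, not_le, not_le] at hs
  rcases hs with hs | hs
  · rw [max_eq_left (by linarith), max_eq_left (by linarith), max_eq_left (by linarith)]
    rw [mul_eq_zero]; right; linarith
  · rw [max_eq_right (by linarith), max_eq_right (by linarith), max_eq_right (by linarith)]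
    simp

lemma integral_tent {N : ℕ} (hN : 0 < N) (i : ℕ) :
    ∫ s in (((i : ℝ) - 1) / N)..(((i : ℝ) + 1) / N), tent N i s = 1 := by
  have hN' : (0 : ℝ) < N := by exact_mod_cast hN
  have h1 : ((i : ℝ) - 1) / N ≤ i / N := by gcongr; linarith
  have h2 : (i : ℝ) / N ≤ (i + 1) / N := by gcongr; linarith
  have hc : ∀ c A B : ℝ, IntervalIntegrable (fun s : ℝ => max (c - s) 0) volume A B := fun c A B =>
    (by fun_prop : Continuous fun s : ℝ => max (c - s) 0).intervalIntegrable _ _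
  simp only [tent]
  rw [intervalIntegral.integral_const_mul, intervalIntegral.integral_sub ((hc _ _ _).sub (hc _ _ _))
    ((hc _ _ _).sub (hc _ _ _)), intervalIntegral.integral_sub (hc _ _ _) (hc _ _ _),
    intervalIntegral.integral_sub (hc _ _ _) (hc _ _ _), integral_pos_part (h1.trans h2) le_rfl,
    integral_pos_part h1 h2, integral_pos_part le_rfl (h1.trans h2)]
  field_simp
  ring

/-- Only an inequality is available on `(0, 1)`: the tents at `i = 0` and `i = N` stick out of the
interval and lose part of their mass there. -/
lemma lintegral_tent_le_one {N : ℕ} (hN : 0 < N) (i : ℕ) (S : Set ℝ) :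
    ∫⁻ s in S, ENNReal.ofReal (tent N i s) ≤ 1 := by
  have hN' : (0 : ℝ) < N := by exact_mod_cast hN
  have hle : ((i : ℝ) - 1) / N ≤ ((i : ℝ) + 1) / N := by gcongr; linarith
  calc ∫⁻ s in S, ENNReal.ofReal (tent N i s) ≤ ∫⁻ s, ENNReal.ofReal (tent N i s) :=
        setLIntegral_le_lintegral _ _
    _ = ∫⁻ s in Set.Icc (((i : ℝ) - 1) / N) (((i : ℝ) + 1) / N), ENNReal.ofReal (tent N i s) := by
        rw [← lintegral_indicator measurableSet_Icc]
        refine lintegral_congr fun s => ?_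
        by_cases hs : s ∈ Set.Icc (((i : ℝ) - 1) / N) (((i : ℝ) + 1) / N)
        · rw [Set.indicator_of_mem hs]
        · rw [Set.indicator_of_notMem hs, tent_eq_zero hN hs, ENNReal.ofReal_zero]
    _ = 1 := by
        rw [← ofReal_integral_eq_lintegral_ofReal (continuous_tent N i).integrableOn_Icc
          (Eventually.of_forall fun s => tent_nonneg hN i s), integral_Icc_eq_integral_Ioc,
          ← intervalIntegral.integral_of_le hle, integral_tent hN, ENNReal.ofReal_one]

/-- A tent is a difference of consecutive first differences of the kernel, so the sum telescopes. Up
to the factor `N` the tents are a partition of unity on `(0, 1)`. -/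
lemma sum_tent {N : ℕ} (hN : 0 < N) {s : ℝ} (hs : s ∈ Set.Ioo (0 : ℝ) 1) :
    ∑ i ∈ Finset.range (N + 1), tent N i s = N := by
  have hN' : (0 : ℝ) < N := by exact_mod_cast hN
  have h : ∀ i : ℕ, tent N i s =
      (fun j : ℕ => (N : ℝ) ^ 2 * (max ((j : ℝ) / N - s) 0 - max (((j : ℝ) - 1) / N - s) 0)) (i + 1) -
      (fun j : ℕ => (N : ℝ) ^ 2 * (max ((j : ℝ) / N - s) 0 - max (((j : ℝ) - 1) / N - s) 0)) i := by
    intro i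
    simp only [tent]
    push_cast
    rw [add_sub_cancel_right]
    ring
  rw [Finset.sum_congr rfl fun i _ => h i, Finset.sum_range_sub (fun j : ℕ =>
    (N : ℝ) ^ 2 * (max ((j : ℝ) / N - s) 0 - max (((j : ℝ) - 1) / N - s) 0))]
  have e1 : (0 : ℝ) - 1 ≤ 0 := by norm_num
  have e2 : ((0 : ℝ) - 1) / N ≤ 0 := div_nonpos_of_nonpos_of_nonneg e1 hN'.le
  have e3 : ((N : ℝ) + 1) / N = 1 + 1 / N := by field_simp
  have e4 : (0 : ℝ) < 1 / N := by positivity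
  push_cast
  rw [add_sub_cancel_right, div_self hN'.ne', e3, zero_div,
    max_eq_left (by linarith [hs.2] : (0 : ℝ) ≤ 1 + 1 / N - s),
    max_eq_left (by linarith [hs.2] : (0 : ℝ) ≤ 1 - s),
    max_eq_right (by linarith [hs.1] : (0 : ℝ) - s ≤ 0),
    max_eq_right (by linarith [hs.1] : ((0 : ℝ) - 1) / N - s ≤ 0)]
  field_simp
  ring

section
variable {a α : ℝ} {g : ℝ → ℝ}

lemma integrableOn_max_mul (hg : IntegrableOn g (Set.Ioo 0 1)) (t : ℝ) :
    IntegrableOn (fun s => max (t - s) 0 * g s) (Set.Ioo 0 1) := by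
  refine Integrable.bdd_mul (c := |t|) hg (by fun_prop) ?_
  rw [ae_restrict_iff' measurableSet_Ioo]
  refine Eventually.of_forall fun s hs => ?_
  rw [Real.norm_eq_abs, abs_of_nonneg (le_max_right _ _)]
  exact max_le (by linarith [hs.1, le_abs_self t]) (abs_nonneg _)

lemma gridField_zero {N : ℕ} : gridField (secondPrimitive a α g) N 0 = a * N ^ 2 := by
  have : ∫ s in Set.Ioo (0 : ℝ) 1, max ((((0 : ℤ) : ℝ) / N) - s) 0 * g s = 0 := by
    refine (setIntegral_congr_fun (g := fun _ => (0 : ℝ)) measurableSet_Ioo fun s hs => ?_).trans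
      (by simp)
    simp only [Int.cast_zero, zero_div]
    rw [max_eq_right (by linarith [hs.1]), zero_mul]
  rw [gridField, secondPrimitive, this]
  simp
  ring

lemma gridField_neg_one {N : ℕ} (hN : 0 < N) :
    gridField (secondPrimitive a α g) N (-1) = a * N ^ 2 - α * N := by
  have hN' : (0 : ℝ) < N := by exact_mod_cast hN
  have h1 : (0 : ℝ) < 1 / N := by positivity
  have : ∫ s in Set.Ioo (0 : ℝ) 1, max ((((-1 : ℤ) : ℝ) / N) - s) 0 * g s = 0 := by
    refine (setIntegral_congr_fun (g := fun _ => (0 : ℝ)) measurableSet_Ioo fun s hs => ?_).trans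
      (by simp)
    have e : ((-1 : ℤ) : ℝ) / N = -(1 / N) := by push_cast; ring
    simp only [e]
    rw [max_eq_right (by linarith [hs.1]), zero_mul]
  rw [gridField, secondPrimitive, this]
  push_cast
  field_simp
  ring

lemma integrableOn_tent_mul (hg : IntegrableOn g (Set.Ioo 0 1)) {N : ℕ} (i : ℕ) :
    IntegrableOn (fun s => tent N i s * g s) (Set.Ioo 0 1) := by
  obtain ⟨C, hC⟩ := isCompact_Icc.exists_bound_of_continuousOn (s := Set.Icc (0 : ℝ) 1)
    (continuous_tent N i).continuousOn
  refine Integrable.bdd_mul (c := C) hg (continuous_tent N i).aestronglyMeasurable ?_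
  rw [ae_restrict_iff' measurableSet_Ioo]
  exact Eventually.of_forall fun s hs => hC s (Set.Ioo_subset_Icc_self hs)

/-- The affine part drops out, and the second difference in `t` turns the kernel `(t - s)⁺` into a
tent. -/
lemma discreteLaplacian_gridField (hg : IntegrableOn g (Set.Ioo 0 1)) {N : ℕ} (hN : 0 < N) (i : ℕ) :
    discreteLaplacian (gridField (secondPrimitive a α g) N) i =
      ∫ s in Set.Ioo (0 : ℝ) 1, tent N i s * g s := by
  have hN' : (0 : ℝ) < N := by exact_mod_cast hN
  have h := integrableOn_max_mul hg
  have e : ∀ s, tent N i s * g s = (N : ℝ) ^ 2 * ((max (((i : ℝ) + 1) / N - s) 0 * g s +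
      max (((i : ℝ) - 1) / N - s) 0 * g s) - 2 * (max ((i : ℝ) / N - s) 0 * g s)) := fun s => by
    simp only [tent]; ring
  simp only [e]
  have hadd : IntegrableOn (fun s => max (((i : ℝ) + 1) / N - s) 0 * g s +
      max (((i : ℝ) - 1) / N - s) 0 * g s) (Set.Ioo 0 1) := (h _).add (h _)
  rw [integral_const_mul, integral_sub hadd ((h _).const_mul 2),
    integral_add (h _) (h _), integral_const_mul]
  simp only [discreteLaplacian, gridField, secondPrimitive]
  push_cast
  field_simp
  ring

lemma ofReal_integral_le_lintegral_ofReal {X : Type*} [MeasurableSpace X] {μ : Measure X} {f : X → ℝ}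
    (hf : Integrable f μ) : ENNReal.ofReal (∫ x, f x ∂μ) ≤ ∫⁻ x, ENNReal.ofReal (f x) ∂μ := by
  have h1 : ∫ x, f x ∂μ ≤ ∫ x, max (f x) 0 ∂μ :=
    integral_mono hf hf.pos_part fun x => le_max_left _ _
  refine (ENNReal.ofReal_le_ofReal h1).trans (le_of_eq ?_)
  rw [ofReal_integral_eq_lintegral_ofReal hf.pos_part (Eventually.of_forall fun x => le_max_right _ _)]
  simp [ENNReal.ofReal_max]

/-- Jensen's inequality for averaging against a tent, proved for each affine function below the
Legendre transform. Mass smaller than one is harmless because `L` is nonnegative. -/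
lemma legE_discreteLaplacian_le {L : ℝ → ℝ} (hL : ∀ s, 0 ≤ L s) (hg : IntegrableOn g (Set.Ioo 0 1))
    {N : ℕ} (hN : 0 < N) (i : ℕ) :
    legE L (discreteLaplacian (gridField (secondPrimitive a α g) N) i) ≤
      ∫⁻ s in Set.Ioo (0 : ℝ) 1, ENNReal.ofReal (tent N i s) * legE L (g s) := by
  refine iSup_le fun q => ?_
  rw [discreteLaplacian_gridField hg hN]
  have hti : IntegrableOn (fun s => tent N i s) (Set.Ioo 0 1) :=
    (continuous_tent N i).integrableOn_Icc.mono_set Set.Ioo_subset_Icc_self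
  have h1 : ∫ s in Set.Ioo (0 : ℝ) 1, tent N i s ≤ 1 := by
    have := lintegral_tent_le_one hN i (Set.Ioo (0 : ℝ) 1)
    rw [← ofReal_integral_eq_lintegral_ofReal hti (Eventually.of_forall fun s => tent_nonneg hN i s),
      ← ENNReal.ofReal_one, ENNReal.ofReal_le_ofReal_iff zero_le_one] at this
    exact this
  have hint : IntegrableOn (fun s => tent N i s * (q * g s - L q)) (Set.Ioo 0 1) := by
    have e : (fun s => tent N i s * (q * g s - L q)) =
        fun s => q * (tent N i s * g s) - L q * tent N i s := by
      funext s; ring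
    rw [e]
    exact ((integrableOn_tent_mul hg i).const_mul q).sub (hti.const_mul _)
  have h2 : q * (∫ s in Set.Ioo (0 : ℝ) 1, tent N i s * g s) - L q ≤
      ∫ s in Set.Ioo (0 : ℝ) 1, tent N i s * (q * g s - L q) := by
    have e : ∀ s, tent N i s * (q * g s - L q) = q * (tent N i s * g s) - L q * tent N i s :=
      fun s => by ring
    simp only [e]
    rw [integral_sub ((integrableOn_tent_mul hg i).const_mul q) (hti.const_mul _), integral_const_mul,
      integral_const_mul]
    nlinarith [hL q]
  refine (ENNReal.ofReal_le_ofReal h2).trans ((ofReal_integral_le_lintegral_ofReal hint).trans ?_)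
  refine lintegral_mono fun s => ?_
  rw [ENNReal.ofReal_mul (tent_nonneg hN i s)]
  gcongr
  exact ofReal_le_legE L q (g s)

lemma legE_discreteLaplacian_le_of_le {L : ℝ → ℝ} (hL : ∀ s, 0 ≤ L s)
    (hg : IntegrableOn g (Set.Ioo 0 1)) {K : ℝ≥0∞} (hK : ∀ s, legE L (g s) ≤ K)
    {N : ℕ} (hN : 0 < N) (i : ℕ) :
    legE L (discreteLaplacian (gridField (secondPrimitive a α g) N) i) ≤ K := by
  refine (legE_discreteLaplacian_le hL hg hN i).trans ?_
  calc _ ≤ ∫⁻ s in Set.Ioo (0 : ℝ) 1, ENNReal.ofReal (tent N i s) * K :=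
        lintegral_mono fun s => by gcongr; exact hK s
    _ = (∫⁻ s in Set.Ioo (0 : ℝ) 1, ENNReal.ofReal (tent N i s)) * K :=
        lintegral_mul_const _ (continuous_tent N i).measurable.ennreal_ofReal
    _ ≤ 1 * K := by gcongr; exact lintegral_tent_le_one hN i _
    _ = K := one_mul K

/-- Summing the Jensen bounds, the tents add up to exactly `N` on `(0, 1)`, so discretisation never
increases the energy. -/
lemma sum_legE_discreteLaplacian_le {L : ℝ → ℝ} (hL : ∀ s, 0 ≤ L s)
    (hg : IntegrableOn g (Set.Ioo 0 1)) {N : ℕ} (hN : 0 < N) :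
    ∑ i ∈ Finset.range (N + 1),
      legE L (discreteLaplacian (gridField (secondPrimitive a α g) N) i) ≤
      N * ∫⁻ s in Set.Ioo (0 : ℝ) 1, legE L (g s) := by
  have hm : AEMeasurable (fun s => legE L (g s)) (volume.restrict (Set.Ioo (0 : ℝ) 1)) :=
    (measurable_legE L).comp_aemeasurable hg.aemeasurable
  calc _ ≤ ∑ i ∈ Finset.range (N + 1),
        ∫⁻ s in Set.Ioo (0 : ℝ) 1, ENNReal.ofReal (tent N i s) * legE L (g s) :=
        Finset.sum_le_sum fun i _ => legE_discreteLaplacian_le hL hg hN i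
    _ = ∫⁻ s in Set.Ioo (0 : ℝ) 1, ∑ i ∈ Finset.range (N + 1),
          ENNReal.ofReal (tent N i s) * legE L (g s) :=
        (lintegral_finsetSum' _ fun i _ =>
          (continuous_tent N i).measurable.ennreal_ofReal.aemeasurable.mul hm).symm
    _ = ∫⁻ s in Set.Ioo (0 : ℝ) 1, N * legE L (g s) := by
        refine setLIntegral_congr_fun measurableSet_Ioo fun s hs => ?_
        rw [← Finset.sum_mul, ← ENNReal.ofReal_sum_of_nonneg fun i _ => tent_nonneg hN i s,
          sum_tent hN hs, ENNReal.ofReal_natCast]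
    _ = N * ∫⁻ s in Set.Ioo (0 : ℝ) 1, legE L (g s) :=
        lintegral_const_mul' _ _ (ENNReal.natCast_ne_top N)

lemma abs_secondPrimitive_sub_le (hg : IntegrableOn g (Set.Ioo 0 1)) (t r : ℝ) :
    |secondPrimitive a α g t - secondPrimitive a α g r| ≤
      (|α| + ∫ s in Set.Ioo (0 : ℝ) 1, |g s|) * |t - r| := by
  have e : secondPrimitive a α g t - secondPrimitive a α g r = α * (t - r) +
      ∫ s in Set.Ioo (0 : ℝ) 1, (max (t - s) 0 - max (r - s) 0) * g s := by
    simp only [secondPrimitive, sub_mul]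
    rw [integral_sub (integrableOn_max_mul hg t) (integrableOn_max_mul hg r)]
    ring
  have h : |∫ s in Set.Ioo (0 : ℝ) 1, (max (t - s) 0 - max (r - s) 0) * g s| ≤
      ∫ s in Set.Ioo (0 : ℝ) 1, |g s| * |t - r| := by
    rw [← Real.norm_eq_abs]
    refine norm_integral_le_of_norm_le (Integrable.mul_const hg.abs _) (Eventually.of_forall fun s => ?_)
    have hmax : |max (t - s) 0 - max (r - s) 0| ≤ |t - r| := by
      have := abs_max_sub_max_le_abs (t - s) (r - s) 0
      rwa [sub_sub_sub_cancel_right] at this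
    rw [Real.norm_eq_abs, abs_mul, mul_comm]
    exact mul_le_mul_of_nonneg_left hmax (abs_nonneg _)
  rw [integral_mul_const] at h
  rw [e, add_mul, ← abs_mul]
  exact (abs_add_le _ _).trans (add_le_add_right h _)

/-- Linear interpolation on a grid of mesh `1 / N` differs from a Lipschitz function by at most its
Lipschitz constant over `N`. -/
lemma abs_profile_gridField_sub_le (hg : IntegrableOn g (Set.Ioo 0 1)) {N : ℕ} (hN : 0 < N) (t : I) :
    |profile N (gridField (secondPrimitive a α g) N) t - secondPrimitive a α g t| ≤
      (|α| + ∫ s in Set.Ioo (0 : ℝ) 1, |g s|) / N := by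
  have hN' : (0 : ℝ) < N := by exact_mod_cast hN
  have h0 : 0 ≤ (N : ℝ) * t := mul_nonneg (Nat.cast_nonneg N) t.2.1
  set C := |α| + ∫ s in Set.Ioo (0 : ℝ) 1, |g s| with hC
  have hCn : 0 ≤ C := add_nonneg (abs_nonneg _) (integral_nonneg fun s => abs_nonneg _)
  set H := secondPrimitive a α g with hH
  rw [profile_apply_floor]
  set k : ℕ := ⌊(N : ℝ) * t⌋₊ with hkdef
  set l : ℝ := (N : ℝ) * t - k with hl
  have hl0 : 0 ≤ l := sub_nonneg.2 (Nat.floor_le h0)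
  have hl1 : l ≤ 1 := by
    have := Nat.lt_floor_add_one ((N : ℝ) * t)
    rw [← hkdef] at this
    linarith
  have e : ((1 - l) * gridField H N k + l * gridField H N (k + 1)) / (N : ℝ) ^ 2 - H t =
      (1 - l) * (H (k / N) - H t) + l * (H ((k + 1) / N) - H t) := by
    simp only [gridField]
    push_cast
    field_simp
    ring
  have ht : (t : ℝ) = (k + l) / N := by rw [hl]; field_simp; ring
  have b1 := abs_secondPrimitive_sub_le (a := a) (α := α) hg (k / N) t
  have b2 := abs_secondPrimitive_sub_le (a := a) (α := α) hg ((k + 1) / N) t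
  have c1 : |(k : ℝ) / N - t| ≤ 1 / N := by
    rw [ht, ← sub_div, abs_div, abs_of_pos hN']
    gcongr
    rw [abs_le]; constructor <;> linarith
  have c2 : |((k : ℝ) + 1) / N - t| ≤ 1 / N := by
    rw [ht, ← sub_div, abs_div, abs_of_pos hN']
    gcongr
    rw [abs_le]; constructor <;> linarith
  rw [e]
  refine (abs_add_le _ _).trans ?_
  rw [abs_mul, abs_mul, abs_of_nonneg hl0, abs_of_nonneg (sub_nonneg.2 hl1)]
  have d1 : |H (k / N) - H t| ≤ C / N := (b1.trans (mul_le_mul_of_nonneg_left c1 hCn)).trans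
    (le_of_eq (by ring))
  have d2 : |H ((k + 1) / N) - H t| ≤ C / N := (b2.trans (mul_le_mul_of_nonneg_left c2 hCn)).trans
    (le_of_eq (by ring))
  nlinarith

lemma abs_secondPrimitive_sub_le_integral {g' : ℝ → ℝ} (hg : IntegrableOn g (Set.Ioo 0 1))
    (hg' : IntegrableOn g' (Set.Ioo 0 1)) {t : ℝ} (ht : t ∈ Set.Icc (0 : ℝ) 1) :
    |secondPrimitive a α g t - secondPrimitive a α g' t| ≤
      ∫ s in Set.Ioo (0 : ℝ) 1, |g s - g' s| := by
  have e : secondPrimitive a α g t - secondPrimitive a α g' t =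
      ∫ s in Set.Ioo (0 : ℝ) 1, max (t - s) 0 * (g s - g' s) := by
    simp only [secondPrimitive, mul_sub]
    rw [integral_sub (integrableOn_max_mul hg t) (integrableOn_max_mul hg' t)]
    ring
  rw [e]
  rw [← Real.norm_eq_abs]
  refine norm_integral_le_of_norm_le (hg.sub hg').abs ?_
  rw [ae_restrict_iff' measurableSet_Ioo]
  refine Eventually.of_forall fun s hs => ?_
  rw [Real.norm_eq_abs, abs_mul, abs_of_nonneg (le_max_right _ _)]
  exact mul_le_of_le_one_left (abs_nonneg _) (max_le (by linarith [hs.1, ht.2]) zero_le_one)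

lemma IsSecondPrimitive.apply_eq {h : C(I, ℝ)} (hh : IsSecondPrimitive a α g h) (t : I) :
    h t = secondPrimitive a α g t := by
  rw [← extend_coe, hh.extend_eq t.2, secondPrimitive]

end

/-! ## Second moment bounds for profiles -/

lemma profile_sub (N : ℕ) (φ χ : ℤ → ℝ) (t : I) :
    profile N φ t - profile N χ t = profile N (fun k => φ k - χ k) t := by
  simp only [profile, ContinuousMap.coe_mk]
  ring

lemma abs_profile_le {N : ℕ} (hN : 0 < N) {ζ : ℤ → ℝ} (h0 : ζ 0 = 0) (t : I) :
    |profile N ζ t| ≤ (∑ i ∈ Finset.range (N + 1), |ζ (i + 1) - ζ i|) / (N : ℝ) ^ 2 := by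
  have hN' : (0 : ℝ) < N := by exact_mod_cast hN
  have h0' : 0 ≤ (N : ℝ) * t := mul_nonneg (Nat.cast_nonneg N) t.2.1
  set B := ∑ i ∈ Finset.range (N + 1), |ζ (i + 1) - ζ i| with hB
  have hk : ∀ k : ℕ, k ≤ N + 1 → |ζ k| ≤ B := by
    intro k hk
    have : ζ k = ∑ i ∈ Finset.range k, (ζ ((i + 1 : ℕ) : ℤ) - ζ (i : ℤ)) := by
      rw [Finset.sum_range_sub (fun i : ℕ => ζ (i : ℤ))]
      simp [h0]
    rw [this]
    refine (Finset.abs_sum_le_sum_abs _ _).trans ?_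
    push_cast
    exact Finset.sum_le_sum_of_subset_of_nonneg (Finset.range_mono hk) fun _ _ _ => abs_nonneg _
  rw [profile_apply_floor]
  have hkN := floor_le_of_mem N t
  set k : ℕ := ⌊(N : ℝ) * t⌋₊ with hkdef
  set l : ℝ := (N : ℝ) * t - k with hl
  have hl0 : 0 ≤ l := sub_nonneg.2 (Nat.floor_le h0')
  have hl1 : l ≤ 1 := by
    have := Nat.lt_floor_add_one ((N : ℝ) * t)
    rw [← hkdef] at this
    linarith
  rw [abs_div, abs_of_pos (by positivity : (0 : ℝ) < (N : ℝ) ^ 2)]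
  gcongr
  refine (abs_add_le _ _).trans ?_
  rw [abs_mul, abs_mul, abs_of_nonneg hl0, abs_of_nonneg (sub_nonneg.2 hl1)]
  have b1 := hk k (by omega)
  have b2 := hk (k + 1) (by omega)
  push_cast at b2
  nlinarith

/-- If the slopes of a random field have second moments of order `N`, then its profile is small. -/
lemma measure_profile_ge_le {Ω : Type*} [MeasurableSpace Ω] {Q : Measure Ω} {N : ℕ} (hN : 0 < N)
    {ζ : Ω → ℤ → ℝ} (hm : ∀ k, Measurable fun ω => ζ ω k) (h0 : ∀ᵐ ω ∂Q, ζ ω 0 = 0) {C : ℝ}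
    (hC : ∀ i ∈ Finset.range (N + 1),
      ∫⁻ ω, ENNReal.ofReal ((ζ ω (i + 1) - ζ ω i) ^ 2) ∂Q ≤ ENNReal.ofReal (C * N))
    (hC0 : 0 ≤ C) {ε : ℝ} (hε : 0 < ε) :
    Q {ω | ∃ t : I, ε ≤ |profile N (ζ ω) t|} ≤ ENNReal.ofReal (4 * C / ε ^ 2 / N) := by
  have hN' : (0 : ℝ) < N := by exact_mod_cast hN
  have h1N : (1 : ℝ) ≤ N := by exact_mod_cast hN
  set F : Ω → ℝ := fun ω => ∑ i ∈ Finset.range (N + 1), (ζ ω (i + 1) - ζ ω i) ^ 2 with hF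
  have hFm : Measurable F := Finset.measurable_fun_sum _ fun i _ => ((hm _).sub (hm _)).pow_const 2
  -- By Cauchy–Schwarz over the `N + 1` slopes, a profile reaching height `ε` forces their sum of
  -- squares to be at least `m`; Markov's inequality then concludes.
  set m : ℝ := ε ^ 2 * (N : ℝ) ^ 4 / (N + 1) with hmdef
  have hmpos : 0 < m := by positivity
  have hsub : Q {ω | ∃ t : I, ε ≤ |profile N (ζ ω) t|} ≤
      Q {ω | ENNReal.ofReal m ≤ ENNReal.ofReal (F ω)} := by
    refine measure_mono_ae ?_
    filter_upwards [h0] with ω hω ⟨t, ht⟩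
    refine ENNReal.ofReal_le_ofReal ?_
    have h1 := ht.trans (abs_profile_le hN hω t)
    rw [le_div_iff₀ (by positivity)] at h1
    have h2 := sq_sum_le_card_mul_sum_sq (s := Finset.range (N + 1))
      (f := fun i => |ζ ω (i + 1) - ζ ω i|)
    simp only [sq_abs, Finset.card_range] at h2
    rw [hmdef, div_le_iff₀ (by positivity)]
    have h3 : (ε * (N : ℝ) ^ 2) ^ 2 ≤ (∑ i ∈ Finset.range (N + 1), |ζ ω (i + 1) - ζ ω i|) ^ 2 := by
      gcongr
    push_cast at h2
    calc ε ^ 2 * (N : ℝ) ^ 4 = (ε * (N : ℝ) ^ 2) ^ 2 := by ring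
      _ ≤ _ := h3.trans h2
      _ = _ := by rw [mul_comm]
  have hint : ∫⁻ ω, ENNReal.ofReal (F ω) ∂Q ≤ ENNReal.ofReal ((N + 1) * (C * N)) := by
    calc ∫⁻ ω, ENNReal.ofReal (F ω) ∂Q
        = ∑ i ∈ Finset.range (N + 1), ∫⁻ ω, ENNReal.ofReal ((ζ ω (i + 1) - ζ ω i) ^ 2) ∂Q := by
          have hmi : ∀ i ∈ Finset.range (N + 1),
              Measurable fun ω => ENNReal.ofReal ((ζ ω (i + 1) - ζ ω i) ^ 2) :=
            fun i _ => (((hm _).sub (hm _)).pow_const 2).ennreal_ofReal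
          rw [← lintegral_finsetSum _ hmi]
          refine lintegral_congr fun ω => ?_
          rw [hF, ENNReal.ofReal_sum_of_nonneg fun i _ => sq_nonneg _]
      _ ≤ ∑ i ∈ Finset.range (N + 1), ENNReal.ofReal (C * N) := Finset.sum_le_sum hC
      _ = _ := by
          rw [Finset.sum_const, Finset.card_range, nsmul_eq_mul,
            show ((N : ℝ) + 1) = ((N + 1 : ℕ) : ℝ) by push_cast; rfl,
            ENNReal.ofReal_mul (Nat.cast_nonneg (N + 1)), ENNReal.ofReal_natCast]
  refine hsub.trans ((meas_ge_le_lintegral_div hFm.ennreal_ofReal.aemeasurable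
    (by simpa using hmpos) ENNReal.ofReal_ne_top).trans ?_)
  refine (ENNReal.div_le_div_right hint _).trans ?_
  rw [← ENNReal.ofReal_div_of_pos hmpos]
  refine ENNReal.ofReal_le_ofReal ?_
  rw [hmdef, div_div, div_le_div_iff₀ (by positivity) (by positivity)]
  have h5 : ((N : ℝ) + 1) ^ 2 ≤ 4 * (N : ℝ) ^ 2 := by nlinarith
  calc ((N : ℝ) + 1) * (C * N) * (ε ^ 2 * N) = C * ε ^ 2 * N ^ 2 * (N + 1) ^ 2 / (N + 1) := by
        field_simp
    _ ≤ C * ε ^ 2 * N ^ 2 * (4 * N ^ 2) / (N + 1) := by gcongr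
    _ = 4 * C * (ε ^ 2 * N ^ 4 / (N + 1)) := by ring

/-! ## Cumulant generating functions -/

lemma mem_interior_integrableExpSet {μ : Measure ℝ}
    (hμ : ∀ s : ℝ, Integrable (fun x : ℝ => Real.exp (s * x)) μ) (t : ℝ) :
    t ∈ interior (ProbabilityTheory.integrableExpSet id μ) := by
  have : ProbabilityTheory.integrableExpSet id μ = Set.univ := Set.eq_univ_of_forall hμ
  rw [this, interior_univ]
  exact Set.mem_univ t

section
variable {μ : Measure ℝ}

lemma analyticAt_cgf_id (hμ : ∀ s : ℝ, Integrable (fun x : ℝ => Real.exp (s * x)) μ)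
    (t : ℝ) : AnalyticAt ℝ (ProbabilityTheory.cgf id μ) t :=
  ProbabilityTheory.analyticAt_cgf (mem_interior_integrableExpSet hμ t)

lemma differentiable_cgf_id (hμ : ∀ s : ℝ, Integrable (fun x : ℝ => Real.exp (s * x)) μ)
    : Differentiable ℝ (ProbabilityTheory.cgf id μ) :=
  fun t => (analyticAt_cgf_id hμ t).differentiableAt

/-- The second derivative is the variance of the exponentially tilted law. -/
lemma convexOn_cgf_id (hμ : ∀ s : ℝ, Integrable (fun x : ℝ => Real.exp (s * x)) μ)
    : ConvexOn ℝ Set.univ (ProbabilityTheory.cgf id μ) := by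
  refine convexOn_univ_of_deriv2_nonneg (differentiable_cgf_id hμ)
    (fun t => (analyticAt_cgf_id hμ t).deriv.differentiableAt) fun t => ?_
  rw [← iteratedDeriv_eq_iterate,
    ← ProbabilityTheory.variance_tilted_mul (mem_interior_integrableExpSet hμ t)]
  exact ProbabilityTheory.variance_nonneg _ _

/-- The variance of the tilted law is the second derivative of an analytic function, hence bounded
on compact intervals. -/
lemma exists_variance_tilted_le (hμ : ∀ s : ℝ, Integrable (fun x : ℝ => Real.exp (s * x)) μ)
    (B : ℝ) : ∃ C : ℝ, 0 ≤ C ∧ ∀ t : ℝ, |t| ≤ B →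
    ProbabilityTheory.variance id (μ.tilted fun x => t * id x) ≤ C := by
  have hc : ContinuousOn (iteratedDeriv 2 (ProbabilityTheory.cgf id μ)) (Set.Icc (-B) B) :=
    fun t _ => by
      rw [iteratedDeriv_eq_iterate]
      exact ((analyticAt_cgf_id hμ t).iterated_deriv 2).continuousAt.continuousWithinAt
  obtain ⟨C, hC⟩ := isCompact_Icc.exists_bound_of_continuousOn hc
  refine ⟨max C 0, le_max_right _ _, fun t ht => ?_⟩
  rw [ProbabilityTheory.variance_tilted_mul (mem_interior_integrableExpSet hμ t)]
  exact ((le_abs_self _).trans (hC t (abs_le.1 ht))).trans (le_max_left _ _)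

lemma integrable_id_of_exp (hμ : ∀ s : ℝ, Integrable (fun x : ℝ => Real.exp (s * x)) μ)
    : Integrable (fun x : ℝ => x) μ :=
  ProbabilityTheory.integrable_of_mem_interior_integrableExpSet (X := id)
    (mem_interior_integrableExpSet hμ 0)

variable [IsProbabilityMeasure μ]

lemma lintegral_exp_eq_exp_cgf (hμ : ∀ s : ℝ, Integrable (fun x : ℝ => Real.exp (s * x)) μ)
    (s : ℝ) : ∫⁻ x, ENNReal.ofReal (Real.exp (s * x)) ∂μ =
    ENNReal.ofReal (Real.exp (ProbabilityTheory.cgf id μ s)) := by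
  rw [ProbabilityTheory.exp_cgf (X := id) (hμ s)]
  exact (ofReal_integral_eq_lintegral_ofReal (hμ s)
    (Eventually.of_forall fun x => (Real.exp_pos _).le)).symm

/-- Integrate `exp y ≥ 1 + y` and use that the mean is zero. -/
lemma cgf_id_nonneg (hμ : ∀ s : ℝ, Integrable (fun x : ℝ => Real.exp (s * x)) μ)
    (hm : ∫ x, x ∂μ = 0) (s : ℝ) : 0 ≤ ProbabilityTheory.cgf id μ s := by
  refine Real.log_nonneg ?_
  have h1 : Integrable (fun x : ℝ => s * x + 1) μ :=
    ((integrable_id_of_exp hμ).const_mul s).add (integrable_const 1)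
  have h2 : ∫ x, (s * x + 1) ∂μ = 1 := by
    rw [integral_add ((integrable_id_of_exp hμ).const_mul s) (integrable_const 1), integral_const_mul,
      hm]
    simp
  rw [← h2]
  exact integral_mono h1 (hμ s) fun x => Real.add_one_le_exp _

lemma cgf_id_ge (hμ : ∀ s : ℝ, Integrable (fun x : ℝ => Real.exp (s * x)) μ)
    {A : Set ℝ} (hA : MeasurableSet A) (hpos : μ A ≠ 0) {r s : ℝ}
    (hs : ∀ x ∈ A, r ≤ s * x) : r + Real.log (μ.real A) ≤ ProbabilityTheory.cgf id μ s := by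
  have hp : 0 < μ.real A := ENNReal.toReal_pos hpos (measure_ne_top μ A)
  rw [← Real.log_exp r, ← Real.log_mul (Real.exp_pos r).ne' hp.ne']
  refine Real.log_le_log (by positivity) ?_
  calc Real.exp r * μ.real A = ∫ x in A, Real.exp r ∂μ := by
        rw [setIntegral_const, smul_eq_mul, mul_comm]
    _ ≤ ∫ x in A, Real.exp (s * x) ∂μ := setIntegral_mono_on (integrable_const _).integrableOn
        (hμ s).integrableOn hA fun x hx => Real.exp_le_exp.2 (hs x hx)
    _ ≤ ∫ x, Real.exp (s * x) ∂μ := setIntegral_le_integral (hμ s)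
        (Eventually.of_forall fun x => (Real.exp_pos _).le)

lemma exists_measure_Ici_ne_zero {μ : Measure ℝ} (h : μ (Set.Ioi 0) ≠ 0) : ∃ r : ℝ, 0 < r ∧ μ (Set.Ici r) ≠ 0 := by
  have hU : Set.Ioi (0 : ℝ) ⊆ ⋃ n : ℕ, Set.Ici (1 / ((n : ℝ) + 1)) := fun x hx => by
    obtain ⟨n, hn⟩ := exists_nat_one_div_lt (Set.mem_Ioi.1 hx)
    exact Set.mem_iUnion.2 ⟨n, hn.le⟩
  obtain ⟨n, hn⟩ := exists_measure_pos_of_not_measure_iUnion_null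
    (fun h0 => h (measure_mono_null hU h0))
  exact ⟨_, Nat.one_div_pos_of_nat, hn.ne'⟩

/-- A centred law without mass on the positive half-line is concentrated at `0`, which the absence
of an atom there excludes. -/
lemma measure_Ioi_ne_zero (hi : Integrable (fun x : ℝ => x) μ) (hm : ∫ x, x ∂μ = 0)
    (h0 : μ {0} = 0) : μ (Set.Ioi 0) ≠ 0 := by
  intro h
  have hle : ∀ᵐ x ∂μ, x ≤ 0 := by
    rw [ae_iff]
    convert h using 2
    ext x
    simp
  have hz : (fun x : ℝ => -x) =ᵐ[μ] 0 := by
    refine (integral_eq_zero_iff_of_nonneg_ae ?_ hi.neg).1 (by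
      rw [integral_neg', hm, neg_zero])
    filter_upwards [hle] with x hx using by simpa using hx
  have : ∀ᵐ x ∂μ, x ∈ ({0} : Set ℝ) := by
    filter_upwards [hz] with x hx using by simpa using hx
  rw [ae_iff] at this
  have h1 : μ Set.univ ≤ μ {0} + μ {a | a ∉ ({0} : Set ℝ)} := by
    refine (measure_mono fun x _ => ?_).trans (measure_union_le _ _)
    by_cases hx : x ∈ ({0} : Set ℝ)
    · exact Or.inl hx
    · exact Or.inr hx
  rw [h0, this, measure_univ] at h1
  simp at h1

/-- A centred law without atom at `0` charges half-lines strictly on either side of `0`, and each of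
them forces linear growth of the cumulant generating function in its direction. This converts a
bound on `Λ(θ)` into a bound on `θ`. -/
lemma exists_le_cgf_id (hμ : ∀ s : ℝ, Integrable (fun x : ℝ => Real.exp (s * x)) μ)
    (hm : ∫ x, x ∂μ = 0) (h0 : μ {0} = 0) :
    ∃ r : ℝ, 0 < r ∧ ∃ C : ℝ, ∀ s, r * |s| - C ≤ ProbabilityTheory.cgf id μ s := by
  have hi := integrable_id_of_exp hμ
  obtain ⟨r₁, hr₁, h₁⟩ := exists_measure_Ici_ne_zero (measure_Ioi_ne_zero hi hm h0)
  have hmn : MeasurableEmbedding fun x : ℝ => -x := (Homeomorph.neg ℝ).measurableEmbedding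
  have hprob : IsProbabilityMeasure (μ.map fun x => -x) :=
    Measure.isProbabilityMeasure_map measurable_neg.aemeasurable
  obtain ⟨r₂, hr₂, h₂⟩ := exists_measure_Ici_ne_zero (μ := μ.map fun x => -x)
    (measure_Ioi_ne_zero (hmn.integrable_map_iff.2 hi.neg)
      (by rw [hmn.integral_map, integral_neg, hm, neg_zero])
      (by
        rw [hmn.map_apply]
        convert h0 using 2
        ext x
        simp))
  rw [hmn.map_apply] at h₂
  have hs₂ : MeasurableSet ((fun x : ℝ => -x) ⁻¹' Set.Ici r₂) := measurable_neg measurableSet_Ici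
  refine ⟨min r₁ r₂, lt_min hr₁ hr₂, max (-Real.log (μ.real (Set.Ici r₁)))
    (-Real.log (μ.real ((fun x : ℝ => -x) ⁻¹' Set.Ici r₂))), fun s => ?_⟩
  rcases le_total 0 s with hs | hs
  · have := cgf_id_ge hμ (s := s) (r := r₁ * |s|) measurableSet_Ici h₁ fun x hx => by
      rw [abs_of_nonneg hs, mul_comm]
      exact mul_le_mul_of_nonneg_left hx hs
    have h3 : min r₁ r₂ * |s| ≤ r₁ * |s| := by gcongr; exact min_le_left _ _
    linarith [le_max_left (-Real.log (μ.real (Set.Ici r₁)))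
      (-Real.log (μ.real ((fun x : ℝ => -x) ⁻¹' Set.Ici r₂)))]
  · have := cgf_id_ge hμ (s := s) (r := r₂ * |s|) hs₂ h₂ fun x hx => by
      rw [abs_of_nonpos hs]
      have hx' : r₂ ≤ -x := hx
      nlinarith
    have h3 : min r₁ r₂ * |s| ≤ r₂ * |s| := by gcongr; exact min_le_right _ _
    linarith [le_max_right (-Real.log (μ.real (Set.Ici r₁)))
      (-Real.log (μ.real ((fun x : ℝ => -x) ⁻¹' Set.Ici r₂)))]

end

/-- A point strictly inside the domain of the Legendre transform of `L` is a slope of `L`. -/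
lemma exists_deriv_eq_of_legendre_le {L : ℝ → ℝ} (hd : Differentiable ℝ L) (h0 : L 0 = 0)
    {r C : ℝ} (hr : 0 < r) (hgrow : ∀ s, r * |s| - C ≤ L s) {κ x K : ℝ} (hκ : 0 < κ) (hκ1 : κ < 1)
    (hK0 : 0 ≤ K) (hK : ∀ s, s * x - L s ≤ K) :
    ∃ θ : ℝ, deriv L θ = (1 - κ) * x ∧ L θ ≤ K / κ := by
  -- The factor `1 - κ` sets aside the part `κ L s`; as `L` grows at least linearly, the concave
  -- functional becomes coercive and attains its maximum.
  have hle : ∀ s, s * ((1 - κ) * x) - L s ≤ K - κ * L s := fun s => by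
    have := mul_le_mul_of_nonneg_left (hK s) (sub_nonneg.2 hκ1.le)
    nlinarith
  have htend : Tendsto (fun s => s * ((1 - κ) * x) - L s) (cocompact ℝ) atBot := by
    have h1 : Tendsto (fun s : ℝ => K + κ * C - κ * r * |s|) (cocompact ℝ) atBot := by
      refine tendsto_atBot_add_const_left _ _ (tendsto_neg_atTop_atBot.comp ?_)
      exact tendsto_norm_cocompact_atTop.const_mul_atTop (by positivity)
    refine tendsto_atBot_mono (fun s => (hle s).trans ?_) h1
    nlinarith [mul_le_mul_of_nonneg_left (hgrow s) hκ.le]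
  have hdF : Differentiable ℝ fun s => s * ((1 - κ) * x) - L s := by fun_prop
  obtain ⟨θ, hθ⟩ := hdF.continuous.exists_forall_ge htend
  refine ⟨θ, ?_, ?_⟩
  · have hmax : IsLocalMax (fun s => s * ((1 - κ) * x) - L s) θ := Eventually.of_forall hθ
    have hder : HasDerivAt (fun s => s * ((1 - κ) * x) - L s) (1 * ((1 - κ) * x) - deriv L θ) θ :=
      ((hasDerivAt_id θ).mul_const _).sub (hd θ).hasDerivAt
    linarith [hmax.hasDerivAt_eq_zero hder]
  -- The maximum is at least the value at `0`, which is zero, so `κ L θ ≤ K`.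
  · have h1 := hθ 0
    simp only [zero_mul, h0, sub_zero] at h1
    rw [le_div_iff₀ hκ]
    linarith [hle θ]

/-- The summands are independent and centred, so the second moment of the sum is its variance, which
is additive. -/
lemma lintegral_sq_sum_pi {ι : Type*} [Fintype ι] (ν : ι → Measure ℝ)
    [∀ i, IsProbabilityMeasure (ν i)] (hν : ∀ i, MemLp id 2 (ν i)) (c m : ι → ℝ)
    (hm : ∀ i, ∫ x, x ∂ν i = m i) :
    ∫⁻ η, ENNReal.ofReal ((∑ i, c i * (η i - m i)) ^ 2) ∂Measure.pi ν =
      ENNReal.ofReal (∑ i, c i ^ 2 * ProbabilityTheory.variance id (ν i)) := by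
  have hmem : ∀ i, MemLp (fun x : ℝ => c i * (x - m i)) 2 (ν i) := fun i =>
    ((hν i).sub (memLp_const (m i))).const_mul (c i)
  have hmem' : ∀ i, MemLp (fun η : ι → ℝ => c i * (η i - m i)) 2 (Measure.pi ν) := fun i =>
    (hmem i).comp_measurePreserving (measurePreserving_eval _ i)
  have hsum : (∑ i, fun η : ι → ℝ => c i * (η i - m i)) = fun η => ∑ i, c i * (η i - m i) := by
    funext η
    rw [Finset.sum_apply]
  have hvar := ProbabilityTheory.variance_sum_pi hmem
  have hi : ∀ i, ∫ η, c i * (η i - m i) ∂Measure.pi ν = 0 := fun i => by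
    have hid : Integrable (fun x : ℝ => x) (ν i) := (hν i).integrable (by norm_num)
    have h1 : ∫ x, c i * (x - m i) ∂ν i = 0 := by
      rw [integral_const_mul, integral_sub hid (integrable_const _), hm]
      simp
    rw [← (measurePreserving_eval ν i).map_eq, integral_map (measurable_pi_apply i).aemeasurable
      (by fun_prop)] at h1
    exact h1
  have hint : ∫ η, ∑ i, c i * (η i - m i) ∂Measure.pi ν = 0 := by
    rw [integral_finsetSum _ fun i _ => (hmem' i).integrable (by norm_num)]
    exact Finset.sum_eq_zero fun i _ => hi i
  have hev := ProbabilityTheory.evariance_eq_lintegral_ofReal (fun η => ∑ i, c i * (η i - m i))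
    (Measure.pi ν)
  simp only [hint, sub_zero] at hev
  have hS : MemLp (fun η => ∑ i, c i * (η i - m i)) 2 (Measure.pi ν) :=
    memLp_finsetSum _ fun i _ => hmem' i
  rw [← hev, ← hS.ofReal_variance_eq, ← hsum, hvar]
  congr 1
  refine Finset.sum_congr rfl fun i _ => ?_
  rw [ProbabilityTheory.variance_const_mul]
  congr 1
  exact ProbabilityTheory.variance_sub_const (hν i).aestronglyMeasurable (m i)

/-! ## The measure with free right boundary -/

section
variable {V : ℝ → EReal}

lemma integral_incrementLaw (hV : IsPotential V) : ∫ x, x ∂incrementLaw V = 0 := by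
  rw [incrementLaw, integral_smul_measure, integral_withDensity_eq_integral_toReal_smul
    hV.continuous_exp.measurable (ae_lt_top hV.continuous_exp.measurable hV.lintegral_lt_top.ne)]
  have : ∫ x, (EReal.exp (-V x)).toReal • x = 0 := by
    rw [← hV.integral_eq_zero]
    exact integral_congr_ae (Eventually.of_forall fun x => by simp [mul_comm])
  rw [this, smul_zero]

lemma incrementLaw_singleton (V : ℝ → EReal) (x : ℝ) : incrementLaw V {x} = 0 := by
  rw [incrementLaw, Measure.smul_apply,
    withDensity_absolutelyContinuous _ _ (measure_singleton x), smul_zero]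

lemma measurable_laplacians (N : ℕ) : Measurable
    fun (φ : ℤ → ℝ) (k : Finset.Icc (1 : ℤ) (N + 1)) => discreteLaplacian φ (k - 1) :=
  measurable_pi_lambda _ fun _ => measurable_discreteLaplacian _

lemma ae_freeGibbs_zero (V : ℝ → EReal) (a α : ℝ) (N : ℕ) :
    ∀ᵐ φ ∂freeGibbs V a α N, φ 0 = a * N ^ 2 :=
  ae_gibbsMeasure_eq V N (freeBoundary a α N) _ (by simp)

lemma ae_freeGibbs_neg_one (V : ℝ → EReal) (a α : ℝ) (N : ℕ) :
    ∀ᵐ φ ∂freeGibbs V a α N, φ (-1) = a * N ^ 2 - α * N :=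
  ae_gibbsMeasure_eq V N (freeBoundary a α N) _ (by simp)

/-- By independence the exponential moment factorises into moment generating functions, so the bound
is an equality and no factor `exp (c N)` is lost. -/
lemma expBound_freeGibbs (hV : IsPotential V)
    (hμ : ∀ s : ℝ, Integrable (fun x : ℝ => Real.exp (s * x)) (incrementLaw V)) (a α : ℝ) (N : ℕ) :
    ExpBound a α (logMGF V) 0 N (freeGibbs V a α N) := by
  have hprob := isProbabilityMeasure_incrementLaw hV
  refine ⟨ae_freeGibbs_zero V a α N, ae_freeGibbs_neg_one V a α N, fun u => le_of_eq ?_⟩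
  set F : (Finset.Icc (1 : ℤ) (N + 1) → ℝ) → ℝ≥0∞ := fun η =>
    ∏ k : Finset.Icc (1 : ℤ) (N + 1), ENNReal.ofReal (Real.exp (u ((k : ℤ) - 1).toNat * η k)) with hF
  have hm : ∀ k : Finset.Icc (1 : ℤ) (N + 1), Measurable fun x : ℝ =>
      ENNReal.ofReal (Real.exp (u ((k : ℤ) - 1).toNat * x)) := fun k => by fun_prop
  have hFm : Measurable F :=
    Finset.measurable_fun_prod _ fun k _ => (hm k).comp (measurable_pi_apply k)
  have h1 : ∀ φ : ℤ → ℝ, ENNReal.ofReal (Real.exp (∑ i ∈ Finset.range (N + 1),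
      u i * discreteLaplacian φ i)) = F fun k => discreteLaplacian φ (k - 1) := fun φ => by
    rw [hF, Real.exp_sum, ENNReal.ofReal_prod_of_nonneg fun i _ => (Real.exp_pos _).le]
    exact (prod_Icc_int_eq_prod_range N fun k : ℤ =>
      ENNReal.ofReal (Real.exp (u k.toNat * discreteLaplacian φ k))).symm
  simp only [h1]
  rw [← lintegral_map hFm (measurable_laplacians N), map_freeGibbs hV, hF, lintegral_pi_prod _ hm,
    zero_mul, add_zero, Real.exp_sum, ENNReal.ofReal_prod_of_nonneg fun i _ => (Real.exp_pos _).le]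
  exact (Finset.prod_congr rfl fun k _ => lintegral_exp_eq_exp_cgf hμ _).trans
    (prod_Icc_int_eq_prod_range N fun k : ℤ => ENNReal.ofReal (Real.exp (logMGF V (u k.toNat))))

/-- The field with left boundary values `0` and discrete Laplacians `η`. -/
noncomputable def noiseField (N : ℕ) (η : Finset.Icc (1 : ℤ) (N + 1) → ℝ) (n : ℤ) : ℝ :=
  ∑ k : Finset.Icc (1 : ℤ) (N + 1), max ((n : ℝ) - ((k : ℤ) - 1 : ℤ)) 0 * η k

lemma measurable_noiseField (N : ℕ) : Measurable (noiseField N) :=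
  measurable_pi_lambda _ fun _ => Finset.measurable_fun_sum _ fun k _ =>
    (measurable_pi_apply k).const_mul _

lemma noiseField_zero (N : ℕ) (η : Finset.Icc (1 : ℤ) (N + 1) → ℝ) : noiseField N η 0 = 0 := by
  refine Finset.sum_eq_zero fun k _ => ?_
  have h := (Finset.mem_Icc.1 k.2).1
  have h' : (0 : ℝ) ≤ ((k : ℤ) - 1 : ℤ) := by exact_mod_cast sub_nonneg.2 h
  rw [max_eq_right (by push_cast at h' ⊢; linarith), zero_mul]

lemma noiseField_sub {N n : ℕ} (η : Finset.Icc (1 : ℤ) (N + 1) → ℝ) :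
    noiseField N η (n + 1) - noiseField N η n =
      ∑ k : Finset.Icc (1 : ℤ) (N + 1), (if (k : ℤ) - 1 ≤ n then 1 else 0) * η k := by
  rw [noiseField, noiseField, ← Finset.sum_sub_distrib]
  refine Finset.sum_congr rfl fun k _ => ?_
  rw [← sub_mul]
  congr 1
  split_ifs with h
  · have h' : (((k : ℤ) - 1 : ℤ) : ℝ) ≤ n := by exact_mod_cast h
    push_cast at h' ⊢
    rw [max_eq_left (by linarith), max_eq_left (by linarith)]
    ring
  · have h' : ((n + 1 : ℤ) : ℝ) ≤ (((k : ℤ) - 1 : ℤ) : ℝ) := by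
      rw [Int.cast_le]; omega
    push_cast at h' ⊢
    rw [max_eq_right (by linarith), max_eq_right (by linarith), sub_zero]

/-- The discrete Taylor formula is linear and the boundary terms agree, so only the differences of
the Laplacians survive. -/
lemma profile_sub_eq_profile_noiseField (N : ℕ) {φ χ : ℤ → ℝ} (h0 : φ 0 = χ 0)
    (h1 : φ (-1) = χ (-1)) (t : I) :
    profile N φ t - profile N χ t = profile N (noiseField N fun k =>
      discreteLaplacian φ (k - 1) - discreteLaplacian χ (k - 1)) t := by
  have hk : ∀ n : ℕ, n ≤ N + 1 → φ n - χ n = noiseField N (fun k =>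
      discreteLaplacian φ (k - 1) - discreteLaplacian χ (k - 1)) n := by
    intro n hn
    rw [eq_add_sum_discreteLaplacian φ hn, eq_add_sum_discreteLaplacian χ hn, h0, h1, noiseField,
      sum_Icc_int_eq_sum_range N fun k : ℤ => max (((n : ℤ) : ℝ) - (k : ℝ)) 0 *
        (discreteLaplacian φ k - discreteLaplacian χ k)]
    simp only [mul_sub, Finset.sum_sub_distrib, Int.cast_natCast]
    ring
  rw [profile_apply_floor, profile_apply_floor, profile_apply_floor]
  have hN := floor_le_of_mem N t
  have e1 := hk _ (show ⌊(N : ℝ) * t⌋₊ ≤ N + 1 by omega)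
  have e2 := hk _ (show ⌊(N : ℝ) * t⌋₊ + 1 ≤ N + 1 by omega)
  push_cast at e2
  rw [← e1, ← e2]
  ring

end

/-! ## The lower bound by exponential tilting -/

/-- The tilted product law has density `exp (∑ (θ η - Λ(θ)))` with respect to the original one, and
on `B` this density is at most `exp m`. -/
lemma pi_tilted_le {ι : Type*} [Fintype ι] {μ : Measure ℝ} [IsProbabilityMeasure μ]
    (hμ : ∀ s : ℝ, Integrable (fun x : ℝ => Real.exp (s * x)) μ) (θ : ι → ℝ) {B : Set (ι → ℝ)}
    (hB : MeasurableSet B) {m : ℝ}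
    (hm : ∀ η ∈ B, ∑ i, (θ i * η i - ProbabilityTheory.cgf id μ (θ i)) ≤ m) :
    Measure.pi (fun i => μ.tilted fun x => θ i * id x) B ≤
      ENNReal.ofReal (Real.exp m) * Measure.pi (fun _ : ι => μ) B := by
  have hprob : ∀ i, IsProbabilityMeasure (μ.tilted fun x => θ i * id x) := fun i =>
    isProbabilityMeasure_tilted (hμ (θ i))
  have hden : ∀ i, μ.tilted (fun x => θ i * id x) = μ.withDensity fun x =>
      ENNReal.ofReal (Real.exp (θ i * x - ProbabilityTheory.cgf id μ (θ i))) := fun i => by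
    rw [Measure.tilted]
    congr 1
    funext x
    rw [Real.exp_sub, ProbabilityTheory.exp_cgf (X := id) (hμ (θ i))]
    rfl
  simp only [hden] at hprob ⊢
  rw [pi_withDensity (fun _ : ι => μ) fun i => by fun_prop, withDensity_apply _ hB,
    ← setLIntegral_const]
  refine setLIntegral_mono measurable_const fun η hη => ?_
  rw [← ENNReal.ofReal_prod_of_nonneg fun i _ => (Real.exp_pos _).le, ← Real.exp_sum]
  exact ENNReal.ofReal_le_ofReal (Real.exp_le_exp.2 (hm η hη))

lemma measure_pi_sum_ge_le {ι : Type*} [Fintype ι] (ν : ι → Measure ℝ)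
    [∀ i, IsProbabilityMeasure (ν i)] (hν : ∀ i, MemLp id 2 (ν i)) (c m : ι → ℝ)
    (hm : ∀ i, ∫ x, x ∂ν i = m i) {D : ℝ}
    (hD : ∑ i, c i ^ 2 * ProbabilityTheory.variance id (ν i) ≤ D) {r : ℝ} (hr : 0 < r) :
    Measure.pi ν {η | r < ∑ i, c i * (η i - m i)} ≤ ENNReal.ofReal (D / r ^ 2) := by
  have hms : Measurable fun η : ι → ℝ => ENNReal.ofReal ((∑ i, c i * (η i - m i)) ^ 2) := by
    fun_prop
  calc _ ≤ Measure.pi ν {η | ENNReal.ofReal (r ^ 2) ≤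
        ENNReal.ofReal ((∑ i, c i * (η i - m i)) ^ 2)} := by
        refine measure_mono fun η hη => ENNReal.ofReal_le_ofReal ?_
        have hη' : r < ∑ i, c i * (η i - m i) := hη
        gcongr
    _ ≤ _ := meas_ge_le_lintegral_div hms.aemeasurable (by simp [hr.ne'])
        ENNReal.ofReal_ne_top
    _ ≤ _ := by
        rw [lintegral_sq_sum_pi ν hν c m hm, ← ENNReal.ofReal_div_of_pos (by positivity)]
        gcongr

/-- Each slope of the noise field is a sum of at most `N + 1` independent centred variables of
variance at most `D`, so its second moment is at most `2 D N` and `measure_profile_ge_le` applies.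
-/
lemma measure_pi_noiseField_ge_le {N : ℕ} (hN : 0 < N)
    (ν : Finset.Icc (1 : ℤ) (N + 1) → Measure ℝ) [∀ i, IsProbabilityMeasure (ν i)]
    (hν : ∀ i, MemLp id 2 (ν i)) (m : Finset.Icc (1 : ℤ) (N + 1) → ℝ) (hm : ∀ i, ∫ x, x ∂ν i = m i)
    {D : ℝ} (hD0 : 0 ≤ D) (hD : ∀ i, ProbabilityTheory.variance id (ν i) ≤ D) {ε : ℝ} (hε : 0 < ε) :
    Measure.pi ν {η | ∃ t : I, ε ≤ |profile N (noiseField N fun k => η k - m k) t|} ≤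
      ENNReal.ofReal (8 * D / ε ^ 2 / N) := by
  have h1N : (1 : ℝ) ≤ N := by exact_mod_cast hN
  have hmeas : Measurable fun η : Finset.Icc (1 : ℤ) (N + 1) → ℝ =>
      noiseField N fun k => η k - m k :=
    (measurable_noiseField N).comp (measurable_pi_lambda _ fun k =>
      (measurable_pi_apply k).sub_const _)
  have h := measure_profile_ge_le (Q := Measure.pi ν) hN
    (ζ := fun η => noiseField N fun k => η k - m k) (C := 2 * D)
    (fun k => (measurable_pi_apply k).comp hmeas)
    (Eventually.of_forall fun η => noiseField_zero N _) (fun i _ => ?_) (by positivity) hε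
  · convert h using 3
    ring
  · simp only [noiseField_sub]
    rw [lintegral_sq_sum_pi ν hν _ m hm]
    refine ENNReal.ofReal_le_ofReal ?_
    calc _ ≤ ∑ k : Finset.Icc (1 : ℤ) (N + 1), D := Finset.sum_le_sum fun k _ => by
          split_ifs
          · simpa using hD k
          · simpa using hD0
      _ = (N + 1) * D := by simp
      _ ≤ 2 * D * N := by nlinarith

lemma measurableSet_profile_lt {Ω : Type*} [MeasurableSpace Ω] (N : ℕ) {ζ : Ω → ℤ → ℝ}
    (hζ : Measurable ζ) {ε : ℝ} (hε : 0 < ε) :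
    MeasurableSet {ω | ∀ t : I, |profile N (ζ ω) t| < ε} := by
  have : {ω | ∀ t : I, |profile N (ζ ω) t| < ε} = ζ ⁻¹' (profile N ⁻¹' Metric.ball 0 ε) := by
    ext ω
    rw [Set.mem_preimage, Set.mem_preimage, mem_ball_zero_iff, ContinuousMap.norm_lt_iff _ hε]
    rfl
  rw [this]
  exact hζ (measurable_profile_preimage N Metric.isOpen_ball)

/-- If every `x k` is the slope of `Λ` at some point `θ k` of a bounded set, then a neighbourhood
of the profile with discrete Laplacians `x` has probability at least of order
`exp (-∑ (θ k x k - Λ (θ k)))`. -/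
lemma eventually_le_pi_of_deriv_eq {μ : Measure ℝ} [IsProbabilityMeasure μ]
    (hμ : ∀ s : ℝ, Integrable (fun x : ℝ => Real.exp (s * x)) μ) (Θ : ℝ) {ε κ : ℝ} (hε : 0 < ε)
    (hκ : 0 < κ) : ∀ᶠ N : ℕ in atTop, ∀ θ x : Finset.Icc (1 : ℤ) (N + 1) → ℝ, (∀ k, |θ k| ≤ Θ) →
      (∀ k, deriv (ProbabilityTheory.cgf id μ) (θ k) = x k) →
      ENNReal.ofReal (Real.exp (-(∑ k, (θ k * x k - ProbabilityTheory.cgf id μ (θ k)) + κ * N))) ≤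
        2 * Measure.pi (fun _ => μ)
          {η | ∀ t : I, |profile N (noiseField N fun k => η k - x k) t| < ε} := by
  obtain ⟨D, hD0, hD⟩ := exists_variance_tilted_le hμ Θ
  have hlim : Tendsto (fun N : ℕ => ENNReal.ofReal (8 * D / ε ^ 2 / N) +
      ENNReal.ofReal (2 * Θ ^ 2 * D / κ ^ 2 / N)) atTop (𝓝 0) := by
    have h : ∀ c : ℝ, Tendsto (fun N : ℕ => ENNReal.ofReal (c / N)) atTop (𝓝 0) := fun c => by
      rw [← ENNReal.ofReal_zero]
      exact ENNReal.tendsto_ofReal (tendsto_const_div_atTop_nhds_zero_nat c)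
    simpa using (h _).add (h _)
  filter_upwards [hlim.eventually (gt_mem_nhds (show (0 : ℝ≥0∞) < 2⁻¹ by simp)),
    eventually_gt_atTop 0] with N hsmall hN θ x hθ hx
  have h1N : (1 : ℝ) ≤ N := by exact_mod_cast hN
  set ν : Finset.Icc (1 : ℤ) (N + 1) → Measure ℝ := fun k => μ.tilted fun y => θ k * id y with hν
  have hprob : ∀ k, IsProbabilityMeasure (ν k) := fun k => isProbabilityMeasure_tilted (hμ (θ k))
  have hmem : ∀ k, MemLp id 2 (ν k) := fun k =>
    ProbabilityTheory.memLp_tilted_mul (mem_interior_integrableExpSet hμ (θ k)) 2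
  have hmean : ∀ k, ∫ y, y ∂ν k = x k := fun k => by
    rw [← hx k]
    exact ProbabilityTheory.integral_tilted_mul_self (mem_interior_integrableExpSet hμ (θ k))
  have hvar : ∀ k, ProbabilityTheory.variance id (ν k) ≤ D := fun k => hD _ (hθ k)
  -- On `A` the profile is close to its target; on `B` the logarithm of the tilted density exceeds
  -- its mean by at most `κ N`. By Chebyshev both have tilted probability tending to one, uniformly
  -- in `θ` and `x`.
  set A : Set (Finset.Icc (1 : ℤ) (N + 1) → ℝ) :=
    {η | ∀ t : I, |profile N (noiseField N fun k => η k - x k) t| < ε} with hA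
  set B : Set (Finset.Icc (1 : ℤ) (N + 1) → ℝ) := {η | ∑ k, θ k * (η k - x k) ≤ κ * N} with hB
  have hAm : MeasurableSet A := measurableSet_profile_lt N
    ((measurable_noiseField N).comp (measurable_pi_lambda _ fun k =>
      (measurable_pi_apply k).sub_const _)) hε
  have hBm : MeasurableSet B := measurableSet_le (by fun_prop) measurable_const
  have hQA : Measure.pi ν Aᶜ ≤ ENNReal.ofReal (8 * D / ε ^ 2 / N) := by
    refine le_trans (le_of_eq ?_) (measure_pi_noiseField_ge_le hN ν hmem x hmean hD0 hvar hε)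
    congr 1
    ext η
    exact not_forall.trans (exists_congr fun t => not_lt)
  have hQB : Measure.pi ν Bᶜ ≤ ENNReal.ofReal (2 * Θ ^ 2 * D / κ ^ 2 / N) := by
    have hsum : ∑ k, θ k ^ 2 * ProbabilityTheory.variance id (ν k) ≤ 2 * Θ ^ 2 * D * N := by
      calc _ ≤ ∑ k : Finset.Icc (1 : ℤ) (N + 1), Θ ^ 2 * D := Finset.sum_le_sum fun k _ =>
            mul_le_mul (sq_le_sq' (by linarith [(abs_le.1 (hθ k)).1]) (abs_le.1 (hθ k)).2) (hvar k)
              (ProbabilityTheory.variance_nonneg _ _) (sq_nonneg _)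
        _ = (N + 1) * (Θ ^ 2 * D) := by simp
        _ ≤ _ := by nlinarith [mul_nonneg (sq_nonneg Θ) hD0]
    refine le_trans (le_of_eq ?_) ((measure_pi_sum_ge_le ν hmem θ x hmean hsum
      (r := κ * N) (by positivity)).trans (le_of_eq ?_))
    · congr 1
      ext η
      simp [hB]
    · congr 1
      field_simp
  have hAB : (2 : ℝ≥0∞)⁻¹ ≤ Measure.pi ν (A ∩ B) := by
    have hc : Measure.pi ν (A ∩ B)ᶜ ≤ 2⁻¹ := by
      rw [Set.compl_inter]
      exact (measure_union_le _ _).trans ((add_le_add hQA hQB).trans hsmall.le)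
    have h1 : 1 ≤ Measure.pi ν (A ∩ B) + Measure.pi ν (A ∩ B)ᶜ := by
      rw [measure_add_measure_compl (hAm.inter hBm), measure_univ]
    rw [← ENNReal.one_sub_inv_two]
    exact tsub_le_iff_right.2 (h1.trans (by gcongr))
  set T := ∑ k, (θ k * x k - ProbabilityTheory.cgf id μ (θ k)) + κ * N with hT
  have htilt := pi_tilted_le hμ θ (hAm.inter hBm) (m := T) fun η hη => by
    have h2 : ∑ k, θ k * (η k - x k) ≤ κ * N := hη.2
    rw [hT]
    simp only [mul_sub, Finset.sum_sub_distrib] at h2 ⊢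
    linarith
  calc ENNReal.ofReal (Real.exp (-T))
      = ENNReal.ofReal (Real.exp (-T)) * (2 * 2⁻¹) := by
        rw [ENNReal.mul_inv_cancel two_ne_zero ENNReal.ofNat_ne_top, mul_one]
    _ ≤ ENNReal.ofReal (Real.exp (-T)) * (2 * (ENNReal.ofReal (Real.exp T) *
          Measure.pi (fun _ => μ) (A ∩ B))) := by
        gcongr
        exact hAB.trans htilt
    _ = (ENNReal.ofReal (Real.exp (-T)) * ENNReal.ofReal (Real.exp T)) *
          (2 * Measure.pi (fun _ => μ) (A ∩ B)) := by ring
    _ = 2 * Measure.pi (fun _ => μ) (A ∩ B) := by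
        rw [← ENNReal.ofReal_mul (Real.exp_pos _).le, ← Real.exp_add, neg_add_cancel, Real.exp_zero,
          ENNReal.ofReal_one, one_mul]
    _ ≤ 2 * Measure.pi (fun _ => μ) A := by
        gcongr
        exact Set.inter_subset_left

/-- If `s c x` exceeds `L s ≥ 0` it is positive, and then dividing by `c ≤ 1` only increases it; so
every affine function that contributes at `c x` is at least as large at `x`. -/
lemma legE_mul_le {L : ℝ → ℝ} (hL : ∀ s, 0 ≤ L s) {c : ℝ} (h0 : 0 ≤ c) (h1 : c ≤ 1) (x : ℝ) :
    legE L (c * x) ≤ legE L x := by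
  refine iSup_le fun s => ?_
  rcases le_or_gt (s * (c * x) - L s) 0 with h | h
  · rw [ENNReal.ofReal_of_nonpos h]; exact zero_le
  · refine le_trans (ENNReal.ofReal_le_ofReal ?_) (ofReal_le_legE L s x)
    have : s * (c * x) ≤ s * x := by
      have h2 : 0 < s * (c * x) := by linarith [hL s]
      have h3 : 0 ≤ c * (s * x) := by linarith
      rcases h0.eq_or_lt with h4 | h4
      · rw [← h4] at h2; simp at h2
      · have h5 : 0 ≤ s * x := nonneg_of_mul_nonneg_right h3 h4
        nlinarith
    linarith

lemma legE_zero {L : ℝ → ℝ} (hL : ∀ s, 0 ≤ L s) : legE L 0 = 0 :=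
  le_antisymm (iSup_le fun s => by rw [ENNReal.ofReal_of_nonpos (by linarith [hL s])]) (zero_le)

/-- Functions with finite rate are approximated in `L¹` by functions with bounded rate, multiplied
by a number less than `1`. -/
lemma exists_truncation {L : ℝ → ℝ} (hL : ∀ s, 0 ≤ L s) {g : ℝ → ℝ}
    (hg : IntegrableOn g (Set.Ioo 0 1)) (hgm : Measurable g)
    (hfin : ∫⁻ t in Set.Ioo (0 : ℝ) 1, legE L (g t) ≠ ∞) {ε : ℝ} (hε : 0 < ε) :
    ∃ (f : ℝ → ℝ) (κ K : ℝ), IntegrableOn f (Set.Ioo 0 1) ∧ 0 < κ ∧ κ < 1 ∧ 0 ≤ K ∧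
      (∀ t, legE L (f t) ≤ ENNReal.ofReal K) ∧ (∀ t, legE L (f t) ≤ legE L (g t)) ∧
      ∫ t in Set.Ioo (0 : ℝ) 1, |g t - (1 - κ) * f t| < ε := by
  -- Truncate `g` to zero off the set where its cost is at most `n`, with `κ n → 0` at the same
  -- time. Almost every point eventually lies in `A n`, and `2 |g|` dominates.
  set A : ℕ → Set ℝ := fun n => {t | legE L (g t) ≤ n} with hA
  have hAm : ∀ n, MeasurableSet (A n) := fun n =>
    measurableSet_le ((measurable_legE L).comp hgm) measurable_const
  set f : ℕ → ℝ → ℝ := fun n => (A n).indicator g with hf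
  set κ : ℕ → ℝ := fun n => 1 / ((n : ℝ) + 2) with hκ
  have hκ0 : ∀ n, 0 < κ n := fun n => by positivity
  have hκ1 : ∀ n, κ n < 1 := fun n => by
    rw [hκ]
    simp only
    rw [div_lt_one (by positivity)]
    linarith [(Nat.cast_nonneg n : (0 : ℝ) ≤ n)]
  have hκlim : Tendsto κ atTop (𝓝 0) := by
    have := (tendsto_one_div_add_atTop_nhds_zero_nat (𝕜 := ℝ)).comp (tendsto_add_atTop_nat 1)
    refine this.congr fun n => ?_
    simp only [Function.comp_apply, hκ]
    push_cast
    congr 1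
    ring
  have hfi : ∀ n, IntegrableOn (f n) (Set.Ioo 0 1) := fun n => hg.indicator (hAm n)
  have hfle : ∀ n t, |f n t| ≤ |g t| := fun n t => by
    simp only [hf]
    by_cases ht : t ∈ A n
    · rw [Set.indicator_of_mem ht]
    · rw [Set.indicator_of_notMem ht, abs_zero]; exact abs_nonneg _
  have hlim : Tendsto (fun n => ∫ t in Set.Ioo (0 : ℝ) 1, |g t - (1 - κ n) * f n t|) atTop
      (𝓝 (∫ t in Set.Ioo (0 : ℝ) 1, (0 : ℝ))) := by
    refine tendsto_integral_of_dominated_convergence (fun t => 2 * |g t|)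
      (fun n => ((hg.sub ((hfi n).const_mul _)).abs).aestronglyMeasurable)
      (Integrable.const_mul hg.abs 2) (fun n => Eventually.of_forall fun t => ?_) ?_
    · rw [Real.norm_eq_abs, abs_abs]
      refine (abs_sub _ _).trans ?_
      rw [abs_mul, abs_of_pos (by linarith [hκ1 n] : 0 < 1 - κ n)]
      nlinarith [hfle n t, hκ0 n, hκ1 n, abs_nonneg (f n t)]
    · have hae : ∀ᵐ t ∂volume.restrict (Set.Ioo (0 : ℝ) 1), legE L (g t) < ∞ :=
        ae_lt_top' ((measurable_legE L).comp hgm).aemeasurable hfin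
      filter_upwards [hae] with t ht
      have hev : ∀ᶠ n : ℕ in atTop, f n t = g t := by
        obtain ⟨n₀, hn₀⟩ := ENNReal.exists_nat_gt ht.ne
        filter_upwards [eventually_ge_atTop n₀] with n hn
        have ht' : t ∈ A n := hn₀.le.trans (by exact_mod_cast hn)
        exact Set.indicator_of_mem ht' g
      have h1 : Tendsto (fun n => |g t - (1 - κ n) * g t|) atTop (𝓝 0) := by
        have : Tendsto (fun n => |g t - (1 - κ n) * g t|) atTop (𝓝 |g t - (1 - 0) * g t|) :=
          ((tendsto_const_nhds.sub ((tendsto_const_nhds.sub hκlim).mul_const _))).abs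
        simpa using this
      refine h1.congr' ?_
      filter_upwards [hev] with n hn
      rw [hn]
  rw [integral_zero] at hlim
  obtain ⟨n, hn⟩ := (hlim.eventually (gt_mem_nhds hε)).exists
  refine ⟨f n, κ n, n, hfi n, hκ0 n, hκ1 n, Nat.cast_nonneg n, fun t => ?_, fun t => ?_, hn⟩
  · simp only [hf]
    rw [ENNReal.ofReal_natCast]
    by_cases ht : t ∈ A n
    · rw [Set.indicator_of_mem ht]; exact ht
    · rw [Set.indicator_of_notMem ht, legE_zero hL]; exact zero_le
  · simp only [hf]
    by_cases ht : t ∈ A n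
    · rw [Set.indicator_of_mem ht]
    · rw [Set.indicator_of_notMem ht, legE_zero hL]; exact zero_le

/-- Tilt each increment so that its mean becomes the corresponding Laplacian of the sampled profile.
The entropy of the tilting is at most `N M₀` by Jensen's inequality, and the tilted field stays near
`h` by the law of large numbers. -/
theorem eventually_le_freeGibbs {V : ℝ → EReal} (hV : IsPotential V)
    (hμ : ∀ s : ℝ, Integrable (fun x : ℝ => Real.exp (s * x)) (incrementLaw V)) {a α : ℝ}
    {h : C(I, ℝ)} {g : ℝ → ℝ} (hh : IsSecondPrimitive a α g h) {M₀ M : ℝ} (hM₀ : 0 ≤ M₀)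
    (hg : ∫⁻ t in Set.Ioo (0 : ℝ) 1, legE (logMGF V) (g t) ≤ ENNReal.ofReal M₀) (hM : M₀ < M)
    {U : Set C(I, ℝ)} (hU : IsOpen U) (hhU : h ∈ U) :
    ∀ᶠ N : ℕ in atTop,
      ENNReal.ofReal (Real.exp (-(M * N))) ≤ freeGibbs V a α N (profile N ⁻¹' U) := by
  have hprob := isProbabilityMeasure_incrementLaw hV
  have hmean := integral_incrementLaw hV
  have hL : ∀ s, 0 ≤ logMGF V s := cgf_id_nonneg hμ hmean
  have hL0 : logMGF V 0 = 0 := ProbabilityTheory.cgf_zero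
  obtain ⟨r, hr, C, hgrow⟩ := exists_le_cgf_id hμ hmean (incrementLaw_singleton V 0)
  obtain ⟨ε, hε, hball⟩ := Metric.isOpen_iff.1 hU h hhU
  -- a measurable representative of `g`
  obtain ⟨g₁, hg₁m, hg₁⟩ : ∃ g₁, Measurable g₁ ∧ g =ᵐ[volume.restrict (Set.Ioo (0 : ℝ) 1)] g₁ :=
    hh.1.aestronglyMeasurable.aemeasurable
  have hg₁i : IntegrableOn g₁ (Set.Ioo 0 1) := hh.1.congr hg₁
  have hg₁L : ∫⁻ t in Set.Ioo (0 : ℝ) 1, legE (logMGF V) (g₁ t) ≤ ENNReal.ofReal M₀ := by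
    refine le_trans (le_of_eq (lintegral_congr_ae ?_)) hg
    filter_upwards [hg₁] with t ht using by rw [ht]
  have hheq : ∀ t : I, h t = secondPrimitive a α g₁ t := fun t => by
    rw [hh.apply_eq, secondPrimitive, secondPrimitive]
    congr 1
    refine integral_congr_ae ?_
    filter_upwards [hg₁] with s hs using by rw [hs]
  -- The cost of `f` is bounded by `K` and the target is `(1 - κ) f`; these are the conditions under
  -- which the Laplacians of the sample are slopes of `Λ` at uniformly bounded parameters.
  obtain ⟨f, κ, K, hf, hκ, hκ1, hK, hfK, hfg, hclose⟩ := exists_truncation hL hg₁i hg₁m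
    (hg₁L.trans_lt ENNReal.ofReal_lt_top).ne (show 0 < ε / 4 by positivity)
  set f' : ℝ → ℝ := fun t => (1 - κ) * f t with hf'
  have hf'i : IntegrableOn f' (Set.Ioo 0 1) := hf.const_mul _
  have hf'L : ∀ t, legE (logMGF V) (f' t) ≤ legE (logMGF V) (g₁ t) := fun t =>
    (legE_mul_le hL (by linarith) (by linarith) _).trans (hfg t)
  set B := |α| + ∫ s in Set.Ioo (0 : ℝ) 1, |f' s| with hB
  set δ := (M - M₀) / 2 with hδ
  have hδ0 : 0 < δ := by rw [hδ]; linarith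
  have hlim1 : ∀ᶠ N : ℕ in atTop, B / N < ε / 4 :=
    (tendsto_const_div_atTop_nhds_zero_nat B).eventually (gt_mem_nhds (by positivity))
  filter_upwards [eventually_le_pi_of_deriv_eq hμ ((K / κ + C) / r) (show 0 < ε / 4 by positivity)
    (show 0 < δ / 2 by positivity), hlim1, eventually_gt_atTop 0,
    eventually_const_mul_ofReal_exp_le (show M₀ + δ / 2 < M by rw [hδ]; linarith) 2 0]
    with N hN hBN hN0 hexp
  set χ := gridField (secondPrimitive a α f') N with hχ
  -- The bound on `θ` combines `Λ(θ) ≤ K / κ` with `r |θ| - C ≤ Λ(θ)`; it does not depend on `i` or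
  -- `N`.
  have hx : ∀ i : ℕ, ∃ θ : ℝ, deriv (logMGF V) θ = discreteLaplacian χ i ∧ |θ| ≤ (K / κ + C) / r := by
    intro i
    have h1 : discreteLaplacian χ i =
        (1 - κ) * discreteLaplacian (gridField (secondPrimitive a α f) N) i := by
      rw [hχ, discreteLaplacian_gridField hf'i hN0, discreteLaplacian_gridField hf hN0,
        ← integral_const_mul]
      exact integral_congr_ae (Eventually.of_forall fun s => by simp only [hf']; ring)
    obtain ⟨θ, hθ1, hθ2⟩ := exists_deriv_eq_of_legendre_le (differentiable_cgf_id hμ) hL0 hr hgrow hκ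
      hκ1 hK (le_of_legE_le hK (legE_discreteLaplacian_le_of_le (a := a) (α := α) hL hf hfK hN0 i))
    refine ⟨θ, by rw [h1]; exact hθ1, ?_⟩
    rw [le_div_iff₀ hr]
    linarith [hgrow θ]
  choose θ hθ1 hθ2 using hx
  have hidx : ∀ k : Finset.Icc (1 : ℤ) (N + 1), (((k : ℤ) - 1).toNat : ℤ) = k - 1 := fun k =>
    Int.toNat_of_nonneg (by linarith [(Finset.mem_Icc.1 k.2).1])
  have hlow := hN (fun k => θ ((k : ℤ) - 1).toNat) (fun k => discreteLaplacian χ (k - 1))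
    (fun k => hθ2 _) (fun k => by rw [← hidx k]; exact hθ1 _)
  have hsum : ∑ k : Finset.Icc (1 : ℤ) (N + 1), (θ ((k : ℤ) - 1).toNat *
      discreteLaplacian χ (k - 1) - logMGF V (θ ((k : ℤ) - 1).toNat)) ≤ N * M₀ := by
    rw [sum_Icc_int_eq_sum_range N fun k : ℤ =>
      θ k.toNat * discreteLaplacian χ k - logMGF V (θ k.toNat)]
    rw [← ENNReal.ofReal_le_ofReal_iff (by positivity)]
    calc _ ≤ ∑ i ∈ Finset.range (N + 1), ENNReal.ofReal (θ i * discreteLaplacian χ i -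
          logMGF V (θ i)) := by
          exact Finset.le_sum_of_subadditive ENNReal.ofReal ENNReal.ofReal_zero.le
            (fun _ _ => ENNReal.ofReal_add_le) _ _
      _ ≤ ∑ i ∈ Finset.range (N + 1), legE (logMGF V) (discreteLaplacian χ i) :=
          Finset.sum_le_sum fun i _ => ofReal_le_legE _ _ _
      _ ≤ N * ∫⁻ s in Set.Ioo (0 : ℝ) 1, legE (logMGF V) (f' s) :=
          sum_legE_discreteLaplacian_le hL hf'i hN0
      _ ≤ N * ENNReal.ofReal M₀ := by
          gcongr
          exact (lintegral_mono fun t => hf'L t).trans hg₁L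
      _ = ENNReal.ofReal (N * M₀) := by
          rw [ENNReal.ofReal_mul (Nat.cast_nonneg N), ENNReal.ofReal_natCast]
  set A : Set (Finset.Icc (1 : ℤ) (N + 1) → ℝ) := {η | ∀ t : I, |profile N (noiseField N fun k =>
    η k - discreteLaplacian χ (k - 1)) t| < ε / 4} with hA
  have hAm : MeasurableSet A := measurableSet_profile_lt N
    ((measurable_noiseField N).comp (measurable_pi_lambda _ fun k =>
      (measurable_pi_apply k).sub_const _)) (by positivity)
  have hpre : Measure.pi (fun _ => incrementLaw V) A ≤ freeGibbs V a α N (profile N ⁻¹' U) := by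
    rw [← map_freeGibbs hV a α N, Measure.map_apply (measurable_laplacians N) hAm]
    refine measure_mono_ae ?_
    filter_upwards [ae_freeGibbs_zero V a α N, ae_freeGibbs_neg_one V a α N] with φ h0 h1 hφ
    have hφ' : ∀ t : I, |profile N (noiseField N fun k =>
      discreteLaplacian φ (k - 1) - discreteLaplacian χ (k - 1)) t| < ε / 4 := hφ
    refine hball ?_
    rw [Metric.mem_ball, ContinuousMap.dist_lt_iff hε]
    -- Three errors below `ε / 4` each: the noise, the sampling on the grid, and the truncation of
    -- the second derivative.
    intro t
    have e1 := hφ' t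
    rw [← profile_sub_eq_profile_noiseField N (h0.trans gridField_zero.symm)
      (h1.trans (gridField_neg_one hN0).symm)] at e1
    have e2 : |profile N χ t - secondPrimitive a α f' t| ≤ B / N :=
      abs_profile_gridField_sub_le hf'i hN0 t
    have e3 := abs_secondPrimitive_sub_le_integral (a := a) (α := α) hg₁i hf'i t.2
    have e4 : |secondPrimitive a α g₁ t - secondPrimitive a α f' t| < ε / 4 := e3.trans_lt hclose
    rw [Real.dist_eq, hheq t]
    rw [abs_lt] at e1 e4 ⊢
    rw [abs_le] at e2
    constructor <;> linarith [e1.1, e1.2, e2.1, e2.2, e4.1, e4.2]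
  have h2 : ENNReal.ofReal (2 * Real.exp (0 - M * N)) ≤
      2 * Measure.pi (fun _ => incrementLaw V) A := by
    refine hexp.trans (le_trans (ENNReal.ofReal_le_ofReal (Real.exp_le_exp.2 ?_)) hlow)
    have hsum' : ∑ k : Finset.Icc (1 : ℤ) (N + 1), (θ ((k : ℤ) - 1).toNat *
      discreteLaplacian χ (k - 1) - ProbabilityTheory.cgf id (incrementLaw V)
        (θ ((k : ℤ) - 1).toNat)) ≤ N * M₀ := hsum
    linarith
  rw [ENNReal.ofReal_mul zero_le_two, ENNReal.ofReal_ofNat, zero_sub] at h2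
  exact ((ENNReal.mul_le_mul_iff_right two_ne_zero ENNReal.ofNat_ne_top).1 h2).trans hpre

/-! ## The large deviation principle with free right boundary -/

section
variable {V : ℝ → EReal} {a α : ℝ} {h : C(I, ℝ)} {g : ℝ → ℝ}

lemma freeRate_le {p : ℝ≥0∞} (hh : IsSecondPrimitive a α g h)
    (hp : MemLp g p (volume.restrict (Set.Ioo 0 1))) :
    freeRate V p a α h ≤ ∫⁻ t in Set.Ioo (0 : ℝ) 1, legE (logMGF V) (g t) := by
  refine (iInf₂_le g ⟨hh.hasSecondWeakDeriv hp, hh.leftBoundary⟩).trans (le_of_eq ?_)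
  simp only [toENNReal_legendre]

lemma exists_isSecondPrimitive_of_freeRate_lt {p c : ℝ≥0∞} (hp : 1 ≤ p)
    (hc : freeRate V p a α h < c) : ∃ g, IsSecondPrimitive a α g h ∧
      ∫⁻ t in Set.Ioo (0 : ℝ) 1, legE (logMGF V) (g t) < c := by
  obtain ⟨g, hg⟩ := iInf_lt_iff.1 hc
  obtain ⟨⟨hgw, hgb⟩, hg⟩ := iInf_lt_iff.1 hg
  simp only [toENNReal_legendre] at hg
  exact ⟨g, isSecondPrimitive_of_hasSecondWeakDeriv hp hgw hgb, hg⟩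

/-- Test the Legendre transform with `s = x / (2 C)`, the maximiser for the quadratic majorant of
`L`. -/
lemma ofReal_sq_le_legE {L : ℝ → ℝ} {C : ℝ} (hC0 : 0 < C) (hC : ∀ s, L s ≤ C * (1 + s ^ 2)) (x : ℝ) :
    ENNReal.ofReal (x ^ 2) ≤ ENNReal.ofReal (4 * C) * (legE L x + ENNReal.ofReal C) := by
  have h1 : x ^ 2 ≤ 4 * C * ((x / (2 * C) * x - L (x / (2 * C))) + C) := by
    have := hC (x / (2 * C))
    have e : 4 * C * ((x / (2 * C) * x - C * (1 + (x / (2 * C)) ^ 2)) + C) = x ^ 2 := by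
      field_simp
      ring
    rw [← e]
    gcongr
  refine (ENNReal.ofReal_le_ofReal h1).trans ?_
  rw [ENNReal.ofReal_mul (by positivity)]
  gcongr
  exact ENNReal.ofReal_add_le.trans (by gcongr; exact ofReal_le_legE _ _ _)

lemma memLp_two_of_lintegral_sq (hg : AEStronglyMeasurable g (volume.restrict (Set.Ioo 0 1)))
    (h : ∫⁻ t in Set.Ioo (0 : ℝ) 1, ENNReal.ofReal (g t ^ 2) < ∞) :
    MemLp g 2 (volume.restrict (Set.Ioo 0 1)) := by
  rw [memLp_two_iff_integrable_sq hg]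
  refine ⟨hg.pow 2, ?_⟩
  rw [hasFiniteIntegral_iff_ofReal (Eventually.of_forall fun t => sq_nonneg _)]
  exact h

/-- Where the rate with exponent one is finite, the quadratic bound makes the second derivative
square integrable. The reverse inequality only uses that the second primitives obtained from
exponent two have an integrable `g`. -/
lemma freeRate_two_eq (hC : ∃ C : ℝ, ∀ s : ℝ, logMGF V s ≤ C * (1 + s ^ 2)) (a α : ℝ) :
    freeRate V 2 a α = freeRate V 1 a α := by
  obtain ⟨C, hC⟩ := hC
  have hC' : ∀ s : ℝ, logMGF V s ≤ max C 1 * (1 + s ^ 2) := fun s =>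
    (hC s).trans (by gcongr; exact le_max_left _ _)
  have hpos : 0 < max C 1 := lt_max_of_lt_right one_pos
  funext h
  refine le_antisymm (le_of_forall_gt fun c hc => ?_) (le_of_forall_gt fun c hc => ?_)
  · obtain ⟨g, hg, hlt⟩ := exists_isSecondPrimitive_of_freeRate_lt le_rfl hc
    refine (freeRate_le hg (memLp_two_of_lintegral_sq hg.1.aestronglyMeasurable ?_)).trans_lt hlt
    refine (lintegral_mono fun t => ofReal_sq_le_legE hpos hC' (g t)).trans_lt ?_
    rw [lintegral_const_mul' _ _ ENNReal.ofReal_ne_top]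
    refine ENNReal.mul_lt_top ENNReal.ofReal_lt_top ?_
    rw [lintegral_add_right _ measurable_const]
    exact ENNReal.add_lt_top.2 ⟨hlt.trans_le le_top, by simp⟩
  · obtain ⟨g, hg, hlt⟩ := exists_isSecondPrimitive_of_freeRate_lt one_le_two hc
    exact (freeRate_le hg (memLp_one_iff_integrable.2 hg.1)).trans_lt hlt

end

lemma ExpBound.measure_univ_le {a α : ℝ} {L : ℝ → ℝ} {c : ℝ} {N : ℕ} {P : Measure (ℤ → ℝ)}
    (hP : ExpBound a α L c N P) (hL : L 0 = 0) : P Set.univ ≤ ENNReal.ofReal (Real.exp (c * N)) := by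
  simpa [hL] using hP.exp_le fun _ => 0

theorem satisfiesLDP_freeGibbs {V : ℝ → EReal} (hV : IsPotential V)
    (hμ : ∀ s : ℝ, Integrable (fun x : ℝ => Real.exp (s * x)) (incrementLaw V)) (a α : ℝ) :
    SatisfiesLDP (freeGibbs V a α) profile (freeRate V 1 a α) := by
  have hprob := isProbabilityMeasure_incrementLaw hV
  have hexp : ∀ᶠ N in atTop, ExpBound a α (logMGF V) 0 N (freeGibbs V a α N) :=
    Eventually.of_forall fun N => expBound_freeGibbs hV hμ a α N
  have hL : ∀ s, 0 ≤ logMGF V s := cgf_id_nonneg hμ (integral_incrementLaw hV)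
  have hL0 : logMGF V 0 = 0 := ProbabilityTheory.cgf_zero
  refine SatisfiesLDP.of_local (fun h M hM => ?_) (fun M => exponentially_tight hexp M)
    (fun h M hM U hU hh => ?_)
  · rcases lt_or_ge M 0 with hM0 | hM0
    -- For negative `M` the bound on the total mass suffices.
    · refine ⟨Set.univ, isOpen_univ, Set.mem_univ h, Eventually.of_forall fun N => ?_⟩
      refine ((expBound_freeGibbs hV hμ a α N).measure_univ_le hL0).trans ?_
      refine ENNReal.ofReal_le_ofReal (Real.exp_le_exp.2 ?_)
      nlinarith [(Nat.cast_nonneg N : (0 : ℝ) ≤ N)]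
    -- The intermediate rate `M₁` leaves room for the constant `D` of the Chernoff bound.
    · obtain ⟨M₁, h1, h2⟩ := EReal.lt_iff_exists_real_btwn.1 hM
      have h1' : M < M₁ := EReal.coe_lt_coe_iff.1 h1
      have hn : ¬∃ g, IsSecondPrimitive a α g h ∧
          ∫⁻ t in Set.Ioo (0 : ℝ) 1, legE (logMGF V) (g t) ≤ ENNReal.ofReal M₁ := by
        rintro ⟨g, hg, hle⟩
        have h3 := (freeRate_le hg (memLp_one_iff_integrable.2 hg.1)).trans hle
        have h4 : ((freeRate V 1 a α h : ℝ≥0∞) : EReal) ≤ (M₁ : EReal) := by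
          rw [← max_eq_left (hM0.trans h1'.le), ← EReal.coe_ennreal_ofReal]
          exact EReal.coe_ennreal_le_coe_ennreal_iff.2 h3
        exact absurd (h2.trans_le h4) (lt_irrefl _)
      obtain ⟨U, hU, hh, D, hD⟩ := exists_open_of_not_isSecondPrimitive (convexOn_cgf_id hμ) hL0 hL
        hexp h hn
      refine ⟨U, hU, hh, ?_⟩
      filter_upwards [hD, eventually_const_mul_ofReal_exp_le h1' 1 D] with N h5 h6
      refine h5.trans (le_trans (le_of_eq ?_) h6)
      rw [sub_zero, one_mul]
  · have hM' : freeRate V 1 a α h < ENNReal.ofReal M := by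
      have h0 : (0 : EReal) < M := (EReal.coe_ennreal_nonneg _).trans_lt hM
      have h0' : 0 < M := EReal.coe_pos.1 h0
      rw [← EReal.coe_ennreal_lt_coe_ennreal_iff, EReal.coe_ennreal_ofReal, max_eq_left h0'.le]
      exact hM
    obtain ⟨g, hg, hlt⟩ := exists_isSecondPrimitive_of_freeRate_lt le_rfl hM'
    have hfin : ∫⁻ t in Set.Ioo (0 : ℝ) 1, legE (logMGF V) (g t) ≠ ∞ := (hlt.trans_le le_top).ne
    refine eventually_le_freeGibbs hV hμ hg ENNReal.toReal_nonneg
      (ENNReal.ofReal_toReal hfin).ge ?_ hU hh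
    exact (ENNReal.lt_ofReal_iff_toReal_lt hfin).1 hlt

/-! ## Gaussian measures given by a linear map -/

section
variable {ι E : Type*} [NormedAddCommGroup E] [InnerProductSpace ℝ E]

/-- The unnormalised density `exp (-‖A y‖² / 2)`. -/
noncomputable def gaussDensity (A : (ι → ℝ) →ₗ[ℝ] E) (y : ι → ℝ) : ℝ≥0∞ :=
  ENNReal.ofReal (Real.exp (-(‖A y‖ ^ 2 / 2)))

variable {A : (ι → ℝ) →ₗ[ℝ] E}

lemma gaussDensity_sub (y v : ι → ℝ) : gaussDensity A (y - v) =
    ENNReal.ofReal (Real.exp (-(‖A v‖ ^ 2 / 2))) *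
      (ENNReal.ofReal (Real.exp (inner ℝ (A v) (A y))) * gaussDensity A y) := by
  rw [gaussDensity, gaussDensity, ← ENNReal.ofReal_mul (Real.exp_pos _).le,
    ← ENNReal.ofReal_mul (Real.exp_pos _).le, ← Real.exp_add, ← Real.exp_add]
  congr 2
  rw [map_sub, norm_sub_sq_real, real_inner_comm]
  ring

lemma gaussDensity_neg (y : ι → ℝ) : gaussDensity A (-y) = gaussDensity A y := by
  rw [gaussDensity, gaussDensity, map_neg, norm_neg]

variable [Fintype ι]

/-- The centred Gaussian law with density proportional to `exp (-‖A y‖² / 2)`. -/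
noncomputable def gaussLaw (A : (ι → ℝ) →ₗ[ℝ] E) : Measure (ι → ℝ) :=
  (∫⁻ y, gaussDensity A y)⁻¹ • volume.withDensity (gaussDensity A)

variable (A)

lemma measurable_gaussDensity [FiniteDimensional ℝ E] : Measurable (gaussDensity A) := by
  have hA : Continuous A := A.continuous_of_finiteDimensional
  unfold gaussDensity
  exact (by fun_prop : Continuous fun y => Real.exp (-(‖A y‖ ^ 2 / 2))).measurable.ennreal_ofReal

lemma lintegral_gaussDensity_ne_zero [FiniteDimensional ℝ E] : ∫⁻ y, gaussDensity A y ≠ 0 := by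
  rw [Ne, lintegral_eq_zero_iff (measurable_gaussDensity A)]
  intro h
  have h2 : ∀ᵐ y : ι → ℝ, False := by
    filter_upwards [h] with y hy
    simp only [gaussDensity, Pi.zero_apply, ENNReal.ofReal_eq_zero] at hy
    exact absurd (Real.exp_pos _) (not_lt.2 hy)
  have h3 := isOpen_univ.measure_ne_zero (volume : Measure (ι → ℝ)) Set.univ_nonempty
  rw [ae_iff] at h2
  simp only [not_false_eq_true, Set.ofPred_true] at h2
  exact h3 h2

variable {A}

/-- An injective linear map on a finite-dimensional space is bounded below, so the density is
dominated by a product of one-dimensional Gaussian densities. -/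
lemma lintegral_gaussDensity_ne_top [FiniteDimensional ℝ E] (hA : Function.Injective A) :
    ∫⁻ y, gaussDensity A y ≠ ∞ := by
  obtain ⟨K, hK, hanti⟩ := A.exists_antilipschitzWith (LinearMap.ker_eq_bot.2 hA)
  have hK' : (0 : ℝ) < K := by exact_mod_cast hK
  -- The added one keeps `n` positive when the index type is empty.
  set n : ℝ := Fintype.card ι + 1 with hn
  have hnpos : 0 < n := by positivity
  set c : ℝ := 1 / (2 * K ^ 2 * n) with hc
  have hcpos : 0 < c := by positivity
  have hle : ∀ y : ι → ℝ, gaussDensity A y ≤ ∏ i, ENNReal.ofReal (Real.exp (-c * y i ^ 2)) := by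
    intro y
    rw [← ENNReal.ofReal_prod_of_nonneg fun i _ => (Real.exp_pos _).le, ← Real.exp_sum]
    refine ENNReal.ofReal_le_ofReal (Real.exp_le_exp.2 ?_)
    have h1 : ‖y‖ ≤ K * ‖A y‖ := by
      have := hanti.le_mul_dist y 0
      simpa using this
    have h2 : ∑ i, y i ^ 2 ≤ n * ‖y‖ ^ 2 := by
      calc ∑ i, y i ^ 2 ≤ ∑ _i : ι, ‖y‖ ^ 2 := Finset.sum_le_sum fun i _ => by
            rw [← sq_abs]
            gcongr
            exact norm_le_pi_norm y i
        _ = Fintype.card ι * ‖y‖ ^ 2 := by simp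
        _ ≤ _ := by gcongr; linarith
    have h3 : ‖y‖ ^ 2 ≤ K ^ 2 * ‖A y‖ ^ 2 := by
      rw [← mul_pow]
      gcongr
    rw [← Finset.mul_sum, neg_mul, neg_le_neg_iff]
    calc c * ∑ i, y i ^ 2 ≤ c * (n * (K ^ 2 * ‖A y‖ ^ 2)) := by gcongr; exact h2.trans (by gcongr)
      _ = ‖A y‖ ^ 2 / 2 := by rw [hc]; field_simp
  refine ((lintegral_mono hle).trans_lt ?_).ne
  rw [volume_pi, lintegral_pi_prod (fun _ : ι => (volume : Measure ℝ))
    (f := fun _ x => ENNReal.ofReal (Real.exp (-c * x ^ 2))) fun _ => by fun_prop]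
  exact ENNReal.prod_lt_top fun i _ => (integrable_exp_neg_mul_sq hcpos).lintegral_lt_top

lemma isProbabilityMeasure_gaussLaw [FiniteDimensional ℝ E] (hA : Function.Injective A) :
    IsProbabilityMeasure (gaussLaw A) := by
  refine ⟨?_⟩
  rw [gaussLaw, Measure.smul_apply, withDensity_apply _ MeasurableSet.univ, Measure.restrict_univ,
    smul_eq_mul]
  exact ENNReal.inv_mul_cancel (lintegral_gaussDensity_ne_zero A) (lintegral_gaussDensity_ne_top hA)

/-- Completing the square turns the tilted density into a translate of the original one, and
Lebesgue measure is translation invariant. -/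
lemma lintegral_exp_inner_gaussLaw [FiniteDimensional ℝ E] (hA : Function.Injective A) (v : ι → ℝ) :
    ∫⁻ y, ENNReal.ofReal (Real.exp (inner ℝ (A v) (A y))) ∂gaussLaw A =
      ENNReal.ofReal (Real.exp (‖A v‖ ^ 2 / 2)) := by
  have hAc : Continuous A := A.continuous_of_finiteDimensional
  have hm : Measurable fun y => ENNReal.ofReal (Real.exp (inner ℝ (A v) (A y))) :=
    (by fun_prop : Continuous fun y => Real.exp (inner ℝ (A v) (A y))).measurable.ennreal_ofReal
  rw [gaussLaw, lintegral_smul_measure,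
    lintegral_withDensity_eq_lintegral_mul _ (measurable_gaussDensity A) hm]
  have h : ∀ y, (gaussDensity A * fun y => ENNReal.ofReal (Real.exp (inner ℝ (A v) (A y)))) y =
      ENNReal.ofReal (Real.exp (‖A v‖ ^ 2 / 2)) * gaussDensity A (y - v) := fun y => by
    rw [gaussDensity_sub, ← mul_assoc, ← ENNReal.ofReal_mul (Real.exp_pos _).le, ← Real.exp_add,
      add_neg_cancel, Real.exp_zero, ENNReal.ofReal_one, one_mul, Pi.mul_apply, mul_comm]
  simp only [h]
  rw [lintegral_const_mul' _ _ ENNReal.ofReal_ne_top, lintegral_sub_right_eq_self, smul_eq_mul,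
    mul_left_comm, ENNReal.inv_mul_cancel (lintegral_gaussDensity_ne_zero A)
      (lintegral_gaussDensity_ne_top hA), mul_one]

/-- Translating a symmetric set by `v` costs at most a factor `exp (-‖A v‖² / 2)`. -/
lemma mul_gaussLaw_le [FiniteDimensional ℝ E] (v : ι → ℝ) {B : Set (ι → ℝ)} (hB : MeasurableSet B)
    (hsymm : ∀ y, -y ∈ B ↔ y ∈ B) :
    ENNReal.ofReal (Real.exp (-(‖A v‖ ^ 2 / 2))) * gaussLaw A B ≤ gaussLaw A {y | y + v ∈ B} := by
  have hm := measurable_gaussDensity A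
  have hBv : MeasurableSet {y | y + v ∈ B} := (measurable_add_const v) hB
  have e1 : ∫⁻ y in {y | y + v ∈ B}, gaussDensity A y = ∫⁻ y in B, gaussDensity A (y - v) := by
    rw [← lintegral_indicator hB, ← lintegral_indicator hBv,
      ← lintegral_add_right_eq_self (fun y => B.indicator (fun y => gaussDensity A (y - v)) y) v]
    refine lintegral_congr fun y => ?_
    by_cases hy : y + v ∈ B
    · rw [Set.indicator_of_mem hy, Set.indicator_of_mem (show y ∈ {y | y + v ∈ B} from hy),
        add_sub_cancel_right]
    · rw [Set.indicator_of_notMem hy, Set.indicator_of_notMem (show y ∉ {y | y + v ∈ B} from hy)]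
  have e2 : ∫⁻ y in B, gaussDensity A (y - v) = ∫⁻ y in B, gaussDensity A (y + v) := by
    rw [← lintegral_indicator hB, ← lintegral_indicator hB,
      ← lintegral_neg_eq_self (fun y => B.indicator (fun y => gaussDensity A (y - v)) y)]
    refine lintegral_congr fun y => ?_
    by_cases hy : y ∈ B
    · rw [Set.indicator_of_mem hy, Set.indicator_of_mem ((hsymm y).2 hy), ← gaussDensity_neg]
      congr 1
      abel
    · rw [Set.indicator_of_notMem hy, Set.indicator_of_notMem (fun h => hy ((hsymm y).1 h))]
  have hmm : Measurable fun y => gaussDensity A (y - v) := hm.comp (measurable_sub_const v)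
  -- By symmetry of `B`, translation by `v` and by `-v` give the same mass. In their sum the linear
  -- terms of the exponent combine to `2 cosh ⟨A v, A y⟩ ≥ 2`.
  have hkey : 2 * (ENNReal.ofReal (Real.exp (-(‖A v‖ ^ 2 / 2))) * ∫⁻ y in B, gaussDensity A y) ≤
      2 * ∫⁻ y in B, gaussDensity A (y - v) := by
    rw [two_mul (∫⁻ y in B, gaussDensity A (y - v))]
    nth_rewrite 2 [e2]
    rw [← lintegral_add_left hmm, ← mul_assoc, ← lintegral_const_mul _ hm]
    refine lintegral_mono fun y => ?_
    have h1 := gaussDensity_sub (A := A) y v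
    have h2 := gaussDensity_sub (A := A) y (-v)
    rw [sub_neg_eq_add, map_neg, norm_neg, inner_neg_left] at h2
    rw [h1, h2, ← mul_add, ← add_mul, ← ENNReal.ofReal_add (Real.exp_pos _).le (Real.exp_pos _).le,
      mul_comm 2, mul_assoc]
    gcongr
    rw [← ENNReal.ofReal_ofNat]
    refine ENNReal.ofReal_le_ofReal ?_
    have := Real.one_le_cosh (inner ℝ (A v) (A y))
    rw [Real.cosh_eq] at this
    linarith
  have hkey' := (ENNReal.mul_le_mul_iff_right two_ne_zero ENNReal.ofNat_ne_top).1 hkey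
  rw [gaussLaw, Measure.smul_apply, Measure.smul_apply, withDensity_apply _ hB,
    withDensity_apply _ hBv, e1, smul_eq_mul, smul_eq_mul, mul_left_comm]
  gcongr

end

/-! ## The Gaussian model with Dirichlet boundary conditions -/

/-- The sites that are not fixed by Dirichlet boundary conditions. -/
noncomputable abbrev innerSites (N : ℕ) : Finset ℤ := Finset.Icc 1 ((N : ℤ) - 1)

/-- The discrete Laplacians at the sites `0, …, N`. -/
noncomputable def laplacianVector (N : ℕ) (φ : ℤ → ℝ) : EuclideanSpace ℝ (Fin (N + 1)) :=
  WithLp.toLp 2 fun i => discreteLaplacian φ ((i : ℕ) : ℤ)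

/-- The discrete Laplacians of a field on `1, …, N - 1` with zero boundary values. -/
noncomputable def dirichletMap (N : ℕ) :
    (innerSites N → ℝ) →ₗ[ℝ] EuclideanSpace ℝ (Fin (N + 1)) :=
  (WithLp.linearEquiv 2 ℝ (Fin (N + 1) → ℝ)).symm.toLinearMap ∘ₗ
    (LinearMap.funLeft ℝ ℝ fun i : Fin (N + 1) => ((i : ℕ) : ℤ)) ∘ₗ glueLaplacian _

lemma dirichletMap_apply (N : ℕ) (x : innerSites N → ℝ) :
    dirichletMap N x = laplacianVector N (glue 0 (innerSites N) x) := rfl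

lemma laplacianVector_glue (N : ℕ) (ψ : ℤ → ℝ) (x : innerSites N → ℝ) :
    laplacianVector N (glue ψ (innerSites N) x) = dirichletMap N x + laplacianVector N (glue ψ (innerSites N) 0) := by
  ext i
  exact discreteLaplacian_glue ψ (innerSites N) x _

lemma laplacianVector_glue_add (N : ℕ) (ψ : ℤ → ℝ) (x y : innerSites N → ℝ) :
    laplacianVector N (glue ψ (innerSites N) (x + y)) = dirichletMap N y + laplacianVector N (glue ψ (innerSites N) x) := by
  rw [laplacianVector_glue, laplacianVector_glue N ψ x, map_add]
  abel

lemma inner_laplacianVector (N : ℕ) (u : ℕ → ℝ) (φ : ℤ → ℝ) :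
    inner ℝ (WithLp.toLp 2 fun i : Fin (N + 1) => u i) (laplacianVector N φ) =
      ∑ i ∈ Finset.range (N + 1), u i * discreteLaplacian φ i := by
  rw [PiLp.inner_apply, Finset.sum_range]
  exact Finset.sum_congr rfl fun i _ => by simp [laplacianVector, mul_comm]

lemma norm_sq_toLp (N : ℕ) (u : ℕ → ℝ) :
    ‖(WithLp.toLp 2 fun i : Fin (N + 1) => u i : EuclideanSpace ℝ (Fin (N + 1)))‖ ^ 2 =
      ∑ i ∈ Finset.range (N + 1), u i ^ 2 := by
  rw [EuclideanSpace.norm_sq_eq, Finset.sum_range]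
  simp

lemma norm_sq_laplacianVector (N : ℕ) (φ : ℤ → ℝ) : ‖laplacianVector N φ‖ ^ 2 =
    ∑ i ∈ Finset.range (N + 1), discreteLaplacian φ i ^ 2 :=
  norm_sq_toLp N fun i => discreteLaplacian φ i

/-- With zero values at `-1` and `0` and vanishing Laplacians, the discrete Taylor formula gives the
zero field. -/
lemma dirichletMap_injective (N : ℕ) : Function.Injective (dirichletMap N) := by
  rw [← LinearMap.ker_eq_bot, LinearMap.ker_eq_bot']
  intro x hx
  have h1 : ∀ i ∈ Finset.range (N + 1), discreteLaplacian (glue 0 (innerSites N) x) i = 0 := fun i hi =>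
    congrArg (fun v : EuclideanSpace ℝ (Fin (N + 1)) => v ⟨i, Finset.mem_range.1 hi⟩) hx
  funext k
  have hk := Finset.mem_Icc.1 k.2
  have h2 := eq_add_sum_discreteLaplacian (glue 0 (innerSites N) x) (n := (k : ℤ).toNat) (N := N) (by omega)
  rw [Finset.sum_eq_zero fun i hi => by rw [h1 i hi, mul_zero], glue_of_notMem _ _ (k := 0) (by simp),
    glue_of_notMem _ _ (k := -1) (by simp), Int.toNat_of_nonneg (by omega)] at h2
  simpa [glue] using h2

lemma gaussianPotential_ne_bot (x : ℝ) : gaussianPotential x ≠ ⊥ := EReal.coe_ne_bot _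

lemma exp_neg_gaussianPotential (x : ℝ) :
    EReal.exp (-gaussianPotential x) = ENNReal.ofReal (Real.exp (-(x ^ 2 / 2))) := by
  rw [gaussianPotential, ← EReal.coe_neg, EReal.exp_coe]

lemma exp_neg_hamiltonian_gaussian (N : ℕ) (φ : ℤ → ℝ) :
    EReal.exp (-hamiltonian gaussianPotential (-1) (N + 1) φ) =
      ENNReal.ofReal (Real.exp (-(‖laplacianVector N φ‖ ^ 2 / 2))) := by
  rw [exp_neg_hamiltonian gaussianPotential_ne_bot, norm_sq_laplacianVector]
  simp only [exp_neg_gaussianPotential]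
  rw [← ENNReal.ofReal_prod_of_nonneg fun i _ => (Real.exp_pos _).le, ← Real.exp_sum,
    Finset.sum_neg_distrib, Finset.sum_div]

/-- `x₀` minimises the Hamiltonian. -/
def IsEquilibrium (N : ℕ) (ψ : ℤ → ℝ) (x₀ : innerSites N → ℝ) : Prop :=
  ∀ y, inner ℝ (dirichletMap N y) (laplacianVector N (glue ψ (innerSites N) x₀)) = 0

/-- Stationarity says that the Laplacian vector is orthogonal to the range of `dirichletMap N`; the
solution comes from projecting the boundary contribution onto that range. -/
lemma exists_isEquilibrium (N : ℕ) (ψ : ℤ → ℝ) : ∃ x₀, IsEquilibrium N ψ x₀ := by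
  obtain ⟨_, ⟨x, rfl⟩, z, hz, h⟩ := (LinearMap.range (dirichletMap N)).exists_add_mem_mem_orthogonal
    (laplacianVector N (glue ψ (innerSites N) 0))
  refine ⟨-x, fun y => ?_⟩
  rw [laplacianVector_glue, h, map_neg, neg_add_cancel_left]
  exact (Submodule.mem_orthogonal _ _).1 hz _ ⟨y, rfl⟩

section
variable {N : ℕ} {ψ : ℤ → ℝ} {x₀ : innerSites N → ℝ}

/-- Pythagoras: the energy of a configuration is the equilibrium energy plus that of its
displacement. -/
lemma IsEquilibrium.norm_sq_add (hx₀ : IsEquilibrium N ψ x₀)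
    (y : innerSites N → ℝ) : ‖laplacianVector N (glue ψ (innerSites N) (x₀ + y))‖ ^ 2 =
      ‖dirichletMap N y‖ ^ 2 + ‖laplacianVector N (glue ψ (innerSites N) x₀)‖ ^ 2 := by
  rw [laplacianVector_glue_add, norm_add_sq_real, hx₀ y]
  ring

/-- The Gaussian Gibbs measure is a translate of a centred Gaussian measure. -/
lemma IsEquilibrium.gibbsMeasure_eq (hx₀ : IsEquilibrium N ψ x₀) :
    gibbsMeasure gaussianPotential N ψ (innerSites N) =
      (gaussLaw (dirichletMap N)).map fun y => glue ψ (innerSites N) (x₀ + y) := by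
  set T : (innerSites N → ℝ) → ℤ → ℝ := fun y => glue ψ (innerSites N) (x₀ + y) with hT
  set G : (ℤ → ℝ) → ℝ≥0∞ := fun φ => EReal.exp (-hamiltonian gaussianPotential (-1) (N + 1) φ)
    with hG
  have hTm : Measurable T := (measurable_glue ψ (innerSites N)).comp (measurable_const_add x₀)
  have hGm : Measurable G := measurable_exp_neg_hamiltonian gaussianPotential_ne_bot
    (by simp only [exp_neg_gaussianPotential]; fun_prop) N
  have href : referenceMeasure ψ (innerSites N) = volume.map T := by
    rw [referenceMeasure, show T = glue ψ (innerSites N) ∘ (x₀ + ·) from rfl,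
      ← Measure.map_map (measurable_glue ψ (innerSites N)) (measurable_const_add x₀),
      map_add_left_eq_self]
  set e : ℝ≥0∞ := ENNReal.ofReal (Real.exp (-(‖laplacianVector N (glue ψ (innerSites N) x₀)‖ ^ 2 / 2))) with he
  have he0 : e ≠ 0 := by simp [he, Real.exp_pos]
  have heT : e ≠ ∞ := ENNReal.ofReal_ne_top
  have hGT : G ∘ T = e • gaussDensity (dirichletMap N) := by
    funext y
    simp only [Function.comp_apply, hG, hT, exp_neg_hamiltonian_gaussian, hx₀.norm_sq_add, he,
      Pi.smul_apply, smul_eq_mul, gaussDensity]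
    rw [← ENNReal.ofReal_mul (Real.exp_pos _).le, ← Real.exp_add]
    congr 2
    ring
  have hm := measurable_gaussDensity (dirichletMap N)
  have hZ : partitionFunction gaussianPotential N ψ (innerSites N) =
      e * ∫⁻ y, gaussDensity (dirichletMap N) y := by
    rw [partitionFunction, href, lintegral_map hGm hTm, ← lintegral_const_mul _ hm]
    exact lintegral_congr fun y => congrFun hGT y
  rw [gibbsMeasure, hZ, href, withDensity_map_eq hTm hGm, hGT, withDensity_smul _ hm,
    Measure.map_smul, gaussLaw, Measure.map_smul, smul_smul]
  congr 1
  rw [ENNReal.mul_inv (Or.inl he0) (Or.inl heT), mul_right_comm, ENNReal.inv_mul_cancel he0 heT,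
    one_mul]

lemma measurable_glue_add (N : ℕ) (ψ : ℤ → ℝ) (x₀ : innerSites N → ℝ) :
    Measurable fun y => glue ψ (innerSites N) (x₀ + y) :=
  (measurable_glue ψ (innerSites N)).comp (measurable_const_add x₀)

/-- Split `u = A v + z` with `z` orthogonal to the range of `A`. The first part has Gaussian
exponential moment `exp (‖A v‖² / 2)`; the second is deterministic, equal to `⟨z, w⟩ ≤ ‖z‖² / 2 +
‖w‖² / 2`. So, compared with independent Gaussian Laplacians, the loss is at most the exponential of
the equilibrium energy. -/
lemma IsEquilibrium.lintegral_exp_le (hx₀ : IsEquilibrium N ψ x₀) (u : ℕ → ℝ) :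
    ∫⁻ φ, ENNReal.ofReal (Real.exp (∑ i ∈ Finset.range (N + 1), u i * discreteLaplacian φ i))
      ∂gibbsMeasure gaussianPotential N ψ (innerSites N) ≤
      ENNReal.ofReal (Real.exp (∑ i ∈ Finset.range (N + 1), u i ^ 2 / 2 +
        ‖laplacianVector N (glue ψ (innerSites N) x₀)‖ ^ 2 / 2)) := by
  set A := dirichletMap N
  set w := laplacianVector N (glue ψ (innerSites N) x₀) with hw
  set U : EuclideanSpace ℝ (Fin (N + 1)) := WithLp.toLp 2 fun i => u i with hU
  obtain ⟨_, ⟨v, rfl⟩, z, hz, h⟩ := (LinearMap.range A).exists_add_mem_mem_orthogonal U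
  have hz' : ∀ y, inner ℝ z (A y) = 0 := fun y => by
    rw [real_inner_comm]
    exact (Submodule.mem_orthogonal _ _).1 hz _ ⟨y, rfl⟩
  have hm : Measurable fun φ : ℤ → ℝ =>
      ENNReal.ofReal (Real.exp (∑ i ∈ Finset.range (N + 1), u i * discreteLaplacian φ i)) := by
    have h1 : Measurable fun φ : ℤ → ℝ =>
        ∑ i ∈ Finset.range (N + 1), u i * discreteLaplacian φ i :=
      Finset.measurable_fun_sum _ fun i _ => (measurable_discreteLaplacian i).const_mul _
    fun_prop
  rw [hx₀.gibbsMeasure_eq, lintegral_map hm (measurable_glue_add N ψ x₀)]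
  have e1 : ∀ y, ENNReal.ofReal (Real.exp (∑ i ∈ Finset.range (N + 1),
      u i * discreteLaplacian (glue ψ (innerSites N) (x₀ + y)) i)) =
      ENNReal.ofReal (Real.exp (inner ℝ z w)) *
        ENNReal.ofReal (Real.exp (inner ℝ (A v) (A y))) := fun y => by
    rw [← ENNReal.ofReal_mul (Real.exp_pos _).le, ← Real.exp_add, ← inner_laplacianVector,
      laplacianVector_glue_add, ← hU, h, inner_add_left, inner_add_right, inner_add_right, hz',
      hx₀ v]
    congr 2
    ring
  simp only [e1]
  rw [lintegral_const_mul' _ _ ENNReal.ofReal_ne_top,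
    lintegral_exp_inner_gaussLaw (dirichletMap_injective N), ← ENNReal.ofReal_mul (Real.exp_pos _).le,
    ← Real.exp_add]
  refine ENNReal.ofReal_le_ofReal (Real.exp_le_exp.2 ?_)
  have h1 : ∑ i ∈ Finset.range (N + 1), u i ^ 2 / 2 = (‖A v‖ ^ 2 + ‖z‖ ^ 2) / 2 := by
    rw [← Finset.sum_div, ← norm_sq_toLp, ← hU, h, norm_add_sq_real, real_inner_comm, hz']
    ring
  have h2 : inner ℝ z w ≤ ‖z‖ ^ 2 / 2 + ‖w‖ ^ 2 / 2 := by
    have := real_inner_le_norm z w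
    nlinarith [sq_nonneg (‖z‖ - ‖w‖)]
  rw [h1]
  linarith

end

section
variable {a α b β c : ℝ} {N : ℕ}

lemma ae_dirichletGibbs (V : ℝ → EReal) (k : ℤ) (hk : k ∉ innerSites N) :
    ∀ᵐ φ ∂dirichletGibbs V a α b β N, φ k = dirichletBoundary a α b β N k :=
  ae_gibbsMeasure_eq V N _ _ hk

lemma dirichletBoundary_neg_one : dirichletBoundary a α b β N (-1) = a * N ^ 2 - α * N := by
  simp [dirichletBoundary]

lemma dirichletBoundary_zero : dirichletBoundary a α b β N 0 = a * N ^ 2 := by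
  simp [dirichletBoundary]

lemma dirichletBoundary_right (hN : 0 < N) : dirichletBoundary a α b β N N = b * N ^ 2 := by
  simp only [dirichletBoundary]
  rw [if_neg (by omega), if_neg (by omega), if_pos trivial]

lemma dirichletBoundary_right_add_one :
    dirichletBoundary a α b β N (N + 1) = b * N ^ 2 + β * N := by
  simp only [dirichletBoundary]
  rw [if_neg (by omega), if_neg (by omega), if_neg (by omega), if_pos trivial]

lemma expBound_dirichletGibbs {x₀ : innerSites N → ℝ}
    (hx₀ : IsEquilibrium N (dirichletBoundary a α b β N) x₀)
    (hc : ‖laplacianVector N (glue (dirichletBoundary a α b β N) _ x₀)‖ ^ 2 / 2 ≤ c * N) :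
    ExpBound a α (fun s => s ^ 2 / 2) c N (dirichletGibbs gaussianPotential a α b β N) := by
  refine ⟨?_, ?_, fun u => (hx₀.lintegral_exp_le u).trans ?_⟩
  · filter_upwards [ae_dirichletGibbs gaussianPotential 0 (by simp)] with φ hφ
    rw [hφ, dirichletBoundary_zero]
  · filter_upwards [ae_dirichletGibbs gaussianPotential (-1) (by simp)] with φ hφ
    rw [hφ, dirichletBoundary_neg_one]
  · exact ENNReal.ofReal_le_ofReal (Real.exp_le_exp.2 (by linarith))

/-- Fields with the prescribed boundary values. -/
lemma glue_eq_of_boundary {ψ χ : ℤ → ℝ} (h : ∀ k ∉ innerSites N,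
    -1 ≤ k → k ≤ N + 1 → χ k = ψ k) {k : ℤ} (h1 : -1 ≤ k) (h2 : k ≤ N + 1) :
    glue ψ (innerSites N) (fun k => χ k) k = χ k := by
  by_cases hk : k ∈ innerSites N
  · simp [glue, hk]
  · rw [glue_of_notMem _ _ hk, h k hk h1 h2]

end

/-! ## Profiles with Dirichlet boundary values -/

lemma legE_sq_div_two (x : ℝ) : legE (fun s => s ^ 2 / 2) x = ENNReal.ofReal (x ^ 2 / 2) := by
  refine le_antisymm (iSup_le fun s => ENNReal.ofReal_le_ofReal ?_) ?_
  · nlinarith [sq_nonneg (s - x)]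
  · refine le_of_eq_of_le ?_ (ofReal_le_legE (fun s => s ^ 2 / 2) x x)
    congr 1
    ring

/-- The second derivative `g` leads from the boundary values `(a, α)` at `0` to the boundary values
`(b, β)` at `1`. -/
structure IsAdmissible (a α b β : ℝ) (g : ℝ → ℝ) : Prop where
  integrableOn : IntegrableOn g (Set.Ioo 0 1)
  apply_one : secondPrimitive a α g 1 = b
  slope_one : α + ∫ s in Set.Ioo (0 : ℝ) 1, g s = β

section
variable {a α b β : ℝ} {g : ℝ → ℝ} {h : C(I, ℝ)}

lemma IsSecondPrimitive.rightBoundary_iff (hh : IsSecondPrimitive a α g h) :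
    RightBoundary b β h ↔ IsAdmissible a α b β g := by
  have h1 : h 1 = secondPrimitive a α g 1 := hh.apply_eq 1
  have hd := hh.hasDerivWithinAt (t := 1) (by simp)
  rw [← setIntegral_Ioo_eq] at hd
  refine ⟨fun ⟨hb, hβ⟩ => ⟨hh.1, h1 ▸ hb, ?_⟩, fun hg => ⟨h1.trans hg.apply_one, ?_⟩⟩
  · exact (uniqueDiffOn_Icc_zero_one 1 (by simp)).eq_deriv _ hd hβ
  · rwa [hg.slope_one] at hd

lemma dirichletRate_le (hh : IsSecondPrimitive a α g h) (hg : IsAdmissible a α b β g) :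
    dirichletRate a α b β h ≤ ∫⁻ t in Set.Ioo (0 : ℝ) 1, legE (fun s => s ^ 2 / 2) (g t) := by
  have e : ∫⁻ t in Set.Ioo (0 : ℝ) 1, legE (fun s => s ^ 2 / 2) (g t) =
      (1 / 2) * ∫⁻ t in Set.Ioo (0 : ℝ) 1, ENNReal.ofReal (g t ^ 2) := by
    rw [← lintegral_const_mul' _ _ (by simp)]
    refine lintegral_congr fun t => ?_
    rw [legE_sq_div_two, div_eq_inv_mul, ENNReal.ofReal_mul (by norm_num), one_div,
      ENNReal.ofReal_inv_of_pos two_pos, ENNReal.ofReal_ofNat]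
  rw [e]
  rcases eq_or_ne (∫⁻ t in Set.Ioo (0 : ℝ) 1, ENNReal.ofReal (g t ^ 2)) ∞ with ht | ht
  · rw [ht, ENNReal.mul_top (by simp)]
    exact le_top
  · exact iInf₂_le g ⟨hh.hasSecondWeakDeriv (memLp_two_of_lintegral_sq hh.1.aestronglyMeasurable
      ht.lt_top), hh.leftBoundary, hh.rightBoundary_iff.2 hg⟩

lemma exists_isAdmissible_of_dirichletRate_lt {c : ℝ≥0∞} (hc : dirichletRate a α b β h < c) :
    ∃ g, IsSecondPrimitive a α g h ∧ IsAdmissible a α b β g ∧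
      ∫⁻ t in Set.Ioo (0 : ℝ) 1, legE (fun s => s ^ 2 / 2) (g t) < c := by
  obtain ⟨g, hg⟩ := iInf_lt_iff.1 hc
  obtain ⟨⟨hgw, hgl, hgr⟩, hg⟩ := iInf_lt_iff.1 hg
  have hh := isSecondPrimitive_of_hasSecondWeakDeriv one_le_two hgw hgl
  refine ⟨g, hh, hh.rightBoundary_iff.1 hgr, lt_of_eq_of_lt ?_ hg⟩
  rw [← lintegral_const_mul' _ _ (by simp)]
  refine lintegral_congr fun t => ?_
  rw [legE_sq_div_two, div_eq_inv_mul, ENNReal.ofReal_mul (by norm_num), one_div,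
    ENNReal.ofReal_inv_of_pos two_pos, ENNReal.ofReal_ofNat]

/-- At `N + 1` the sampled point lies beyond `1`, where `secondPrimitive` continues linearly with
slope `β`; this reproduces the microscopic boundary value exactly. -/
lemma IsAdmissible.gridField_eq (hg : IsAdmissible a α b β g) {N : ℕ} (hN : 0 < N) (k : ℤ)
    (hk : k ∉ innerSites N) (h1 : -1 ≤ k) (h2 : k ≤ N + 1) :
    gridField (secondPrimitive a α g) N k = dirichletBoundary a α b β N k := by
  have hN' : (0 : ℝ) < N := by exact_mod_cast hN
  rw [Finset.mem_Icc] at hk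
  have : k = -1 ∨ k = 0 ∨ k = N ∨ k = N + 1 := by omega
  rcases this with rfl | rfl | rfl | rfl
  · rw [gridField_neg_one hN, dirichletBoundary_neg_one]
  · rw [gridField_zero, dirichletBoundary_zero]
  · rw [dirichletBoundary_right hN, gridField, Int.cast_natCast, div_self hN'.ne', hg.apply_one]
    ring
  · have e : secondPrimitive a α g (((N : ℤ) + 1 : ℤ) / (N : ℝ)) = b + β / N := by
      rw [← hg.apply_one, ← hg.slope_one, secondPrimitive, secondPrimitive]
      have e1 : (((N : ℤ) + 1 : ℤ) : ℝ) / N = 1 + 1 / N := by push_cast; field_simp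
      have e2 : ∫ s in Set.Ioo (0 : ℝ) 1, max (1 + 1 / (N : ℝ) - s) 0 * g s =
          ∫ s in Set.Ioo (0 : ℝ) 1, (max (1 - s) 0 * g s + 1 / (N : ℝ) * g s) := by
        refine setIntegral_congr_fun measurableSet_Ioo fun s hs => ?_
        have h3 : (0 : ℝ) < 1 / N := by positivity
        rw [max_eq_left (by linarith [hs.2]), max_eq_left (by linarith [hs.2])]
        ring
      rw [e1, e2, integral_add (integrableOn_max_mul hg.integrableOn 1)
        (hg.integrableOn.const_mul _), integral_const_mul]
      ring
    rw [dirichletBoundary_right_add_one, gridField, e]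
    field_simp

lemma laplacianVector_congr {N : ℕ} {φ χ : ℤ → ℝ}
    (h : ∀ k : ℤ, -1 ≤ k → k ≤ N + 1 → φ k = χ k) : laplacianVector N φ = laplacianVector N χ := by
  ext i
  have hi := i.2
  simp only [laplacianVector, discreteLaplacian]
  rw [h _ (by omega) (by omega), h _ (by omega) (by omega), h _ (by omega) (by omega)]

/-- The sampled profile has the same boundary values as the equilibrium, so Pythagoras applies to
their difference. -/
lemma IsEquilibrium.norm_sq_gridField {N : ℕ} {x₀ : innerSites N → ℝ} (hN : 0 < N)
    (hg : IsAdmissible a α b β g) (hx₀ : IsEquilibrium N (dirichletBoundary a α b β N) x₀) :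
    ‖laplacianVector N (gridField (secondPrimitive a α g) N)‖ ^ 2 =
      ‖dirichletMap N ((fun k : innerSites N => gridField (secondPrimitive a α g) N k) - x₀)‖ ^ 2 +
        ‖laplacianVector N (glue (dirichletBoundary a α b β N) (innerSites N) x₀)‖ ^ 2 := by
  rw [← hx₀.norm_sq_add, add_sub_cancel]
  congr 2
  exact laplacianVector_congr fun k h1 h2 =>
    (glue_eq_of_boundary (fun k hk h1 h2 => hg.gridField_eq hN k hk h1 h2) h1 h2).symm

lemma norm_sq_gridField_le (hg : IntegrableOn g (Set.Ioo 0 1)) {N : ℕ} (hN : 0 < N) {v : ℝ}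
    (hv0 : 0 ≤ v)
    (hv : ∫⁻ t in Set.Ioo (0 : ℝ) 1, legE (fun s => s ^ 2 / 2) (g t) ≤ ENNReal.ofReal v) :
    ‖laplacianVector N (gridField (secondPrimitive a α g) N)‖ ^ 2 / 2 ≤ v * N := by
  have h := sum_legE_discreteLaplacian_le (a := a) (α := α) (L := fun s => s ^ 2 / 2)
    (fun s => by positivity) hg hN
  simp only [legE_sq_div_two] at h hv
  rw [← ENNReal.ofReal_sum_of_nonneg fun i _ => by positivity, ← Finset.sum_div,
    ← norm_sq_laplacianVector] at h
  have h2 := h.trans (mul_le_mul_right hv (N : ℝ≥0∞))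
  rw [← ENNReal.ofReal_natCast, ← ENNReal.ofReal_mul (Nat.cast_nonneg N),
    ENNReal.ofReal_le_ofReal_iff (by positivity), mul_comm] at h2
  exact h2

end

/-! ## The minimal energy -/

section
variable {a α b β r s : ℝ}

lemma sum_range_cast_id (N : ℕ) : ∑ i ∈ Finset.range (N + 1), (i : ℝ) = N * (N + 1) / 2 := by
  induction N with
  | zero => simp
  | succ n ih => rw [Finset.sum_range_succ, ih]; push_cast; ring

lemma sum_range_cast_sq (N : ℕ) :
    ∑ i ∈ Finset.range (N + 1), (i : ℝ) ^ 2 = N * (N + 1) * (2 * N + 1) / 6 := by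
  induction N with
  | zero => simp
  | succ n ih => rw [Finset.sum_range_succ, ih]; push_cast; ring

lemma integral_quadratic (p q w x : ℝ) :
    ∫ y in (0 : ℝ)..x, (p + q * y + w * y ^ 2) = p * x + q * x ^ 2 / 2 + w * x ^ 3 / 3 := by
  have hc : ∀ f : ℝ → ℝ, Continuous f → IntervalIntegrable f volume 0 x := fun f hf =>
    hf.intervalIntegrable _ _
  rw [intervalIntegral.integral_add (hc _ (by fun_prop)) (hc _ (by fun_prop)),
    intervalIntegral.integral_add (hc _ (by fun_prop)) (hc _ (by fun_prop)),
    intervalIntegral.integral_const_mul, intervalIntegral.integral_const_mul, integral_pow,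
    integral_id, intervalIntegral.integral_const]
  simp
  ring

lemma integrableOn_affine (r s : ℝ) : IntegrableOn (fun t => r + s * t) (Set.Ioo (0 : ℝ) 1) :=
  (by fun_prop : Continuous fun t : ℝ => r + s * t).integrableOn_Icc.mono_set Set.Ioo_subset_Icc_self

/-- The minimiser of the clamped problem is a cubic, so its second derivative is affine. The
boundary data fix `∫ g` and `∫ (1 - t) g`, an invertible linear system for the two coefficients. -/
lemma exists_isAdmissible_affine (a α b β : ℝ) :
    ∃ r s : ℝ, β - α = r + s / 2 ∧ b - a - α = r / 2 + s / 6 :=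
  ⟨6 * (b - a - α) - 2 * (β - α), 6 * (β - α) - 12 * (b - a - α), by ring, by ring⟩

lemma isAdmissible_affine (h1 : β - α = r + s / 2) (h2 : b - a - α = r / 2 + s / 6) :
    IsAdmissible a α b β fun t => r + s * t := by
  refine ⟨integrableOn_affine r s, ?_, ?_⟩
  · have e : ∫ t in Set.Ioo (0 : ℝ) 1, max (1 - t) 0 * (r + s * t) =
        ∫ t in Set.Ioo (0 : ℝ) 1, (r + (s - r) * t + -s * t ^ 2) := by
      refine setIntegral_congr_fun measurableSet_Ioo fun t ht => ?_
      rw [max_eq_left (by linarith [ht.2])]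
      ring
    rw [secondPrimitive, e, setIntegral_Ioo_eq, integral_quadratic]
    linarith
  · have e := integral_quadratic r s 0 1
    simp only [zero_mul, add_zero, zero_div] at e
    rw [setIntegral_Ioo_eq, e]
    linarith

lemma lintegral_legE_affine (r s : ℝ) :
    ∫⁻ t in Set.Ioo (0 : ℝ) 1, legE (fun s => s ^ 2 / 2) (r + s * t) =
      ENNReal.ofReal ((r ^ 2 + r * s + s ^ 2 / 3) / 2) := by
  simp only [legE_sq_div_two]
  rw [← ofReal_integral_eq_lintegral_ofReal ((by fun_prop : Continuous fun t : ℝ =>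
      (r + s * t) ^ 2 / 2).integrableOn_Icc.mono_set Set.Ioo_subset_Icc_self)
    (Eventually.of_forall fun t => by positivity)]
  congr 1
  have e : ∀ t : ℝ, (r + s * t) ^ 2 / 2 = r ^ 2 / 2 + r * s * t + s ^ 2 / 2 * t ^ 2 := fun t => by
    ring
  simp only [e]
  rw [setIntegral_Ioo_eq, integral_quadratic]
  ring

lemma exists_isSecondPrimitive_affine (a α r s : ℝ) :
    ∃ h : C(I, ℝ), IsSecondPrimitive a α (fun t => r + s * t) h := by
  refine ⟨⟨fun t => a + (α * t + (r * t ^ 2 / 2 + s * t ^ 3 / 6)), by fun_prop⟩,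
    integrableOn_affine r s, fun t ht => ?_⟩
  have e : ∀ x : ℝ, α + ∫ y in (0 : ℝ)..x, (r + s * y) = α + r * x + s / 2 * x ^ 2 := fun x => by
    have := integral_quadratic r s 0 x
    simp only [zero_mul, add_zero, zero_div] at this
    rw [this]
    ring
  simp only [e]
  have e2 : ∫ x in (0 : ℝ)..t, (α + r * x + s / 2 * x ^ 2) =
      α * t + (r * t ^ 2 / 2 + s * t ^ 3 / 6) := by
    rw [integral_quadratic]
    ring
  rw [e2]
  exact extend_coe _ ⟨t, ht⟩

/-- A lower bound for the energy, by the discrete Green formula. -/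
lemma le_norm_sq_laplacianVector (h1 : β - α = r + s / 2) (h2 : b - a - α = r / 2 + s / 6) {N : ℕ}
    (hN : 0 < N) (x : innerSites N → ℝ) :
    (r ^ 2 + r * s + s ^ 2 / 3) / 2 * N - (r ^ 2 + |r * s| + s ^ 2) ≤
      ‖laplacianVector N (glue (dirichletBoundary a α b β N) (innerSites N) x)‖ ^ 2 / 2 := by
  have hN' : (0 : ℝ) < N := by exact_mod_cast hN
  have h1N : (1 : ℝ) ≤ N := by exact_mod_cast hN
  set φ := glue (dirichletBoundary a α b β N) (innerSites N) x with hφ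
  have b1 : φ (-1) = a * N ^ 2 - α * N := by
    rw [hφ, glue_of_notMem _ _ (by simp), dirichletBoundary_neg_one]
  have b2 : φ 0 = a * N ^ 2 := by
    rw [hφ, glue_of_notMem _ _ (by simp), dirichletBoundary_zero]
  have b3 : φ N = b * N ^ 2 := by
    rw [hφ, glue_of_notMem _ _ (by simp), dirichletBoundary_right hN]
  have b4 : φ (N + 1) = b * N ^ 2 + β * N := by
    rw [hφ, glue_of_notMem _ _ (by simp), dirichletBoundary_right_add_one]
  -- The boundary values determine the zeroth and first moments of the Laplacians (`s1`, `s2`),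
  -- whatever the interior values are.
  have s1 : ∑ i ∈ Finset.range (N + 1), discreteLaplacian φ i = (β - α) * N := by
    have := slope_eq_sum φ N
    rw [b1, b2, b3, b4] at this
    linarith
  have s2 : ∑ i ∈ Finset.range (N + 1), (i : ℝ) * discreteLaplacian φ i = (β - b + a) * N ^ 2 := by
    have h3 := eq_add_sum_discreteLaplacian φ (n := N) (N := N) (by omega)
    have h4 : ∑ i ∈ Finset.range (N + 1), max ((N : ℝ) - i) 0 * discreteLaplacian φ i =
        N * ∑ i ∈ Finset.range (N + 1), discreteLaplacian φ i -
          ∑ i ∈ Finset.range (N + 1), (i : ℝ) * discreteLaplacian φ i := by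
      rw [Finset.mul_sum, ← Finset.sum_sub_distrib]
      refine Finset.sum_congr rfl fun i hi => ?_
      have : (i : ℝ) ≤ N := by exact_mod_cast Nat.lt_succ_iff.1 (Finset.mem_range.1 hi)
      rw [max_eq_left (by linarith)]
      ring
    rw [h4, s1, b1, b2, b3] at h3
    linarith
  -- The sampled second derivative of the minimiser serves as test vector. Being affine in `i`, it
  -- pairs with the Laplacians through these two moments alone; its own squared norm differs from
  -- the pairing by at most a bounded term.
  set u : ℕ → ℝ := fun i => r + s * i / N with hu
  have s3 : ∑ i ∈ Finset.range (N + 1), u i * discreteLaplacian φ i =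
      (r ^ 2 + r * s + s ^ 2 / 3) * N := by
    have e : ∀ i : ℕ, u i * discreteLaplacian φ i =
        r * discreteLaplacian φ i + s / N * (i * discreteLaplacian φ i) := fun i => by
      simp only [hu]; ring
    simp only [e, Finset.sum_add_distrib, ← Finset.mul_sum, s1, s2]
    have : β - b + a = r / 2 + s / 3 := by linarith
    rw [this, h1]
    field_simp
    ring
  have s4 : ∑ i ∈ Finset.range (N + 1), u i ^ 2 ≤
      (r ^ 2 + r * s + s ^ 2 / 3) * N + 2 * (r ^ 2 + |r * s| + s ^ 2) := by
    have e : ∀ i : ℕ, u i ^ 2 = r ^ 2 + 2 * r * s / N * i + s ^ 2 / N ^ 2 * i ^ 2 := fun i => by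
      simp only [hu]; field_simp; ring
    simp only [e, Finset.sum_add_distrib, ← Finset.mul_sum, sum_range_cast_id, sum_range_cast_sq]
    simp only [Finset.sum_const, Finset.card_range, nsmul_eq_mul]
    push_cast
    have e2 : ((N : ℝ) + 1) * r ^ 2 + 2 * r * s / N * (N * (N + 1) / 2) +
        s ^ 2 / N ^ 2 * (N * (N + 1) * (2 * N + 1) / 6) =
        (r ^ 2 + r * s + s ^ 2 / 3) * N + (r ^ 2 + r * s + s ^ 2 / 2 + s ^ 2 / 6 * (1 / N)) := by
      field_simp
      ring
    rw [e2]
    have e3 : (1 : ℝ) / N ≤ 1 := by rw [div_le_one hN']; exact h1N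
    nlinarith [le_abs_self (r * s), abs_nonneg (r * s), sq_nonneg r, sq_nonneg s,
      mul_le_mul_of_nonneg_left e3 (sq_nonneg s)]
  -- Cauchy–Schwarz in the form `⟨u, w⟩ ≤ ‖u‖² / 2 + ‖w‖² / 2` turns the known pairing into the
  -- lower bound.
  have h5 := real_inner_le_norm (WithLp.toLp 2 fun i : Fin (N + 1) => u i) (laplacianVector N φ)
  rw [inner_laplacianVector, s3] at h5
  have h6 := norm_sq_toLp N u
  nlinarith [sq_nonneg (‖(WithLp.toLp 2 fun i : Fin (N + 1) => u i :
    EuclideanSpace ℝ (Fin (N + 1)))‖ - ‖laplacianVector N φ‖)]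

end

/-! ## The slope at the right boundary -/

/-- The weights of the discrete Laplacians in the difference between the slope at the right boundary
and the mean slope on `[1 - δ, 1]`. -/
noncomputable def endWeight (N : ℕ) (δ : ℝ) (i : ℕ) : ℝ :=
  1 - (max ((N : ℝ) - i) 0 - max (N * (1 - δ) - i) 0) / (N * δ)

/-- The weight vanishes for `i ≤ N (1 - δ)` and lies in `[0, 1]` closer to the right end. Only about
`N δ` Laplacians matter, so a small `δ` makes the quadratic Chernoff cost small. -/
lemma endWeight_sq_le {N : ℕ} (hN : 0 < N) {δ : ℝ} (hδ : 0 < δ) {i : ℕ} (hi : i ≤ N) :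
    endWeight N δ i ^ 2 ≤ if (N : ℝ) - i < N * δ then 1 else 0 := by
  have hN' : (0 : ℝ) < N := by exact_mod_cast hN
  have hi' : (i : ℝ) ≤ N := by exact_mod_cast hi
  have hNδ : 0 < N * δ := by positivity
  rw [endWeight, max_eq_left (by linarith : (0 : ℝ) ≤ N - i)]
  split_ifs with h
  · rw [max_eq_right (by linarith), sub_zero]
    have h1 : ((N : ℝ) - i) / (N * δ) ≤ 1 := (div_le_one hNδ).2 h.le
    have h2 : 0 ≤ ((N : ℝ) - i) / (N * δ) := div_nonneg (by linarith) hNδ.le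
    nlinarith
  · rw [max_eq_left (by linarith), show (N : ℝ) - i - (N * (1 - δ) - i) = N * δ by ring,
      div_self hNδ.ne']
    norm_num

lemma sum_endWeight_sq_le {N : ℕ} (hN : 0 < N) {δ : ℝ} (hδ : 0 < δ) :
    ∑ i ∈ Finset.range (N + 1), endWeight N δ i ^ 2 ≤ N * δ + 1 := by
  calc _ ≤ ∑ i ∈ Finset.range (N + 1), if (N : ℝ) - i < N * δ then (1 : ℝ) else 0 :=
        Finset.sum_le_sum fun i hi =>
          endWeight_sq_le hN hδ (Nat.lt_succ_iff.1 (Finset.mem_range.1 hi))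
    _ = ((Finset.range (N + 1)).filter fun i : ℕ => (N : ℝ) - i < N * δ).card := by
        rw [Finset.sum_boole]
    _ ≤ ((Finset.range ⌈(N : ℝ) * δ⌉₊).card : ℝ) := by
        refine Nat.cast_le.2 (Finset.card_le_card_of_injOn (fun i => N - i) (fun i hi => ?_)
          fun i hi j hj hij => ?_)
        · simp only [Finset.coe_filter, Finset.mem_range, Set.mem_ofPred_eq] at hi
          simp only [Finset.coe_range, Set.mem_Iio, Nat.lt_ceil]
          rw [Nat.cast_sub (by omega)]
          exact hi.2
        · simp only [Finset.coe_filter, Finset.mem_range, Set.mem_ofPred_eq] at hi hj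
          simp only at hij
          omega
    _ ≤ N * δ + 1 := by
        rw [Finset.card_range]
        exact (Nat.ceil_lt_add_one (by positivity)).le

lemma sum_endWeight {N : ℕ} (hN : 0 < N) {δ : ℝ} (hδ : 0 < δ) (t : I) (ht : (t : ℝ) = 1 - δ)
    {β : ℝ} {φ : ℤ → ℝ} (hφ : φ (N + 1) - φ N = β * N) :
    ∑ i ∈ Finset.range (N + 1), endWeight N δ i * discreteLaplacian φ i =
      N * (β - (profile N φ 1 - profile N φ t) / δ) := by
  have hN' : (0 : ℝ) < N := by exact_mod_cast hN
  have h1 := slope_eq_sum φ N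
  rw [hφ] at h1
  have e : ∀ i : ℕ, endWeight N δ i * discreteLaplacian φ i = discreteLaplacian φ i -
      1 / (N * δ) * (max ((N : ℝ) - i) 0 * discreteLaplacian φ i -
        max (N * (1 - δ) - i) 0 * discreteLaplacian φ i) := fun i => by
    rw [endWeight]; ring
  simp only [e]
  rw [Finset.sum_sub_distrib, ← Finset.mul_sum, Finset.sum_sub_distrib, profile_eq, profile_eq, ht]
  simp only [Set.Icc.coe_one, mul_one]
  rw [show ∑ i ∈ Finset.range (N + 1), discreteLaplacian φ i = β * N - (φ 0 - φ (-1)) by linarith]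
  field_simp
  ring

/-- Profiles with the wrong slope at the right boundary. -/
lemma exists_open_of_slope_ne {a α β c : ℝ} {P : ℕ → Measure (ℤ → ℝ)}
    (hP : ∀ᶠ N : ℕ in atTop, ExpBound a α (fun s => s ^ 2 / 2) c N (P N))
    (hβ : ∀ᶠ N : ℕ in atTop, ∀ᵐ φ ∂P N, φ (N + 1) - φ N = β * N) {h : C(I, ℝ)} {v : ℝ}
    (hd : HasDerivWithinAt (extend h) v (Set.Icc 0 1) 1) (hv : v ≠ β) (M : ℝ) :
    ∃ U : Set C(I, ℝ), IsOpen U ∧ h ∈ U ∧ ∃ D : ℝ, ∀ᶠ N : ℕ in atTop,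
      P N (profile N ⁻¹' U) ≤ ENNReal.ofReal (2 * Real.exp (D - M * N)) := by
  set ρ := |v - β| / 2 with hρ
  have hρ0 : 0 < ρ := by
    have := abs_pos.2 (sub_ne_zero.2 hv)
    positivity
  -- The Chernoff parameter: a slope error `ρ` gains `l ρ N = (|M| + |c| + 1) N`, while the cost `l²
  -- (N δ + 1) / 2` is at most `N / 2 + l² / 2` once `δ < 1 / l²`.
  set l := (|M| + |c| + 1) / ρ with hl
  have hl0 : 0 < l := by positivity
  have hlρ : l * ρ = |M| + |c| + 1 := by rw [hl]; field_simp
  -- the scale on which the slope is computed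
  obtain ⟨δ, hδ0, hδ1, hδl, hδ⟩ : ∃ δ : ℝ, 0 < δ ∧ δ < 1 ∧ δ < 1 / l ^ 2 ∧
      |(extend h 1 - extend h (1 - δ)) / δ - v| < ρ := by
    have h1 := (hasDerivWithinAt_iff_tendsto_slope.1 hd).comp
      (show Tendsto (fun δ : ℝ => 1 - δ) (𝓝[>] 0) (𝓝[Set.Icc 0 1 \ {1}] 1) from ?_)
    · have h2 := h1.eventually (Metric.ball_mem_nhds v hρ0)
      have h3 : ∀ᶠ δ : ℝ in 𝓝[>] 0, δ < 1 / l ^ 2 :=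
        nhdsWithin_le_nhds (gt_mem_nhds (by positivity))
      have h4 : ∀ᶠ δ : ℝ in 𝓝[>] 0, δ < 1 := nhdsWithin_le_nhds (gt_mem_nhds one_pos)
      obtain ⟨δ, h2, h3, h4, h5⟩ := (h2.and (h3.and (h4.and self_mem_nhdsWithin))).exists
      refine ⟨δ, h5, h4, h3, ?_⟩
      simp only [Function.comp_apply, Real.dist_eq, slope_def_field] at h2
      have h5' : (0 : ℝ) < δ := h5
      convert h2 using 3
      rw [show (1 : ℝ) - δ - 1 = -δ by ring, div_neg, ← neg_div, neg_sub]
    · refine tendsto_nhdsWithin_iff.2 ⟨?_, ?_⟩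
      · have : Tendsto (fun δ : ℝ => 1 - δ) (𝓝 0) (𝓝 (1 - 0)) := tendsto_const_nhds.sub tendsto_id
        rw [sub_zero] at this
        exact this.mono_left nhdsWithin_le_nhds
      · have h4 : ∀ᶠ δ : ℝ in 𝓝[>] 0, δ < 1 := nhdsWithin_le_nhds (gt_mem_nhds one_pos)
        filter_upwards [h4, self_mem_nhdsWithin] with δ hδ1 hδ0
        have hδ0' : (0 : ℝ) < δ := hδ0
        exact ⟨⟨by linarith, by linarith⟩, by simp [hδ0'.ne']⟩
  set t : I := ⟨1 - δ, by linarith, by linarith⟩ with ht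
  set U : Set C(I, ℝ) := {f | ρ < |(f 1 - f t) / δ - β|} with hU
  have hev : ∀ x : I, Continuous fun f : C(I, ℝ) => f x := fun x =>
    continuous_eval_const (F := C(I, ℝ)) x
  have hUo : IsOpen U := isOpen_lt continuous_const
    ((((hev 1).sub (hev t)).div_const δ).sub continuous_const).abs
  refine ⟨U, hUo, ?_, l ^ 2 / 2, ?_⟩
  · have e1 : extend h 1 = h 1 := extend_coe h 1
    have e2 : extend h (1 - δ) = h t := extend_coe h t
    rw [e1, e2] at hδ
    have h3 : |v - β| ≤ |(h 1 - h t) / δ - β| + |(h 1 - h t) / δ - v| := by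
      rw [abs_sub_comm _ v, add_comm]
      exact abs_sub_le _ _ _
    have h4 : |v - β| = 2 * ρ := by rw [hρ]; ring
    change ρ < _
    linarith
  · filter_upwards [hP, hβ, eventually_gt_atTop 0] with N hPN hβN hN
    have hN' : (0 : ℝ) < N := by exact_mod_cast hN
    set w := fun i : ℕ => endWeight N δ i with hw
    -- The cases `q = 1` and `q = -1` treat the two signs of the slope error.
    have hone : ∀ q : ℝ, q ^ 2 = 1 → P N {φ | l * ρ * N ≤ ∑ i ∈ Finset.range (N + 1),
        (q * l * w i) * discreteLaplacian φ i} ≤ ENNReal.ofReal (Real.exp (l ^ 2 / 2 - M * N)) := by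
      intro q hq
      refine (hPN.measure_le (fun i => q * l * w i) (m := l * ρ * N) fun φ hφ _ _ => hφ).trans
        (ENNReal.ofReal_le_ofReal (Real.exp_le_exp.2 ?_))
      have e : ∑ i ∈ Finset.range (N + 1), (q * l * w i) ^ 2 / 2 =
          l ^ 2 / 2 * ∑ i ∈ Finset.range (N + 1), w i ^ 2 := by
        rw [Finset.mul_sum]
        refine Finset.sum_congr rfl fun i _ => ?_
        rw [mul_pow, mul_pow, hq]
        ring
      have h5 : l ^ 2 * δ ≤ 1 := by
        rw [lt_div_iff₀ (by positivity)] at hδl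
        linarith
      have h6 : l ^ 2 / 2 * ∑ i ∈ Finset.range (N + 1), w i ^ 2 ≤ l ^ 2 / 2 * (N * δ + 1) :=
        mul_le_mul_of_nonneg_left (sum_endWeight_sq_le hN hδ0) (by positivity)
      rw [e, hlρ]
      have h7 : l ^ 2 / 2 * (N * δ + 1) = N / 2 * (l ^ 2 * δ) + l ^ 2 / 2 := by ring
      have h8 : (N : ℝ) / 2 * (l ^ 2 * δ) ≤ N / 2 * 1 := by gcongr
      have h9 : c * N ≤ |c| * N := by gcongr; exact le_abs_self c
      have h10 : M * N ≤ |M| * N := by gcongr; exact le_abs_self M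
      linarith
    have hcover : P N (profile N ⁻¹' U) ≤
        P N ({φ | l * ρ * N ≤ ∑ i ∈ Finset.range (N + 1), (1 * l * w i) * discreteLaplacian φ i} ∪
          {φ | l * ρ * N ≤ ∑ i ∈ Finset.range (N + 1), (-1 * l * w i) * discreteLaplacian φ i}) := by
      refine measure_mono_ae ?_
      filter_upwards [hβN] with φ hφ hmem
      have h5 := sum_endWeight hN hδ0 t rfl hφ
      have h6 : ρ < |(profile N φ 1 - profile N φ t) / δ - β| := hmem
      have h7 : ∀ q : ℝ, ∑ i ∈ Finset.range (N + 1), (q * l * w i) * discreteLaplacian φ i =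
          q * l * N * (β - (profile N φ 1 - profile N φ t) / δ) := fun q => by
        rw [mul_assoc (q * l), ← h5, Finset.mul_sum]
        exact Finset.sum_congr rfl fun i _ => by ring
      have hlN : 0 < l * N := by positivity
      rcases lt_abs.1 h6 with h8 | h8
      · refine Or.inr ?_
        change l * ρ * N ≤ _
        rw [h7]
        nlinarith [mul_lt_mul_of_pos_left h8 hlN]
      · refine Or.inl ?_
        change l * ρ * N ≤ _
        rw [h7]
        nlinarith [mul_lt_mul_of_pos_left h8 hlN]
    refine hcover.trans ((measure_union_le _ _).trans ((add_le_add (hone 1 (by norm_num))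
      (hone (-1) (by norm_num))).trans (le_of_eq ?_)))
    rw [ENNReal.ofReal_mul zero_le_two, ENNReal.ofReal_ofNat, two_mul]

/-! ## The lower bound for the Gaussian model -/

lemma sq_le_exp_add_exp_neg (x : ℝ) : x ^ 2 ≤ Real.exp x + Real.exp (-x) := by
  have h1 : |x / 2| ≤ Real.sinh |x / 2| := Real.self_le_sinh_iff.2 (abs_nonneg _)
  have h2 := pow_le_pow_left₀ (abs_nonneg _) h1 2
  rw [← Real.abs_sinh, sq_abs, sq_abs] at h2
  have h3 := Real.cosh_two_mul (x / 2)
  rw [mul_div_cancel₀ x two_ne_zero, Real.cosh_eq x, Real.cosh_sq] at h3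
  linarith [show (x / 2) ^ 2 = x ^ 2 / 4 by ring]

/-- With zero boundary values the profile of the Gaussian field is small. -/
lemma measure_profile_zero_boundary_ge_le {N : ℕ} (hN : 0 < N) {ε : ℝ} (hε : 0 < ε) :
    gibbsMeasure gaussianPotential N 0 (innerSites N) {φ | ∃ t : I, ε ≤ |profile N φ t|} ≤
      ENNReal.ofReal (4 * (4 * Real.exp (1 / 2)) / ε ^ 2 / N) := by
  have h1N : (1 : ℝ) ≤ N := by exact_mod_cast hN
  have hzero : laplacianVector N (glue 0 (innerSites N) 0) = 0 := by
    rw [← dirichletMap_apply, map_zero]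
  have heq : IsEquilibrium N 0 0 := fun y => by rw [hzero, inner_zero_right]
  have hae : ∀ k ∉ innerSites N, ∀ᵐ φ ∂gibbsMeasure gaussianPotential N 0 (innerSites N), φ k = 0 :=
    fun k hk => ae_gibbsMeasure_eq _ N 0 _ hk
  have h0 := hae 0 (by simp)
  have h0' := hae (-1) (by simp)
  refine measure_profile_ge_le (ζ := fun φ => φ) hN measurable_pi_apply h0 (fun i hi => ?_)
    (by positivity) hε
  -- With zero left boundary values, the slope after site `i` is the sum of the Laplacians up to
  -- `i`, so these weights represent `q` times that slope.
  set u : ℝ → ℕ → ℝ := fun q j => q * (if j ≤ i then 1 else 0) with hu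
  set n : ℝ := N + 1 with hn
  have hn0 : 0 < n := by positivity
  have hsum : ∀ φ : ℤ → ℝ, φ 0 = 0 → φ (-1) = 0 → ∀ q : ℝ,
      ∑ j ∈ Finset.range (N + 1), u q j * discreteLaplacian φ j = q * (φ (i + 1) - φ i) := by
    intro φ hφ hφ' q
    rw [slope_eq_sum, hφ, hφ', sub_zero, zero_add, Finset.mul_sum]
    have hsub : Finset.range (i + 1) ⊆ Finset.range (N + 1) := by
      refine Finset.range_mono ?_
      have := Finset.mem_range.1 hi
      omega
    rw [← Finset.sum_subset hsub fun j _ hj => by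
      simp only [hu]
      rw [if_neg (by rw [Finset.mem_range] at hj; omega)]
      ring]
    refine Finset.sum_congr rfl fun j hj => ?_
    simp only [hu]
    rw [if_pos (by rw [Finset.mem_range] at hj; omega), mul_one]
  have hexp : ∀ q : ℝ, q ^ 2 * n = 1 →
      ∫⁻ φ, ENNReal.ofReal (Real.exp (∑ j ∈ Finset.range (N + 1), u q j * discreteLaplacian φ j))
        ∂gibbsMeasure gaussianPotential N 0 (innerSites N) ≤ ENNReal.ofReal (Real.exp (1 / 2)) := by
    intro q hq
    refine (heq.lintegral_exp_le (u q)).trans (ENNReal.ofReal_le_ofReal (Real.exp_le_exp.2 ?_))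
    rw [hzero, norm_zero]
    have : ∑ j ∈ Finset.range (N + 1), u q j ^ 2 / 2 ≤ ∑ j ∈ Finset.range (N + 1), q ^ 2 / 2 :=
      Finset.sum_le_sum fun j _ => by
        simp only [hu]
        split_ifs
        · rw [mul_one]
        · rw [mul_zero]; nlinarith [sq_nonneg q]
    rw [Finset.sum_const, Finset.card_range, nsmul_eq_mul] at this
    push_cast at this
    rw [← hn] at this
    nlinarith
  -- At the scale `n^(-1/2)` the rescaled slope has exponential moments bounded independently of
  -- `N`; undoing the scaling gives a second moment of order `N`.
  set q : ℝ := (Real.sqrt n)⁻¹ with hq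
  have hq2 : q ^ 2 * n = 1 := by
    rw [hq, inv_pow, Real.sq_sqrt hn0.le, inv_mul_cancel₀ hn0.ne']
  have hm : ∀ q : ℝ, Measurable fun φ : ℤ → ℝ =>
      ENNReal.ofReal (Real.exp (∑ j ∈ Finset.range (N + 1), u q j * discreteLaplacian φ j)) := by
    intro q
    have h1 : Measurable fun φ : ℤ → ℝ =>
        ∑ j ∈ Finset.range (N + 1), u q j * discreteLaplacian φ j :=
      Finset.measurable_fun_sum _ fun j _ => (measurable_discreteLaplacian j).const_mul _
    fun_prop
  calc ∫⁻ φ, ENNReal.ofReal ((φ (i + 1) - φ i) ^ 2)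
        ∂gibbsMeasure gaussianPotential N 0 (innerSites N)
      ≤ ∫⁻ φ, ENNReal.ofReal n * (ENNReal.ofReal (Real.exp (∑ j ∈ Finset.range (N + 1),
          u q j * discreteLaplacian φ j)) + ENNReal.ofReal (Real.exp (∑ j ∈ Finset.range (N + 1),
          u (-q) j * discreteLaplacian φ j))) ∂gibbsMeasure gaussianPotential N 0 (innerSites N) := by
        refine lintegral_mono_ae ?_
        filter_upwards [h0, h0'] with φ hφ hφ'
        rw [hsum φ hφ hφ', hsum φ hφ hφ', ← ENNReal.ofReal_add (Real.exp_pos _).le (Real.exp_pos _).le,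
          ← ENNReal.ofReal_mul hn0.le]
        refine ENNReal.ofReal_le_ofReal ?_
        have h2 := sq_le_exp_add_exp_neg (q * (φ (i + 1) - φ i))
        rw [neg_mul]
        calc (φ (i + 1) - φ i) ^ 2 = n * (q * (φ (i + 1) - φ i)) ^ 2 := by
              rw [mul_pow, ← mul_assoc, mul_comm n, hq2, one_mul]
          _ ≤ _ := by gcongr
    _ ≤ ENNReal.ofReal n * (ENNReal.ofReal (Real.exp (1 / 2)) + ENNReal.ofReal (Real.exp (1 / 2))) := by
        rw [lintegral_const_mul' _ _ ENNReal.ofReal_ne_top, lintegral_add_left (hm q)]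
        gcongr
        · exact hexp q hq2
        · exact hexp (-q) (by rw [neg_sq]; exact hq2)
    _ ≤ ENNReal.ofReal (4 * Real.exp (1 / 2) * N) := by
        rw [← ENNReal.ofReal_add (Real.exp_pos _).le (Real.exp_pos _).le, ← ENNReal.ofReal_mul hn0.le]
        refine ENNReal.ofReal_le_ofReal ?_
        have := Real.exp_pos (1 / 2)
        rw [hn]
        nlinarith

lemma profile_congr {N : ℕ} {φ χ : ℤ → ℝ} (h : ∀ k : ℤ, -1 ≤ k → k ≤ N + 1 → φ k = χ k) (t : I) :
    profile N φ t = profile N χ t := by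
  have := floor_le_of_mem N t
  rw [profile_apply_floor, profile_apply_floor, h _ (by omega) (by omega), h _ (by omega) (by omega)]

lemma eventually_half_le_gaussLaw {ε : ℝ} (hε : 0 < ε) : ∀ᶠ N : ℕ in atTop, (2 : ℝ≥0∞)⁻¹ ≤
    gaussLaw (dirichletMap N) {y | ∀ t : I, |profile N (glue 0 (innerSites N) y) t| < ε} := by
  have hlim : Tendsto (fun N : ℕ => ENNReal.ofReal (4 * (4 * Real.exp (1 / 2)) / ε ^ 2 / N)) atTop
      (𝓝 0) := by
    rw [← ENNReal.ofReal_zero]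
    exact ENNReal.tendsto_ofReal (tendsto_const_div_atTop_nhds_zero_nat _)
  filter_upwards [hlim.eventually (gt_mem_nhds (show (0 : ℝ≥0∞) < 2⁻¹ by simp)),
    eventually_gt_atTop 0] with N hsmall hN
  have hprob := isProbabilityMeasure_gaussLaw (dirichletMap_injective N)
  have heq : IsEquilibrium N 0 0 := fun y => by
    rw [← dirichletMap_apply, map_zero, inner_zero_right]
  have h1 := measure_profile_zero_boundary_ge_le hN hε
  have hS : MeasurableSet {φ : ℤ → ℝ | ∀ t : I, |profile N φ t| < ε} :=
    measurableSet_profile_lt N measurable_id hε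
  have hc : {φ : ℤ → ℝ | ∃ t : I, ε ≤ |profile N φ t|} =
      {φ : ℤ → ℝ | ∀ t : I, |profile N φ t| < ε}ᶜ := by
    ext φ
    exact (not_forall.trans (exists_congr fun t => not_lt)).symm
  rw [hc, heq.gibbsMeasure_eq, Measure.map_apply (measurable_glue_add N 0 0) hS.compl] at h1
  simp only [zero_add] at h1
  set B := {y | ∀ t : I, |profile N (glue 0 (innerSites N) y) t| < ε} with hB
  have h2 : gaussLaw (dirichletMap N) Bᶜ ≤ 2⁻¹ := h1.trans hsmall.le
  have h3 : 1 ≤ gaussLaw (dirichletMap N) B + gaussLaw (dirichletMap N) Bᶜ := by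
    rw [measure_add_measure_compl (measurableSet_profile_lt N (measurable_glue 0 _) hε), measure_univ]
  rw [← ENNReal.one_sub_inv_two]
  exact tsub_le_iff_right.2 (h3.trans (by gcongr))

/-- A small symmetric ball around the equilibrium is moved onto the sampled profile. The cost of the
translation is the excess of the sampled energy over the equilibrium energy, at most `(v - c) N` up
to a constant. -/
theorem eventually_le_dirichletGibbs {a α b β r s : ℝ} (h1 : β - α = r + s / 2)
    (h2 : b - a - α = r / 2 + s / 6) {h : C(I, ℝ)} {g : ℝ → ℝ} (hh : IsSecondPrimitive a α g h)
    (hg : IsAdmissible a α b β g) {v M : ℝ} (hv0 : 0 ≤ v)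
    (hv : ∫⁻ t in Set.Ioo (0 : ℝ) 1, legE (fun s => s ^ 2 / 2) (g t) ≤ ENNReal.ofReal v)
    (hM : v - (r ^ 2 + r * s + s ^ 2 / 3) / 2 < M) {U : Set C(I, ℝ)} (hU : IsOpen U) (hhU : h ∈ U) :
    ∀ᶠ N : ℕ in atTop, ENNReal.ofReal (Real.exp (-(M * N))) ≤
      dirichletGibbs gaussianPotential a α b β N (profile N ⁻¹' U) := by
  obtain ⟨ε, hε, hball⟩ := Metric.isOpen_iff.1 hU h hhU
  set c := (r ^ 2 + r * s + s ^ 2 / 3) / 2 with hc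
  set C := r ^ 2 + |r * s| + s ^ 2 with hC
  have hlim : ∀ᶠ N : ℕ in atTop, (|α| + ∫ s in Set.Ioo (0 : ℝ) 1, |g s|) / N < ε / 2 :=
    (tendsto_const_div_atTop_nhds_zero_nat _).eventually (gt_mem_nhds (by positivity))
  filter_upwards [eventually_half_le_gaussLaw (show 0 < ε / 2 by positivity), hlim,
    eventually_gt_atTop 0, eventually_const_mul_ofReal_exp_le hM 2 C] with N hhalf hBN hN hexp
  set ψ := dirichletBoundary a α b β N with hψ
  set χ := gridField (secondPrimitive a α g) N with hχ
  obtain ⟨x₀, hx₀⟩ := exists_isEquilibrium N ψ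
  set B := {y | ∀ t : I, |profile N (glue 0 (innerSites N) y) t| < ε / 2} with hB
  have hBm : MeasurableSet B := measurableSet_profile_lt N (measurable_glue 0 _) (by positivity)
  have hglue_neg : ∀ y : innerSites N → ℝ,
      glue 0 (innerSites N) (-y) = fun k => -glue 0 (innerSites N) y k := fun y => by
    funext k
    by_cases hk : k ∈ innerSites N <;> simp [glue, hk]
  have hsymm : ∀ y, -y ∈ B ↔ y ∈ B := fun y => by
    have : ∀ t : I, profile N (glue 0 (innerSites N) (-y)) t =
        -profile N (glue 0 (innerSites N) y) t := fun t => by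
      rw [hglue_neg]
      simp only [profile, ContinuousMap.coe_mk]
      ring
    simp only [hB, Set.mem_ofPred_eq, this, abs_neg]
  -- The displacement from the equilibrium to the sampled profile.
  set v₀ : innerSites N → ℝ := (fun k : innerSites N => χ k) - x₀ with hv₀
  have hshift := mul_gaussLaw_le (A := dirichletMap N) (-v₀) hBm hsymm
  rw [map_neg, norm_neg] at hshift
  -- By Pythagoras the left side is the sampled energy, at most `v N`, minus the equilibrium energy,
  -- at least `c N - C`.
  have henergy : ‖dirichletMap N v₀‖ ^ 2 / 2 ≤ (v - c) * N + C := by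
    have e1 := hx₀.norm_sq_gridField hN hg
    have e2 := norm_sq_gridField_le (a := a) (α := α) hg.integrableOn hN hv0 hv
    have e3 := le_norm_sq_laplacianVector h1 h2 hN x₀
    rw [← hc, ← hC] at e3
    rw [e1] at e2
    linarith
  have hsub : {y | y + -v₀ ∈ B} ⊆ (fun y => glue ψ (innerSites N) (x₀ + y)) ⁻¹' (profile N ⁻¹' U) := by
    intro y hy
    refine hball ?_
    rw [Metric.mem_ball, ContinuousMap.dist_lt_iff hε]
    intro t
    have e1 : |profile N (glue 0 (innerSites N) (y + -v₀)) t| < ε / 2 := hy t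
    have e2 : profile N (glue ψ (innerSites N) (x₀ + y)) t - profile N χ t =
        profile N (glue 0 (innerSites N) (y + -v₀)) t := by
      have e3 : profile N χ t = profile N (glue ψ (innerSites N) (x₀ + v₀)) t := by
        refine profile_congr (fun k h3 h4 => ?_) t
        rw [hv₀, add_sub_cancel]
        exact (glue_eq_of_boundary (fun k hk h1 h2 => hg.gridField_eq hN k hk h1 h2) h3 h4).symm
      rw [e3, profile_sub]
      congr 2
      funext k
      by_cases hk : k ∈ innerSites N
      · simp only [glue, hk, dif_pos, Pi.add_apply, Pi.neg_apply]
        ring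
      · simp [glue, hk]
    have e4 := abs_profile_gridField_sub_le (a := a) (α := α) hg.integrableOn hN t
    rw [← e2] at e1
    rw [Real.dist_eq, hh.apply_eq t]
    rw [abs_lt] at e1 ⊢
    rw [abs_le] at e4
    constructor <;> linarith [e1.1, e1.2, e4.1, e4.2]
  have hlow : ENNReal.ofReal (Real.exp (-((v - c) * N + C))) * 2⁻¹ ≤
      dirichletGibbs gaussianPotential a α b β N (profile N ⁻¹' U) := by
    rw [dirichletGibbs, hx₀.gibbsMeasure_eq, Measure.map_apply (measurable_glue_add N ψ x₀)
      (measurable_profile_preimage N hU)]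
    refine le_trans ?_ (hshift.trans (measure_mono hsub))
    gcongr
  refine le_trans ?_ hlow
  have h3 : ENNReal.ofReal (Real.exp (-(M * N))) * 2 ≤
      ENNReal.ofReal (Real.exp (-((v - c) * N + C))) := by
    rw [← ENNReal.ofReal_ofNat, ← ENNReal.ofReal_mul (Real.exp_pos _).le]
    have h4 := mul_le_mul_left hexp (ENNReal.ofReal (Real.exp (-C)))
    rw [← ENNReal.ofReal_mul' (Real.exp_pos _).le, ← ENNReal.ofReal_mul' (Real.exp_pos _).le,
      mul_assoc, ← Real.exp_add, ← Real.exp_add] at h4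
    convert h4 using 2
    · rw [mul_comm]; congr 2; ring
    · congr 1; ring
  calc ENNReal.ofReal (Real.exp (-(M * N)))
      = ENNReal.ofReal (Real.exp (-(M * N))) * 2 * 2⁻¹ := by
        rw [mul_assoc, ENNReal.mul_inv_cancel two_ne_zero ENNReal.ofNat_ne_top, mul_one]
    _ ≤ _ := by gcongr

/-! ## The large deviation principle for the Gaussian model -/

section
variable {a α b β r s : ℝ}

lemma affine_energy_nonneg (r s : ℝ) : 0 ≤ (r ^ 2 + r * s + s ^ 2 / 3) / 2 := by
  nlinarith [sq_nonneg (r + s / 2), sq_nonneg s]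

/-- The bound is inherited from the discrete one: sampling an admissible `g` of energy below `c`
would produce discrete energies below `c N - C` for large `N`. -/
lemma ofReal_le_dirichletRate (h1 : β - α = r + s / 2) (h2 : b - a - α = r / 2 + s / 6)
    (h : C(I, ℝ)) :
    ENNReal.ofReal ((r ^ 2 + r * s + s ^ 2 / 3) / 2) ≤ dirichletRate a α b β h := by
  by_contra hlt
  obtain ⟨g, -, hg, hlt⟩ := exists_isAdmissible_of_dirichletRate_lt (not_le.1 hlt)
  set c := (r ^ 2 + r * s + s ^ 2 / 3) / 2 with hc
  set E := ∫⁻ t in Set.Ioo (0 : ℝ) 1, legE (fun s => s ^ 2 / 2) (g t) with hE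
  have hfin : E ≠ ∞ := (hlt.trans_le le_top).ne
  have hv : E.toReal < c := (ENNReal.lt_ofReal_iff_toReal_lt hfin).1 hlt
  obtain ⟨N, hN⟩ := exists_nat_gt ((r ^ 2 + |r * s| + s ^ 2) / (c - E.toReal))
  have hN0 : (0 : ℝ) < N := lt_of_le_of_lt (div_nonneg (by positivity) (by linarith)) hN
  have hN0' : 0 < N := by exact_mod_cast hN0
  obtain ⟨x₀, hx₀⟩ := exists_isEquilibrium N (dirichletBoundary a α b β N)
  have e1 := hx₀.norm_sq_gridField hN0' hg
  have e2 := norm_sq_gridField_le (a := a) (α := α) hg.integrableOn hN0' ENNReal.toReal_nonneg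
    (ENNReal.ofReal_toReal hfin).ge
  have e3 := le_norm_sq_laplacianVector h1 h2 hN0' x₀
  rw [div_lt_iff₀ (by linarith)] at hN
  rw [← hc] at e3
  rw [e1] at e2
  nlinarith [sq_nonneg ‖dirichletMap N ((fun k : innerSites N =>
    gridField (secondPrimitive a α g) N k) - x₀)‖]

lemma iInf_dirichletRate (h1 : β - α = r + s / 2) (h2 : b - a - α = r / 2 + s / 6) :
    ⨅ h, dirichletRate a α b β h = ENNReal.ofReal ((r ^ 2 + r * s + s ^ 2 / 3) / 2) := by
  refine le_antisymm ?_ (le_iInf (ofReal_le_dirichletRate h1 h2))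
  obtain ⟨h, hh⟩ := exists_isSecondPrimitive_affine a α r s
  refine (iInf_le _ h).trans ((dirichletRate_le hh (isAdmissible_affine h1 h2)).trans (le_of_eq ?_))
  exact lintegral_legE_affine r s

/-- The equilibrium energy is at most that of the sampled minimiser. The constant in the exponential
bound is therefore the infimum of the rate, so an energy level `M₁` yields the decay rate `M₁ - c`.
-/
lemma eventually_expBound_dirichletGibbs (h1 : β - α = r + s / 2)
    (h2 : b - a - α = r / 2 + s / 6) : ∀ᶠ N : ℕ in atTop,
      ExpBound a α (fun s => s ^ 2 / 2) ((r ^ 2 + r * s + s ^ 2 / 3) / 2) N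
        (dirichletGibbs gaussianPotential a α b β N) := by
  filter_upwards [eventually_gt_atTop 0] with N hN
  obtain ⟨x₀, hx₀⟩ := exists_isEquilibrium N (dirichletBoundary a α b β N)
  have hg := isAdmissible_affine h1 h2
  refine expBound_dirichletGibbs hx₀ (le_trans ?_ (norm_sq_gridField_le (a := a) (α := α)
    hg.integrableOn hN (affine_energy_nonneg r s) (lintegral_legE_affine r s).le))
  rw [hx₀.norm_sq_gridField hN hg]
  linarith [sq_nonneg ‖dirichletMap N ((fun k : innerSites N =>
    gridField (secondPrimitive a α fun t => r + s * t) N k) - x₀)‖]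

lemma isProbabilityMeasure_dirichletGibbs (a α b β : ℝ) (N : ℕ) :
    IsProbabilityMeasure (dirichletGibbs gaussianPotential a α b β N) := by
  obtain ⟨x₀, hx₀⟩ := exists_isEquilibrium N (dirichletBoundary a α b β N)
  have := isProbabilityMeasure_gaussLaw (dirichletMap_injective N)
  rw [dirichletGibbs, hx₀.gibbsMeasure_eq]
  exact Measure.isProbabilityMeasure_map (measurable_glue_add N _ x₀).aemeasurable

lemma profile_one {N : ℕ} (φ : ℤ → ℝ) : profile N φ 1 = φ N / (N : ℝ) ^ 2 := by
  rw [profile_apply_floor]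
  simp

lemma ae_dirichletGibbs_right (V : ℝ → EReal) (a α b β : ℝ) {N : ℕ} (hN : 0 < N) :
    ∀ᵐ φ ∂dirichletGibbs V a α b β N, φ N = b * N ^ 2 ∧ φ (N + 1) - φ N = β * N := by
  filter_upwards [ae_dirichletGibbs V (a := a) (α := α) (b := b) (β := β) (N := N) N (by simp),
    ae_dirichletGibbs V (a := a) (α := α) (b := b) (β := β) (N := N) (N + 1) (by simp)] with φ h1 h2
  rw [h1, h2, dirichletBoundary_right hN, dirichletBoundary_right_add_one]
  exact ⟨rfl, by ring⟩

/-- Profiles that are not admissible for the Dirichlet problem. -/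
lemma exists_open_of_not_rightBoundary {c : ℝ}
    (hexp : ∀ᶠ N : ℕ in atTop, ExpBound a α (fun s => s ^ 2 / 2) c N
      (dirichletGibbs gaussianPotential a α b β N)) {h : C(I, ℝ)} {g : ℝ → ℝ}
    (hg : IsSecondPrimitive a α g h) (hn : ¬RightBoundary b β h) (M : ℝ) :
    ∃ U, IsOpen U ∧ h ∈ U ∧ ∀ᶠ N : ℕ in atTop,
      dirichletGibbs gaussianPotential a α b β N (profile N ⁻¹' U) ≤
        ENNReal.ofReal (Real.exp (-(M * N))) := by
  by_cases hb : h 1 = b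
  · have hd := hg.hasDerivWithinAt (t := 1) (by simp)
    have hv : α + ∫ s in (0 : ℝ)..1, g s ≠ β := fun hv => hn ⟨hb, hv ▸ hd⟩
    obtain ⟨U, hU, hh, D, hD⟩ := exists_open_of_slope_ne hexp ((eventually_gt_atTop 0).mono
      fun N hN => (ae_dirichletGibbs_right gaussianPotential a α b β hN).mono fun φ hφ => hφ.2)
      hd hv (M + 1)
    refine ⟨U, hU, hh, ?_⟩
    filter_upwards [hD, eventually_const_mul_ofReal_exp_le (show M < M + 1 by linarith) 2 D]
      with N h3 h4 using h3.trans h4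
  · refine ⟨{f | f 1 ≠ b}, isOpen_ne_fun (continuous_eval_const (F := C(I, ℝ)) 1) continuous_const,
      hb, ?_⟩
    filter_upwards [eventually_gt_atTop 0] with N hN
    have hN' : (N : ℝ) ≠ 0 := by exact_mod_cast hN.ne'
    have hz : dirichletGibbs gaussianPotential a α b β N (profile N ⁻¹' {f | f 1 ≠ b}) = 0 := by
      have hae : ∀ᵐ φ ∂dirichletGibbs gaussianPotential a α b β N, profile N φ 1 = b := by
        filter_upwards [ae_dirichletGibbs_right gaussianPotential a α b β hN] with φ hφ
        rw [profile_one, hφ.1]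
        field_simp
      exact ae_iff.1 hae
    rw [hz]
    exact zero_le

end

theorem satisfiesLDP_dirichletGibbs (a α b β : ℝ) :
    SatisfiesLDP (dirichletGibbs gaussianPotential a α b β) profile
      (normalised (dirichletRate a α b β)) := by
  obtain ⟨r, s, h1, h2⟩ := exists_isAdmissible_affine a α b β
  have hinf := iInf_dirichletRate h1 h2
  have hexp := eventually_expBound_dirichletGibbs h1 h2
  have hle := ofReal_le_dirichletRate h1 h2
  have hc0 := affine_energy_nonneg r s
  have hlow : ∀ {h : C(I, ℝ)} {g : ℝ → ℝ}, IsSecondPrimitive a α g h → IsAdmissible a α b β g →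
      ∀ {v M : ℝ}, 0 ≤ v →
      ∫⁻ t in Set.Ioo (0 : ℝ) 1, legE (fun s => s ^ 2 / 2) (g t) ≤ ENNReal.ofReal v →
      v - (r ^ 2 + r * s + s ^ 2 / 3) / 2 < M → ∀ {U : Set C(I, ℝ)}, IsOpen U → h ∈ U →
      ∀ᶠ N : ℕ in atTop, ENNReal.ofReal (Real.exp (-(M * N))) ≤
        dirichletGibbs gaussianPotential a α b β N (profile N ⁻¹' U) :=
    fun hh hg _ _ hv0 hv hM _ hU hhU => eventually_le_dirichletGibbs h1 h2 hh hg hv0 hv hM hU hhU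
  set c := (r ^ 2 + r * s + s ^ 2 / 3) / 2
  refine SatisfiesLDP.of_local (fun h M hM => ?_) (fun M => exponentially_tight hexp M)
    (fun h M hM U hU hh => ?_)
  · rcases lt_or_ge M 0 with hM0 | hM0
    · refine ⟨Set.univ, isOpen_univ, Set.mem_univ h, Eventually.of_forall fun N => ?_⟩
      have := isProbabilityMeasure_dirichletGibbs a α b β N
      refine prob_le_one.trans ?_
      rw [← ENNReal.ofReal_one]
      refine ENNReal.ofReal_le_ofReal (Real.one_le_exp ?_)
      nlinarith [(Nat.cast_nonneg N : (0 : ℝ) ≤ N)]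
    · have hM' : ENNReal.ofReal (M + c) < dirichletRate a α b β h := by
        rw [ENNReal.ofReal_add hM0 hc0, ← lt_tsub_iff_right, ← hinf,
          ← EReal.coe_ennreal_lt_coe_ennreal_iff, EReal.coe_ennreal_ofReal, max_eq_left hM0]
        exact hM
      obtain ⟨M₁, hM₁0, hM₁, hM₁'⟩ := ENNReal.lt_iff_exists_real_btwn.1 hM'
      have hM₁c : M + c < M₁ := (ENNReal.ofReal_lt_ofReal_iff_of_nonneg (by linarith)).1 hM₁
      -- Beyond the level `M₁` there are two possibilities: either the energy itself exceeds `M₁`,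
      -- or it does not and the right boundary condition fails, in which case the decay is faster
      -- than any given rate.
      by_cases hg : ∃ g, IsSecondPrimitive a α g h ∧
          ∫⁻ t in Set.Ioo (0 : ℝ) 1, legE (fun s => s ^ 2 / 2) (g t) ≤ ENNReal.ofReal M₁
      · obtain ⟨g, hg, hgle⟩ := hg
        refine exists_open_of_not_rightBoundary hexp hg (fun hr => ?_) M
        exact absurd (hM₁'.trans_le ((dirichletRate_le hg (hg.rightBoundary_iff.1 hr)).trans hgle))
          (lt_irrefl _)
      · have hconv : ConvexOn ℝ Set.univ fun s : ℝ => s ^ 2 / 2 := by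
          have := (even_two.convexOn_pow (𝕜 := ℝ)).smul (show (0 : ℝ) ≤ 1 / 2 by norm_num)
          refine this.congr fun x _ => ?_
          simp only [smul_eq_mul]
          ring
        obtain ⟨U, hU, hh, D, hD⟩ := exists_open_of_not_isSecondPrimitive hconv (by norm_num)
          (fun s => by positivity) hexp h hg
        refine ⟨U, hU, hh, ?_⟩
        filter_upwards [hD, eventually_const_mul_ofReal_exp_le (show M < M₁ - c by linarith) 1 D]
          with N h5 h6
        refine h5.trans (le_trans (le_of_eq ?_) h6)
        rw [one_mul]
  · have h0 : (0 : EReal) < M := (EReal.coe_ennreal_nonneg _).trans_lt hM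
    have h0' : 0 < M := EReal.coe_pos.1 h0
    have hM' : dirichletRate a α b β h < ENNReal.ofReal (M + c) := by
      rw [ENNReal.ofReal_add h0'.le hc0, ← ENNReal.sub_lt_iff_lt_right ENNReal.ofReal_ne_top (hle h),
        ← hinf, ← EReal.coe_ennreal_lt_coe_ennreal_iff, EReal.coe_ennreal_ofReal, max_eq_left h0'.le]
      exact hM
    obtain ⟨g, hg, hga, hlt⟩ := exists_isAdmissible_of_dirichletRate_lt hM'
    have hfin : ∫⁻ t in Set.Ioo (0 : ℝ) 1, legE (fun s => s ^ 2 / 2) (g t) ≠ ∞ :=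
      (hlt.trans_le le_top).ne
    have h3 := (ENNReal.lt_ofReal_iff_toReal_lt hfin).1 hlt
    exact hlow hg hga ENNReal.toReal_nonneg (ENNReal.ofReal_toReal hfin).ge (by linarith) hU hh

/-- Since the infimum is finite, adding it back shifts the sublevel sets; below the infimum they are
empty. -/
lemma IsGoodRateFunction.of_normalised {E : Type*} [TopologicalSpace E] {J : E → ℝ≥0∞}
    (hJ : IsGoodRateFunction (normalised J)) (hfin : ⨅ h, J h ≠ ∞) : IsGoodRateFunction J := by
  have heq : J = fun h => normalised J h + ⨅ h, J h := by
    funext h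
    rw [normalised, tsub_add_cancel_of_le (iInf_le _ h)]
  refine ⟨?_, fun c => ?_⟩
  · rw [heq]
    exact hJ.lowerSemicontinuous.add lowerSemicontinuous_const
  · have : {h | J h ≤ c} = if ⨅ h, J h ≤ c then {h | normalised J h ≤ (c - (⨅ h, J h).toNNReal : ℝ≥0)}
        else ∅ := by
      ext h
      split_ifs with hc
      · change J h ≤ c ↔ J h - (⨅ h, J h) ≤ _
        rw [ENNReal.coe_sub, ENNReal.coe_toNNReal hfin, tsub_le_iff_right, tsub_add_cancel_of_le hc]
      · exact iff_of_false (fun hh => hc ((iInf_le _ h).trans hh)) (Set.notMem_empty h)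
    rw [this]
    split_ifs
    · exact hJ.isCompact_sublevel _
    · exact isCompact_empty

theorem isGoodRateFunction_dirichletRate (a α b β : ℝ) :
    IsGoodRateFunction (dirichletRate a α b β) := by
  obtain ⟨r, s, h1, h2⟩ := exists_isAdmissible_affine a α b β
  refine (satisfiesLDP_dirichletGibbs a α b β).good.of_normalised ?_
  rw [iInf_dirichletRate h1 h2]
  exact ENNReal.ofReal_ne_top

end LaplacianModel

theorem mainTheorem2 :
    (∀ (V : ℝ → EReal), IsPotential V →
      (∀ s : ℝ, Integrable (fun x : ℝ => Real.exp (s * x)) (incrementLaw V)) →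
      ∀ a α : ℝ,
        SatisfiesLDP (freeGibbs V a α) profile (freeRate V 1 a α) ∧
        ((∃ C : ℝ, ∀ s : ℝ, logMGF V s ≤ C * (1 + s ^ 2)) →
          SatisfiesLDP (freeGibbs V a α) profile (freeRate V 2 a α))) ∧
    (∀ a α b β : ℝ,
      IsGoodRateFunction (dirichletRate a α b β) ∧
      SatisfiesLDP (dirichletGibbs gaussianPotential a α b β) profile
        (normalised (dirichletRate a α b β))) := by
  refine ⟨fun V hV hμ a α => ⟨satisfiesLDP_freeGibbs hV hμ a α, fun hC => ?_⟩, fun a α b β =>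
    ⟨isGoodRateFunction_dirichletRate a α b β, satisfiesLDP_dirichletGibbs a α b β⟩⟩
  rw [freeRate_two_eq hC]
  exact satisfiesLDP_freeGibbs hV hμ a α
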